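/- Let $\{\varepsilon(u,v)\}_{(u,v)\in\mathbb Z^2}$ be i.i.d. real random variables with $\mathbb E\varepsilon=0$, $\mathbb E\varepsilon^2=1$, let $k\ge 1$ be an integer, and suppose $\mathbb E|\varepsilon|^{2k}<\infty$. Let $q_1,q_2>0$ satisfy $1<Q:=\frac1{q_1}+\frac1{q_2}<2$, put $\rho(t,s):=(|t|^2+|s|^{2q_2/q_1})^{1/2}$, and let $a:\mathbb Z^2\to\mathbb R$ satisfy $$a(t,s)=\rho(t,s)^{-q_1}\Big(L_0\big(t/\rho(t,s)\big)+o(1)\Big),\qquad |t|+|s|\to\infty,$$ where $L_0:[-1,1]\to[0,\infty)$ is bounded and piecewise continuous (continuous off a finite set). Let $$Y(t,s)=\sum_{(u,v)\in\mathbb Z^2}a(t-u,s-v)\,\varepsilon(u,v),\qquad (t,s)\in\mathbb Z^2,$$ the series converging in $L^2$, and let $X(t,s)=A_k(Y(t,s))$, where $$A_k(x)=(-\mathrm i)^k\,\frac{d^k}{du^k}\,\frac{e^{\mathrm iux}}{\mathbb E e^{\mathrm iuY(0,0)}}\Big|_{u=0}$$ is the $k$-th Appell polynomial relative to the common distribution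 of the $Y(t,s)$. Put $p_i:=q_i(2-Q)$ $(i=1,2)$ and $P:=\frac1{p_1}+\frac1{p_2}$. Then every $X(t,s)$ is square integrable with mean zero, and the covariance function $r_X(t,s):=\mathbb E[X(0,0)X(t,s)]$ satisfies the following. (i) If $1\le k<P$ and $L_0$ is not almost everywhere zero on $[-1,1]$, then $\sum_{(t,s)\in\mathbb Z^2}|r_X(t,s)|=\infty$. Moreover, $$\sum_{s\in\mathbb Z}|r_X(0,s)|=\infty\iff kp_2\le 1,\qquad \sum_{t\in\mathbb Z}|r_X(t,0)|=\infty\iff kp_1\le 1.$$ (ii) If $k>P$, then $\sum_{(t,s)\in\mathbb Z^2}|r_X(t,s)|<\infty$. -/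

import Mathlib

open MeasureTheory ProbabilityTheory Filter Topology

noncomputable section

/-- `Q = 1/q₁ + 1/q₂`. -/
def expQ (q₁ q₂ : ℝ) : ℝ := 1 / q₁ + 1 / q₂

/-- `p₁ = q₁ (2 - Q)`. -/
def expP₁ (q₁ q₂ : ℝ) : ℝ := q₁ * (2 - expQ q₁ q₂)

/-- `p₂ = q₂ (2 - Q)`. -/
def expP₂ (q₁ q₂ : ℝ) : ℝ := q₂ * (2 - expQ q₁ q₂)

/-- `P = 1/p₁ + 1/p₂`. -/
def expP (q₁ q₂ : ℝ) : ℝ := 1 / expP₁ q₁ q₂ + 1 / expP₂ q₁ q₂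

/-- The generalized homogeneous "norm" `ρ(t,s) = (|t|² + |s|^{2 q₂/q₁})^{1/2}`. -/
def rho (q₁ q₂ t s : ℝ) : ℝ := (|t| ^ (2 : ℝ) + |s| ^ (2 * q₂ / q₁)) ^ (1 / 2 : ℝ)

/-- A nonnegative bounded function on `[-1,1]` that is piecewise continuous (continuous off a
finite set of points); values outside `[-1,1]` play no role. -/
structure IsAngularFunction (L₀ : ℝ → ℝ) : Prop where
  nonneg : ∀ z ∈ Set.Icc (-1 : ℝ) 1, 0 ≤ L₀ z
  bounded : ∃ C : ℝ, ∀ z ∈ Set.Icc (-1 : ℝ) 1, L₀ z ≤ C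
  piecewise_continuous : ∃ F : Set ℝ, F.Finite ∧ ContinuousOn L₀ (Set.Icc (-1 : ℝ) 1 \ F)

/-- The moving-average coefficients satisfy
`a(t,s) = ρ(t,s)^{-q₁} (L₀(t/ρ(t,s)) + o(1))` as `|t| + |s| → ∞`. -/
structure IsMACoeff (q₁ q₂ : ℝ) (L₀ : ℝ → ℝ) (a : ℤ × ℤ → ℝ) : Prop where
  pos₁ : 0 < q₁
  pos₂ : 0 < q₂
  one_lt_Q : 1 < expQ q₁ q₂
  Q_lt_two : expQ q₁ q₂ < 2
  angular : IsAngularFunction L₀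
  asymp : ∃ e : ℤ × ℤ → ℝ,
    Tendsto e (comap (fun x : ℤ × ℤ => |x.1| + |x.2|) atTop) (𝓝 0) ∧
    ∀ x : ℤ × ℤ, x ≠ 0 →
      a x = rho q₁ q₂ x.1 x.2 ^ (-q₁) * (L₀ ((x.1 : ℝ) / rho q₁ q₂ x.1 x.2) + e x)

variable {Ω : Type*} [MeasurableSpace Ω]

/-- A standardized i.i.d. field of real random variables indexed by `ℤ²`. -/
structure IsStandardIID (ε : ℤ × ℤ → Ω → ℝ) (μ : Measure Ω) : Prop where
  measurable : ∀ x, Measurable (ε x)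
  indep : iIndepFun ε μ
  ident : ∀ x y, IdentDistrib (ε x) (ε y) μ μ
  mean_zero : ∀ x, ∫ ω, ε x ω ∂μ = 0
  var_one : ∀ x, ∫ ω, ε x ω ^ 2 ∂μ = 1

/-- `Y(x) = ∑_{y ∈ ℤ²} a(x - y) ε(y)`, the series converging (unconditionally) in `L²(μ)`. -/
structure IsMovingAverage (a : ℤ × ℤ → ℝ) (ε Y : ℤ × ℤ → Ω → ℝ) (μ : Measure Ω) : Prop where
  memLp : ∀ x, MemLp (Y x) 2 μ
  tendsto : ∀ x, Tendsto
    (fun S : Finset (ℤ × ℤ) => eLpNorm (fun ω => Y x ω - ∑ y ∈ S, a (x - y) * ε y ω) 2 μ)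
    atTop (𝓝 0)

/-- The `k`-th Appell polynomial relative to a distribution `ν` on `ℝ`,
`A_k(x) = (-i)^k d^k/du^k (e^{iux} / ∫ e^{iuξ} ν(dξ))` at `u = 0`. The right-hand side is a real
number when `ν` has a finite `k`-th absolute moment. -/
def appell (k : ℕ) (ν : Measure ℝ) (x : ℝ) : ℝ :=
  ((-Complex.I) ^ k *
    iteratedDeriv k (fun u : ℝ => Complex.exp (Complex.I * u * x) / charFun ν u) 0).re

/-- The subordinated field `X(x) = A_k(Y(x))`, with `A_k` the Appell polynomial relative to the
distribution of `Y(x)`. -/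
def appellField (k : ℕ) (Y : ℤ × ℤ → Ω → ℝ) (μ : Measure Ω) (x : ℤ × ℤ) (ω : Ω) : ℝ :=
  appell k (μ.map (Y x)) (Y x ω)

/-- `r_X(x) = E[X(0,0) X(x)]`. -/
def covFun (X : ℤ × ℤ → Ω → ℝ) (μ : Measure Ω) (x : ℤ × ℤ) : ℝ :=
  ∫ ω, X (0, 0) ω * X x ω ∂μ

end

/-! Put δ = q₂/q₁, N(t,s) = max(1, |t|, |s|^δ) and D = 1 + 1/δ = q₁Q. Of the order of R^D lattice
points satisfy N ≤ R, so ∑ N^(-e) converges for e > D and diverges for 0 < e < D. The coefficients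
are O(N^(-q₁)), and 1 < Q < 2 says exactly that q₁ < D < 2q₁. Hence `a` is square summable, and
splitting ∑ a(v) a(v+x) according to the position of v relative to 0 and -x gives r_Y(x) =
O(N(x)^(-p₁)), because p₁ = 2q₁ - D (`exists_aniWt_correlation_le`). If L₀ is not a.e. zero, it is
bounded below on a curvilinear sector, and a box of about N(x)^D points that stays in the sector
after translation by x gives a lower bound of the same order (`IsMACoeff.exists_correlation_ge`).

It remains to compare r_X with k! r_Y^k. The series ∑ E[A_i(Y(0)) A_j(Y(x))] zⁱ wʲ/(i! j!) is the
joint moment series divided by its two marginals, and for finite truncations of Y it factors over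
the sites into `covSeries`. A logarithmic derivative turns the product into a sum and yields k
G(k,l) = ∑ H(i,j) G(k-i,l-j), where H(i,j) is a joint cumulant times ∑ a(-u)ⁱ a(x-u)ʲ
(`exists_cumulants`). Here H(1,1) is the truncated r_Y(x), while with Z = N(x)^(-q₁) the other terms
are O(Z) off the diagonal and O(Zⁱ) on it (`exists_aniWt_higher_correlation_le`). By
`exists_diagonal_bound`, G(k,k) is H(1,1)^k/k! up to O(N^(-q₁-(k-1)p₁) + N^(-2q₁)).

Since p₁ < q₁, the first error is negligible against N^(-kp₁). The second is summable because 2q₁ >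
D, and is negligible when kp₁ < D. As P = D/p₁, both regimes follow from the sums of powers of N,
over the plane or along an axis. The truncation is removed by convergence in L^{2k}, which comes
from an even-moment inequality. The series are formal, so only moments of order at most 2k matter.
-/

/-! ### Anisotropic size of lattice points -/

/-- Anisotropic size `max(1, |t|, |s|^δ)` of a lattice point `(t, s)`. -/
noncomputable def aniNorm (δ : ℝ) (v : ℤ × ℤ) : ℝ := max 1 (max |(v.1 : ℝ)| (|(v.2 : ℝ)| ^ δ))

theorem one_le_aniNorm (δ : ℝ) (v : ℤ × ℤ) : 1 ≤ aniNorm δ v := le_max_left _ _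

theorem aniNorm_pos (δ : ℝ) (v : ℤ × ℤ) : 0 < aniNorm δ v :=
  one_pos.trans_le (one_le_aniNorm δ v)

theorem aniNorm_neg (δ : ℝ) (v : ℤ × ℤ) : aniNorm δ (-v) = aniNorm δ v := by
  simp [aniNorm]

theorem aniNorm_le_iff {δ R : ℝ} (hδ : 0 < δ) (hR : 1 ≤ R) (v : ℤ × ℤ) :
    aniNorm δ v ≤ R ↔ |(v.1 : ℝ)| ≤ R ∧ |(v.2 : ℝ)| ≤ R ^ (1 / δ) := by
  have h0 : 0 ≤ R := by linarith
  have : |(v.2 : ℝ)| ^ δ ≤ R ↔ |(v.2 : ℝ)| ≤ R ^ (1 / δ) := by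
    rw [one_div]
    exact (Real.le_rpow_inv_iff_of_pos (abs_nonneg _) h0 hδ).symm
  simp [aniNorm, hR, this]

/-- Doubling the box multiplies the first size by 2 and the second by 2^δ; the constant covers both.
A quasi-triangle inequality is all that can be asked for, since |s|^δ is not subadditive when δ > 1.
-/
theorem aniNorm_add_le {δ : ℝ} (hδ : 0 < δ) (u v : ℤ × ℤ) :
    aniNorm δ (u + v) ≤ 2 ^ (1 + δ) * max (aniNorm δ u) (aniNorm δ v) := by
  set M := max (aniNorm δ u) (aniNorm δ v)
  have hM : 1 ≤ M := (one_le_aniNorm δ u).trans (le_max_left _ _)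
  have h2 : (2 : ℝ) ≤ 2 ^ (1 + δ) := by
    conv_lhs => rw [← Real.rpow_one 2]
    exact Real.rpow_le_rpow_of_exponent_le (by norm_num) (by linarith)
  have h2' : (2 : ℝ) ^ δ ≤ 2 ^ (1 + δ) :=
    Real.rpow_le_rpow_of_exponent_le (by norm_num) (by linarith)
  have hu := (aniNorm_le_iff hδ hM u).1 (le_max_left _ _)
  have hv := (aniNorm_le_iff hδ hM v).1 (le_max_right _ _)
  refine max_le (by nlinarith) (max_le ?_ ?_)
  · calc |((u + v).1 : ℝ)| ≤ |(u.1 : ℝ)| + |(v.1 : ℝ)| := by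
          simpa using abs_add_le (u.1 : ℝ) v.1
      _ ≤ 2 * M := by linarith [hu.1, hv.1]
      _ ≤ _ := by gcongr
  · have h1 : |((u + v).2 : ℝ)| ≤ 2 * M ^ (1 / δ) := by
      have := abs_add_le (u.2 : ℝ) v.2
      push_cast [Prod.snd_add]
      linarith [hu.2, hv.2]
    calc |((u + v).2 : ℝ)| ^ δ ≤ (2 * M ^ (1 / δ)) ^ δ := by gcongr
      _ = 2 ^ δ * M := by
          rw [Real.mul_rpow (by norm_num) (by positivity), ← Real.rpow_mul (by linarith),
            one_div, inv_mul_cancel₀ hδ.ne', Real.rpow_one]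
      _ ≤ _ := by gcongr

theorem card_int_abs_le (F : Finset ℤ) {R : ℝ} (hR : 1 ≤ R) (hF : ∀ t ∈ F, |(t : ℝ)| ≤ R) :
    (F.card : ℝ) ≤ 3 * R := by
  have hsub : F ⊆ Finset.Icc (-⌊R⌋) ⌊R⌋ := by
    intro t ht
    have := abs_le.1 (hF t ht)
    rw [Finset.mem_Icc]
    refine ⟨?_, Int.le_floor.2 this.2⟩
    have : -t ≤ ⌊R⌋ := Int.le_floor.2 (by push_cast; linarith)
    linarith
  have h1 : F.card ≤ (⌊R⌋ + 1 - -⌊R⌋).toNat := by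
    simpa [Int.card_Icc] using Finset.card_le_card hsub
  have h0 : (1 : ℤ) ≤ ⌊R⌋ := Int.le_floor.2 (by simpa using hR)
  have h2 : (F.card : ℤ) ≤ 2 * ⌊R⌋ + 1 := by omega
  have h3 : (F.card : ℝ) ≤ 2 * ⌊R⌋ + 1 := by exact_mod_cast h2
  have := Int.floor_le R
  linarith

/-- Such points lie in a box with sides of order R and R^(1/δ), so 1 + 1/δ acts as the homogeneous
dimension of the lattice. -/
theorem card_aniNorm_le {δ : ℝ} (hδ : 0 < δ) {R : ℝ} (hR : 1 ≤ R) (F : Finset (ℤ × ℤ))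
    (hF : ∀ v ∈ F, aniNorm δ v ≤ R) : (F.card : ℝ) ≤ 9 * R ^ (1 + 1 / δ) := by
  have h1 : (F.card : ℝ) ≤ (F.image Prod.fst).card * (F.image Prod.snd).card := by
    rw [← Nat.cast_mul, ← Finset.card_product]
    exact_mod_cast Finset.card_le_card Finset.subset_product
  have h2 : ((F.image Prod.fst).card : ℝ) ≤ 3 * R := by
    refine card_int_abs_le _ hR ?_
    simp only [Finset.mem_image]
    rintro t ⟨v, hv, rfl⟩
    exact ((aniNorm_le_iff hδ hR v).1 (hF v hv)).1
  have h3 : ((F.image Prod.snd).card : ℝ) ≤ 3 * R ^ (1 / δ) := by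
    refine card_int_abs_le _ (Real.one_le_rpow hR (by positivity)) ?_
    simp only [Finset.mem_image]
    rintro t ⟨v, hv, rfl⟩
    exact ((aniNorm_le_iff hδ hR v).1 (hF v hv)).2
  calc (F.card : ℝ) ≤ (3 * R) * (3 * R ^ (1 / δ)) := h1.trans (by gcongr)
    _ = 9 * (R * R ^ (1 / δ)) := by ring
    _ = _ := by rw [Real.rpow_add (by linarith), Real.rpow_one]

/-! ### Power sums under a counting bound -/

section Counting

variable {ι : Type*} {N : ι → ℝ} {B D α : ℝ}

/-- If at most `B R^D` points have size at most `R` then the points of size at most `R` contribute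
`O(R^(D-α))` to `∑ N^(-α)`, provided `α < D`. -/
theorem exists_sum_head_le (hN : ∀ v, 1 ≤ N v)
    (hcard : ∀ R, 1 ≤ R → ∀ F : Finset ι, (∀ v ∈ F, N v ≤ R) → (F.card : ℝ) ≤ B * R ^ D)
    (hB : 0 < B) (hα : 0 < α) (hαD : α < D) :
    ∃ C > 0, ∀ R : ℝ, 0 < R → ∀ F : Finset ι, (∀ v ∈ F, N v ≤ R) →
      ∑ v ∈ F, N v ^ (-α) ≤ C * R ^ (D - α) := by
  classical
  have hθ : (2 : ℝ) ^ (-(D - α)) < 1 :=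
    Real.rpow_lt_one_of_one_lt_of_neg (by norm_num) (by linarith)
  set θ := (2 : ℝ) ^ (-(D - α)) with hθdef
  -- `C` is the fixed point of C = Cθ + B 2^α: passing from R/2 to R multiplies the inductive bound
  -- by θ and adds at most B R^D points, each contributing at most (R/2)^(-α).
  set C := B * 2 ^ α / (1 - θ) with hC
  have hCpos : 0 < C := div_pos (by positivity) (by linarith)
  have hCeq : C * θ + B * 2 ^ α = C := by
    rw [hC]; field_simp [(by linarith : (1 - θ) ≠ 0)]; ring
  refine ⟨C, hCpos, ?_⟩
  have key : ∀ n : ℕ, ∀ R : ℝ, 0 < R → R < 2 ^ n → ∀ F : Finset ι, (∀ v ∈ F, N v ≤ R) →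
      ∑ v ∈ F, N v ^ (-α) ≤ C * R ^ (D - α) := by
    intro n
    induction n with
    | zero =>
      intro R hR hR1 F hF
      have : F = ∅ := by
        refine Finset.eq_empty_of_forall_notMem fun v hv => ?_
        have := hF v hv; have := hN v; simp at hR1; linarith
      subst this; simp; positivity
    | succ n ih =>
      intro R hR hR1 F hF
      by_cases h1 : R < 1
      · have : F = ∅ := by
          refine Finset.eq_empty_of_forall_notMem fun v hv => ?_
          have := hF v hv; have := hN v; linarith
        subst this; simp; positivity
      push Not at h1
      rw [← Finset.sum_filter_add_sum_filter_not F (fun v => N v ≤ R / 2)]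
      have ha := ih (R / 2) (by linarith) (by rw [pow_succ] at hR1; linarith)
        (F.filter (fun v => N v ≤ R / 2)) (by simp)
      have hb : ∑ v ∈ F.filter (fun v => ¬ N v ≤ R / 2), N v ^ (-α)
          ≤ (B * R ^ D) * (R / 2) ^ (-α) := by
        calc _ ≤ ∑ v ∈ F.filter (fun v => ¬ N v ≤ R / 2), (R / 2) ^ (-α) := by
              refine Finset.sum_le_sum fun v hv => ?_
              rw [Finset.mem_filter, not_le] at hv
              exact Real.rpow_le_rpow_of_nonpos (by linarith) hv.2.le (by linarith)
          _ = (F.filter (fun v => ¬ N v ≤ R / 2)).card * (R / 2) ^ (-α) := by simp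
          _ ≤ _ := by
              gcongr
              exact hcard R h1 _ fun v hv => hF v (Finset.mem_filter.1 hv).1
      have e1 : (R / 2) ^ (D - α) = R ^ (D - α) * θ := by
        rw [div_eq_mul_inv, Real.mul_rpow hR.le (by norm_num), hθdef, Real.rpow_neg (by norm_num),
          Real.inv_rpow (by norm_num)]
      have e2 : R ^ D * (R / 2) ^ (-α) = R ^ (D - α) * 2 ^ α := by
        rw [div_eq_mul_inv, Real.mul_rpow hR.le (by norm_num), Real.inv_rpow (by norm_num),
          Real.rpow_neg (by norm_num : (0 : ℝ) ≤ 2), inv_inv, ← mul_assoc, ← Real.rpow_add hR,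
          sub_eq_add_neg]
      calc _ ≤ C * (R ^ (D - α) * θ) + B * (R ^ (D - α) * 2 ^ α) := by
            rw [← e1, ← e2, ← mul_assoc]; exact add_le_add ha hb
        _ = (C * θ + B * 2 ^ α) * R ^ (D - α) := by ring
        _ = _ := by rw [hCeq]
  intro R hR F hF
  obtain ⟨n, hn⟩ := pow_unbounded_of_one_lt R (by norm_num : (1 : ℝ) < 2)
  exact key n R hR hn F hF

/-- If at most `B R^D` points have size at most `R` then the points of size at least `R` contribute
`O(R^(D-α))` to `∑ N^(-α)`, provided `D < α`. -/
theorem exists_sum_tail_le (hN : ∀ v, 1 ≤ N v)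
    (hcard : ∀ R, 1 ≤ R → ∀ F : Finset ι, (∀ v ∈ F, N v ≤ R) → (F.card : ℝ) ≤ B * R ^ D)
    (hB : 0 < B) (hα : 0 < α) (hαD : D < α) :
    ∃ C > 0, ∀ R : ℝ, 0 < R → ∀ F : Finset ι, (∀ v ∈ F, R ≤ N v) →
      ∑ v ∈ F, N v ^ (-α) ≤ C * R ^ (D - α) := by
  classical
  have hθ : (2 : ℝ) ^ (D - α) < 1 :=
    Real.rpow_lt_one_of_one_lt_of_neg (by norm_num) (by linarith)
  set θ := (2 : ℝ) ^ (D - α) with hθdef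
  -- Again a fixed point, now for doubling: points beyond 2R are covered by induction, and those
  -- between R and 2R number at most B (2R)^D.
  set C := B * 2 ^ D / (1 - θ) with hC
  have hCpos : 0 < C := div_pos (by positivity) (by linarith)
  have hCeq : C * θ + B * 2 ^ D = C := by
    rw [hC]; field_simp [(by linarith : (1 - θ) ≠ 0)]; ring
  refine ⟨C, hCpos, ?_⟩
  have key : ∀ n : ℕ, ∀ R : ℝ, 1 ≤ R → ∀ F : Finset ι, (∀ v ∈ F, R ≤ N v) →
      (∀ v ∈ F, N v < R * 2 ^ n) → ∑ v ∈ F, N v ^ (-α) ≤ C * R ^ (D - α) := by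
    intro n
    induction n with
    | zero =>
      intro R hR F hF hF'
      have : F = ∅ := by
        refine Finset.eq_empty_of_forall_notMem fun v hv => ?_
        have := hF v hv; have := hF' v hv; simp at this; linarith
      subst this; simp; positivity
    | succ n ih =>
      intro R hR F hF hF'
      have hR0 : 0 < R := by linarith
      rw [← Finset.sum_filter_add_sum_filter_not F (fun v => 2 * R ≤ N v)]
      have ha := ih (2 * R) (by linarith) (F.filter (fun v => 2 * R ≤ N v)) (by simp)
        (fun v hv => by
          have := hF' v (Finset.mem_filter.1 hv).1
          rw [pow_succ] at this; linarith)
      have hb : ∑ v ∈ F.filter (fun v => ¬ 2 * R ≤ N v), N v ^ (-α)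
          ≤ (B * (2 * R) ^ D) * R ^ (-α) := by
        calc _ ≤ ∑ v ∈ F.filter (fun v => ¬ 2 * R ≤ N v), R ^ (-α) := by
              refine Finset.sum_le_sum fun v hv => ?_
              exact Real.rpow_le_rpow_of_nonpos hR0 (hF v (Finset.mem_filter.1 hv).1) (by linarith)
          _ = (F.filter (fun v => ¬ 2 * R ≤ N v)).card * R ^ (-α) := by simp
          _ ≤ _ := by
              gcongr
              refine hcard (2 * R) (by linarith) _ fun v hv => ?_
              rw [Finset.mem_filter, not_le] at hv
              exact hv.2.le
      have e1 : (2 * R) ^ (D - α) = R ^ (D - α) * θ := by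
        rw [mul_comm, Real.mul_rpow hR0.le (by norm_num)]
      have e2 : (2 * R) ^ D * R ^ (-α) = R ^ (D - α) * 2 ^ D := by
        rw [Real.mul_rpow (by norm_num) hR0.le, mul_assoc, ← Real.rpow_add hR0, sub_eq_add_neg,
          mul_comm]
      calc _ ≤ C * (R ^ (D - α) * θ) + B * (R ^ (D - α) * 2 ^ D) := by
            rw [← e1, ← e2, ← mul_assoc]; exact add_le_add ha hb
        _ = (C * θ + B * 2 ^ D) * R ^ (D - α) := by ring
        _ = _ := by rw [hCeq]
  intro R hR F hF
  obtain ⟨n, hn⟩ := pow_unbounded_of_one_lt (∑ v ∈ F, |N v|) (by norm_num : (1 : ℝ) < 2)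
  -- The counting bound starts at scale 1. Replacing R by max 1 R loses nothing, since N ≥ 1 and the
  -- exponent D - α is negative.
  refine (key n (max 1 R) (le_max_left _ _) F (fun v hv => max_le (hN v) (hF v hv))
    fun v hv => ?_).trans ?_
  swap
  · gcongr C * ?_
    exact Real.rpow_le_rpow_of_nonpos hR (le_max_right _ _) (by linarith)
  calc N v ≤ |N v| := le_abs_self _
    _ ≤ ∑ v ∈ F, |N v| := Finset.single_le_sum (f := fun v => |N v|) (fun _ _ => abs_nonneg _) hv
    _ < 2 ^ n := hn
    _ ≤ max 1 R * 2 ^ n := le_mul_of_one_le_left (by positivity) (le_max_left _ _)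

end Counting

/-! ### Correlations of the weights -/

/-- Since x = (v + x) - v, the points v and v + x cannot both be much smaller than x. -/
theorem aniNorm_div_le_or {δ : ℝ} (hδ : 0 < δ) (v x : ℤ × ℤ) :
    aniNorm δ x / 2 ^ (1 + δ) ≤ aniNorm δ v ∨ aniNorm δ x / 2 ^ (1 + δ) ≤ aniNorm δ (v + x) := by
  have h := aniNorm_add_le hδ (v + x) (-v)
  rw [aniNorm_neg, add_neg_cancel_comm] at h
  rw [div_le_iff₀' (by positivity), div_le_iff₀' (by positivity)]
  rcases le_total (aniNorm δ (v + x)) (aniNorm δ v) with h1 | h1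
  · left; rwa [max_eq_right h1] at h
  · right; rwa [max_eq_left h1] at h

/-- The weight `aniNorm ^ (-q)`. -/
noncomputable def aniWt (δ q : ℝ) (v : ℤ × ℤ) : ℝ := aniNorm δ v ^ (-q)

theorem aniWt_pos (δ q : ℝ) (v : ℤ × ℤ) : 0 < aniWt δ q v :=
  Real.rpow_pos_of_pos (aniNorm_pos δ v) _

theorem aniWt_le_one {δ q : ℝ} (hq : 0 ≤ q) (v : ℤ × ℤ) : aniWt δ q v ≤ 1 :=
  Real.rpow_le_one_of_one_le_of_nonpos (one_le_aniNorm δ v) (by linarith)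

theorem aniWt_sq (δ q : ℝ) (v : ℤ × ℤ) : aniWt δ q v ^ 2 = aniNorm δ v ^ (-(2 * q)) := by
  rw [aniWt, ← Real.rpow_natCast, ← Real.rpow_mul (aniNorm_pos δ v).le]
  congr 1; push_cast; ring

theorem aniWt_le_of_le {δ q R : ℝ} (hq : 0 ≤ q) (hR : 0 < R) {v : ℤ × ℤ} (h : R ≤ aniNorm δ v) :
    aniWt δ q v ≤ R ^ (-q) :=
  Real.rpow_le_rpow_of_nonpos hR h (by linarith)

theorem div_rpow_neg_eq {R K q : ℝ} (hR : 0 < R) (hK : 0 < K) :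
    (R / K) ^ (-q) = K ^ q * R ^ (-q) := by
  rw [Real.div_rpow hR.le hK.le, Real.rpow_neg hK.le, div_inv_eq_mul, mul_comm]

variable {δ q : ℝ}

theorem aniWt_le_or (hδ : 0 < δ) (hq : 0 ≤ q) (v x : ℤ × ℤ) :
    aniWt δ q v ≤ (2 ^ (1 + δ)) ^ q * aniWt δ q x ∨
      aniWt δ q (v + x) ≤ (2 ^ (1 + δ)) ^ q * aniWt δ q x := by
  have hx := aniNorm_pos δ x
  have h0 : 0 < aniNorm δ x / 2 ^ (1 + δ) := by positivity
  rw [aniWt.eq_1 δ q x, ← div_rpow_neg_eq hx (by positivity)]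
  exact (aniNorm_div_le_or hδ v x).imp (aniWt_le_of_le hq h0) (aniWt_le_of_le hq h0)

theorem sum_comp_add_right_le {f : ℤ × ℤ → ℝ} {C : ℝ} (h : ∀ F : Finset (ℤ × ℤ), ∑ v ∈ F, f v ≤ C)
    (x : ℤ × ℤ) (F : Finset (ℤ × ℤ)) : ∑ v ∈ F, f (v + x) ≤ C := by
  simpa using h (F.map (addRightEmbedding x))

/-- Square summability of the weights and the decay of their correlation. -/
theorem exists_aniWt_correlation_le (hδ : 0 < δ) (hq : 0 < q) (h1 : q < 1 + 1 / δ)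
    (h2 : 1 + 1 / δ < 2 * q) :
    ∃ C ≥ 1, (∀ F : Finset (ℤ × ℤ), ∑ v ∈ F, aniWt δ q v ^ 2 ≤ C) ∧
      ∀ x, ∀ F : Finset (ℤ × ℤ), ∑ v ∈ F, aniWt δ q v * aniWt δ q (v + x)
        ≤ C * aniNorm δ x ^ (-(2 * q - (1 + 1 / δ))) := by
  set D := 1 + 1 / δ with hD
  obtain ⟨C₁, hC₁, H1⟩ := exists_sum_head_le (one_le_aniNorm δ)
    (fun R hR F hF => card_aniNorm_le hδ hR F hF) (by norm_num) hq h1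
  obtain ⟨C₂, hC₂, H2⟩ := exists_sum_tail_le (one_le_aniNorm δ)
    (fun R hR F hF => card_aniNorm_le hδ hR F hF) (by norm_num) (by linarith : 0 < 2 * q) h2
  have H2' : ∀ R : ℝ, 0 < R → ∀ F : Finset (ℤ × ℤ), (∀ v ∈ F, R ≤ aniNorm δ v) →
      ∑ v ∈ F, aniWt δ q v ^ 2 ≤ C₂ * R ^ (-(2 * q - D)) := by
    intro R hR F hF
    simp_rw [aniWt_sq]
    rw [neg_sub]
    exact H2 R hR F hF
  set K : ℝ := 2 ^ (1 + δ) with hK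
  have hK0 : 0 < K := by positivity
  set A := 2 * C₁ + 2 * C₂
  refine ⟨max 1 (max C₂ (A * K ^ (2 * q - D))), le_max_left _ _, fun F => ?_, fun x F => ?_⟩
  · refine le_trans ?_ ((le_max_left C₂ _).trans (le_max_right _ _))
    simpa using H2' 1 one_pos F fun v _ => one_le_aniNorm δ v
  have hx := aniNorm_pos δ x
  set R := aniNorm δ x / K with hRdef
  have hR : 0 < R := by positivity
  have hor : ∀ v, R ≤ aniNorm δ v ∨ R ≤ aniNorm δ (v + x) := fun v => aniNorm_div_le_or hδ v x
  have eR : R ^ (-q) * R ^ (D - q) = R ^ (-(2 * q - D)) := by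
    rw [← Real.rpow_add hR]; congr 1; ring
  have hS : ∑ v ∈ F, aniWt δ q v * aniWt δ q (v + x) ≤ A * R ^ (-(2 * q - D)) := by
    classical
    -- Three regions. Near 0 the shifted weight is at most R^(-q) and the other one is summed as a
    -- head; near -x the roles are exchanged; away from both, the product is at most the sum of
    -- squares, which is a tail. Each gives R^(D-2q).
    rw [← Finset.sum_filter_add_sum_filter_not F (fun v => aniNorm δ v < R),
      ← Finset.sum_filter_add_sum_filter_not (F.filter fun v => ¬ aniNorm δ v < R)
        (fun v => aniNorm δ (v + x) < R)]
    have b1 : ∑ v ∈ F.filter (fun v => aniNorm δ v < R), aniWt δ q v * aniWt δ q (v + x)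
        ≤ C₁ * R ^ (-(2 * q - D)) := by
      calc _ ≤ ∑ v ∈ F.filter (fun v => aniNorm δ v < R), aniWt δ q v * R ^ (-q) := by
            refine Finset.sum_le_sum fun v hv => ?_
            have hv' := (Finset.mem_filter.1 hv).2
            have := aniWt_le_of_le hq.le hR ((hor v).resolve_left (not_le.2 hv'))
            have := aniWt_pos δ q v
            gcongr
        _ = (∑ v ∈ F.filter (fun v => aniNorm δ v < R), aniNorm δ v ^ (-q)) * R ^ (-q) := by
            rw [← Finset.sum_mul]; rfl
        _ ≤ (C₁ * R ^ (D - q)) * R ^ (-q) := by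
            gcongr
            exact H1 R hR _ fun v hv => (Finset.mem_filter.1 hv).2.le
        _ = _ := by rw [← eR]; ring
    have b2 : ∑ v ∈ (F.filter fun v => ¬ aniNorm δ v < R).filter
          (fun v => aniNorm δ (v + x) < R), aniWt δ q v * aniWt δ q (v + x)
        ≤ C₁ * R ^ (-(2 * q - D)) := by
      set G := (F.filter fun v => ¬ aniNorm δ v < R).filter (fun v => aniNorm δ (v + x) < R)
      calc _ ≤ ∑ v ∈ G, R ^ (-q) * aniWt δ q (v + x) := by
            refine Finset.sum_le_sum fun v hv => ?_
            have hv' := (Finset.mem_filter.1 (Finset.mem_filter.1 hv).1).2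
            have := aniWt_le_of_le hq.le hR (not_lt.1 hv')
            have := aniWt_pos δ q (v + x)
            gcongr
        _ = R ^ (-q) * ∑ v ∈ G.map (addRightEmbedding x), aniNorm δ v ^ (-q) := by
            rw [← Finset.mul_sum, Finset.sum_map]; rfl
        _ ≤ R ^ (-q) * (C₁ * R ^ (D - q)) := by
            gcongr
            refine H1 R hR _ fun v hv => ?_
            obtain ⟨u, hu, rfl⟩ := Finset.mem_map.1 hv
            exact (Finset.mem_filter.1 hu).2.le
        _ = _ := by rw [← eR]; ring
    have b3 : ∑ v ∈ (F.filter fun v => ¬ aniNorm δ v < R).filter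
          (fun v => ¬ aniNorm δ (v + x) < R), aniWt δ q v * aniWt δ q (v + x)
        ≤ 2 * C₂ * R ^ (-(2 * q - D)) := by
      set G := (F.filter fun v => ¬ aniNorm δ v < R).filter (fun v => ¬ aniNorm δ (v + x) < R)
      calc _ ≤ ∑ v ∈ G, (aniWt δ q v ^ 2 + aniWt δ q (v + x) ^ 2) := by
            refine Finset.sum_le_sum fun v _ => ?_
            nlinarith [sq_nonneg (aniWt δ q v - aniWt δ q (v + x)), sq_nonneg (aniWt δ q v),
              sq_nonneg (aniWt δ q (v + x))]
        _ = ∑ v ∈ G, aniWt δ q v ^ 2 + ∑ v ∈ G.map (addRightEmbedding x), aniWt δ q v ^ 2 := by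
            rw [Finset.sum_add_distrib, Finset.sum_map]; rfl
        _ ≤ C₂ * R ^ (-(2 * q - D)) + C₂ * R ^ (-(2 * q - D)) := by
            refine add_le_add (H2' R hR _ fun v hv => ?_) (H2' R hR _ fun v hv => ?_)
            · exact not_lt.1 (Finset.mem_filter.1 (Finset.mem_filter.1 hv).1).2
            · obtain ⟨u, hu, rfl⟩ := Finset.mem_map.1 hv
              exact not_lt.1 (Finset.mem_filter.1 hu).2
        _ = _ := by ring
    calc _ ≤ _ := add_le_add b1 (add_le_add b2 b3)
      _ = _ := by ring
  calc _ ≤ A * R ^ (-(2 * q - D)) := hS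
    _ = (A * K ^ (2 * q - D)) * aniNorm δ x ^ (-(2 * q - D)) := by
        rw [hRdef, div_rpow_neg_eq hx hK0]; ring
    _ ≤ _ := by
        gcongr
        exact (le_max_right _ _).trans (le_max_right _ _)

/-- Correlation sums with a total exponent at least three. -/
theorem exists_aniWt_higher_correlation_le (hδ : 0 < δ) (hq : 0 < q) (h1 : q < 1 + 1 / δ)
    (h2 : 1 + 1 / δ < 2 * q) :
    ∃ C ≥ 1, (∀ i j : ℕ, 1 ≤ i → 1 ≤ j → i ≠ j → ∀ x, ∀ F : Finset (ℤ × ℤ),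
        ∑ v ∈ F, aniWt δ q v ^ i * aniWt δ q (v + x) ^ j ≤ C * aniWt δ q x) ∧
      (∀ i : ℕ, 2 ≤ i → ∀ x, ∀ F : Finset (ℤ × ℤ),
        ∑ v ∈ F, aniWt δ q v ^ i * aniWt δ q (v + x) ^ i ≤ (C * aniWt δ q x) ^ i) := by
  obtain ⟨C, hC, hsq, -⟩ := exists_aniWt_correlation_le hδ hq h1 h2
  set K : ℝ := (2 ^ (1 + δ)) ^ q with hK
  have hK1 : 1 ≤ K := Real.one_le_rpow (Real.one_le_rpow (by norm_num) (by linarith)) hq.le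
  have hK0 : 0 < K := by linarith
  have hsq2 : ∀ x, ∀ F : Finset (ℤ × ℤ),
      ∑ v ∈ F, (aniWt δ q v ^ 2 + aniWt δ q (v + x) ^ 2) ≤ 2 * C := by
    intro x F
    rw [Finset.sum_add_distrib]
    have := hsq F
    have := sum_comp_add_right_le (f := fun v => aniWt δ q v ^ 2) hsq x F
    linarith
  have bound : ∀ b : ℝ, 0 ≤ b → ∀ x, ∀ F : Finset (ℤ × ℤ), ∀ f : ℤ × ℤ → ℝ,
      (∀ v, f v ≤ b * (aniWt δ q v ^ 2 + aniWt δ q (v + x) ^ 2)) → ∑ v ∈ F, f v ≤ b * (2 * C) := by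
    intro b hb x F f hf
    calc _ ≤ ∑ v ∈ F, b * (aniWt δ q v ^ 2 + aniWt δ q (v + x) ^ 2) :=
          Finset.sum_le_sum fun v _ => hf v
      _ ≤ _ := by rw [← Finset.mul_sum]; gcongr; exact hsq2 x F
  refine ⟨2 * K * C, by nlinarith, fun i j hi hj hij x F => ?_, fun i hi x F => ?_⟩
  · have hx := aniWt_pos δ q x
    refine (bound (K * aniWt δ q x) (by positivity) x F _ fun v => ?_).trans (by nlinarith)
    have p1 := aniWt_pos δ q v
    have p2 := aniWt_pos δ q (v + x)
    have o1 := aniWt_le_one (δ := δ) hq.le v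
    have o2 := aniWt_le_one (δ := δ) hq.le (v + x)
    set s := aniWt δ q v
    set t := aniWt δ q (v + x)
    have hb : 0 < K * aniWt δ q x := by positivity
    -- Unequal positive exponents force one of them to be at least 2, and weights are at most 1.
    have hst : s ^ i * t ^ j ≤ s ^ 2 * t ∨ s ^ i * t ^ j ≤ t ^ 2 * s := by
      have e1 : ∀ n : ℕ, 1 ≤ n → ∀ y : ℝ, 0 < y → y ≤ 1 → y ^ n ≤ y := fun n hn y hy hy1 => by
        simpa using pow_le_pow_of_le_one hy.le hy1 hn
      have e2 : ∀ n : ℕ, 2 ≤ n → ∀ y : ℝ, 0 < y → y ≤ 1 → y ^ n ≤ y ^ 2 := fun n hn y hy hy1 =>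
        pow_le_pow_of_le_one hy.le hy1 hn
      rcases lt_or_gt_of_ne hij with h | h
      · right
        rw [mul_comm]
        exact mul_le_mul (e2 j (by omega) t p2 o2) (e1 i hi s p1 o1) (by positivity) (by positivity)
      · left
        exact mul_le_mul (e2 i (by omega) s p1 o1) (e1 j hj t p2 o2) (by positivity) (by positivity)
    have hmid : s ^ 2 * t ≤ K * aniWt δ q x * (s ^ 2 + t ^ 2) ∧
        t ^ 2 * s ≤ K * aniWt δ q x * (s ^ 2 + t ^ 2) := by
      have hs2 : s * t ≤ s ^ 2 + t ^ 2 := by nlinarith [sq_nonneg (s - t), sq_nonneg s, sq_nonneg t]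
      -- One weight is extracted as O of the weight at x; the two remaining factors are dominated by
      -- the summable squares.
      rcases aniWt_le_or hδ hq.le v x with h | h
      · change s ≤ K * aniWt δ q x at h
        constructor
        · calc s ^ 2 * t = s * (s * t) := by ring
            _ ≤ _ := mul_le_mul h hs2 (by positivity) hb.le
        · calc t ^ 2 * s = s * t ^ 2 := by ring
            _ ≤ _ := mul_le_mul h (by nlinarith) (by positivity) hb.le
      · change t ≤ K * aniWt δ q x at h
        constructor
        · calc s ^ 2 * t = t * s ^ 2 := by ring
            _ ≤ _ := mul_le_mul h (by nlinarith) (by positivity) hb.le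
        · calc t ^ 2 * s = t * (s * t) := by ring
            _ ≤ _ := mul_le_mul h hs2 (by positivity) hb.le
    rcases hst with h | h
    · exact h.trans hmid.1
    · exact h.trans hmid.2
  · have hx := aniWt_pos δ q x
    have hb : 0 < K * aniWt δ q x := by positivity
    refine (bound ((K * aniWt δ q x) ^ i) (by positivity) x F _ fun v => ?_).trans ?_
    · have p1 := aniWt_pos δ q v
      have p2 := aniWt_pos δ q (v + x)
      have o1 := aniWt_le_one (δ := δ) hq.le v
      have o2 := aniWt_le_one (δ := δ) hq.le (v + x)
      rcases aniWt_le_or hδ hq.le v x with h | h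
      · refine mul_le_mul (pow_le_pow_left₀ p1.le h i) ?_ (by positivity) (by positivity)
        exact (pow_le_pow_of_le_one p2.le o2 hi).trans (by nlinarith)
      · rw [mul_comm]
        refine mul_le_mul (pow_le_pow_left₀ p2.le h i) ?_ (by positivity) (by positivity)
        exact (pow_le_pow_of_le_one p1.le o1 hi).trans (by nlinarith)
    -- The constant is enlarged so that it can be absorbed inside the `i`-th power.
    · have : 2 * C ≤ (2 * C) ^ i := le_self_pow₀ (by linarith) (by omega)
      calc _ ≤ (K * aniWt δ q x) ^ i * (2 * C) ^ i := by gcongr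
        _ = _ := by rw [← mul_pow]; ring

/-! ### Logarithmic derivatives of formal power series -/

section LogDerivative

open PowerSeries

/-- A product of images of `g` under ring homomorphisms commuting with `X d/dX` satisfies a linear
differential equation whose coefficient is the sum of the images of that of `g`. -/
theorem X_mul_derivative_prod {A ι : Type*} [CommRing A] (σ : ι → (A⟦X⟧ →+* A⟦X⟧))
    (hσ : ∀ u f, X * d⁄dX A (σ u f) = σ u (X * d⁄dX A f)) {g h : A⟦X⟧}
    (hg : h * g = X * d⁄dX A g) (F : Finset ι) :
    X * d⁄dX A (∏ u ∈ F, σ u g) = (∑ u ∈ F, σ u h) * ∏ u ∈ F, σ u g := by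
  classical
  induction F using Finset.induction_on with
  | empty => simp
  | insert u F hu ih =>
    rw [Finset.prod_insert hu, Finset.sum_insert hu, Derivation.leibniz, smul_eq_mul, smul_eq_mul,
      mul_add, mul_left_comm, ih, mul_left_comm X, hσ, ← hg, map_mul]
    ring

theorem coeff_X_mul_derivative {A : Type*} [CommRing A] (f : A⟦X⟧) (n : ℕ) :
    coeff n (X * d⁄dX A f) = n * coeff n f := by
  cases n with
  | zero => simp
  | succ n => rw [coeff_succ_X_mul, coeff_derivative]; push_cast; ring

/-- A series with constant term 1 is invertible, so X g'/g makes sense over any commutative ring; no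
logarithm or division by integers is needed. -/
theorem exists_mul_eq_X_mul_derivative {A : Type*} [CommRing A] {g : A⟦X⟧}
    (hg : constantCoeff g = 1) : ∃ h : A⟦X⟧, h * g = X * d⁄dX A g :=
  ⟨X * d⁄dX A g * invOfUnit g 1, by
    rw [mul_assoc, invOfUnit_mul _ _ (by simpa using hg), mul_one]⟩

end LogDerivative

/-! ### Moment series and an even-moment inequality -/

section Univariate

open PowerSeries

/-- The series `∑ aⁿ m(n) zⁿ / n!` attached to a moment sequence. -/
noncomputable def momentSeries (m : ℕ → ℝ) (a : ℝ) : ℝ⟦X⟧ :=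
  PowerSeries.mk fun n => a ^ n * m n / n.factorial

theorem momentSeries_eq_rescale (m : ℕ → ℝ) (a : ℝ) :
    momentSeries m a = rescale a (momentSeries m 1) := by
  ext n; simp [momentSeries, mul_div_assoc]

theorem constantCoeff_momentSeries {m : ℕ → ℝ} (hm : m 0 = 1) (a : ℝ) :
    constantCoeff (momentSeries m a) = 1 := by
  simp [momentSeries, hm, ← coeff_zero_eq_constantCoeff_apply]

theorem X_mul_derivative_rescale (a : ℝ) (f : ℝ⟦X⟧) :
    X * d⁄dX ℝ (rescale a f) = rescale a (X * d⁄dX ℝ f) := by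
  ext n; simp only [coeff_X_mul_derivative, coeff_rescale]; ring

/-- Every |c u| is at most the ℓ² norm, so all but two of the j factors can be replaced by it. -/
theorem abs_sum_pow_le {ι : Type*} (F : Finset ι) (c : ι → ℝ) {j : ℕ} (hj : 2 ≤ j) :
    |∑ u ∈ F, c u ^ j| ≤ √(∑ u ∈ F, c u ^ 2) ^ j := by
  set s := √(∑ u ∈ F, c u ^ 2)
  have hs : s ^ 2 = ∑ u ∈ F, c u ^ 2 := Real.sq_sqrt (Finset.sum_nonneg fun _ _ => sq_nonneg _)
  have hc : ∀ u ∈ F, |c u| ≤ s := fun u hu => Real.abs_le_sqrt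
    (Finset.single_le_sum (f := fun u => c u ^ 2) (fun _ _ => sq_nonneg _) hu)
  obtain ⟨i, rfl⟩ := Nat.exists_eq_add_of_le hj
  calc |∑ u ∈ F, c u ^ (2 + i)| ≤ ∑ u ∈ F, |c u ^ (2 + i)| := Finset.abs_sum_le_sum_abs _ _
    _ ≤ ∑ u ∈ F, c u ^ 2 * s ^ i := by
        refine Finset.sum_le_sum fun u hu => ?_
        rw [abs_pow, pow_add, sq_abs]
        gcongr
        exact hc u hu
    _ = _ := by rw [← Finset.sum_mul, ← hs, pow_add]

/-- Growth of the solutions of `n M n = ∑ K j M (n - j)` when `K 0 = K 1 = 0` and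
`|K j| ≤ B σ ^ j`. -/
theorem exists_abs_le_of_recursion (B : ℝ) (n : ℕ) : ∃ C ≥ 0, ∀ (M K : ℕ → ℝ) (s : ℝ), 0 ≤ s →
    M 0 = 1 → (∀ k, k * M k = ∑ x ∈ Finset.HasAntidiagonal.antidiagonal k, K x.1 * M x.2) →
    K 0 = 0 → (∀ j ≤ n, |K j| ≤ B * s ^ j) → ∀ k ≤ n, |M k| ≤ C * s ^ k := by
  suffices h : ∀ m, ∃ C ≥ 0, ∀ (M K : ℕ → ℝ) (s : ℝ), 0 ≤ s →
      M 0 = 1 → (∀ k, k * M k = ∑ x ∈ Finset.HasAntidiagonal.antidiagonal k, K x.1 * M x.2) →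
      K 0 = 0 → (∀ j ≤ n, |K j| ≤ B * s ^ j) → ∀ k ≤ m, k ≤ n → |M k| ≤ C * s ^ k by
    obtain ⟨C, hC, H⟩ := h n
    exact ⟨C, hC, fun M K s hs h0 h1 h2 h3 k hk => H M K s hs h0 h1 h2 h3 k hk hk⟩
  intro m
  induction m with
  | zero =>
    refine ⟨1, zero_le_one, fun M K s hs h0 h1 h2 h3 k hk _ => ?_⟩
    obtain rfl : k = 0 := by omega
    simp [h0]
  | succ m ih =>
    obtain ⟨C, hC, H⟩ := ih
    refine ⟨max C ((m + 2) * (|B| * C)), by positivity, fun M K s hs h0 h1 h2 h3 k hk hkn => ?_⟩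
    rcases Nat.lt_or_ge m k with h | h
    · obtain rfl : k = m + 1 := by omega
      have hb : |((m + 1 : ℕ) : ℝ) * M (m + 1)| ≤ (m + 2) * (|B| * C) * s ^ (m + 1) := by
        rw [h1]
        calc _ ≤ ∑ x ∈ Finset.HasAntidiagonal.antidiagonal (m + 1), |K x.1 * M x.2| :=
              Finset.abs_sum_le_sum_abs _ _
          _ ≤ ∑ x ∈ Finset.HasAntidiagonal.antidiagonal (m + 1), (|B| * C) * s ^ (m + 1) := by
              refine Finset.sum_le_sum fun x hx => ?_
              rw [Finset.HasAntidiagonal.mem_antidiagonal] at hx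
              rcases Nat.eq_zero_or_pos x.1 with hx1 | hx1
              · rw [hx1, h2]; simp; positivity
              · rw [abs_mul, ← hx, pow_add]
                calc |K x.1| * |M x.2| ≤ (|B| * s ^ x.1) * (C * s ^ x.2) := by
                      refine mul_le_mul ((h3 _ (by omega)).trans ?_)
                        (H M K s hs h0 h1 h2 h3 _ (by omega) (by omega)) (abs_nonneg _)
                        (by positivity)
                      gcongr
                      exact le_abs_self B
                  _ = _ := by ring
          _ = _ := by simp; ring
      have hle : |M (m + 1)| ≤ |((m + 1 : ℕ) : ℝ) * M (m + 1)| := by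
        rw [abs_mul]
        refine le_mul_of_one_le_left (abs_nonneg _) ?_
        rw [Nat.abs_cast]; push_cast; linarith [(Nat.cast_nonneg m : (0 : ℝ) ≤ m)]
      refine (hle.trans hb).trans ?_
      gcongr
      exact le_max_right _ _
    · refine (H M K s hs h0 h1 h2 h3 k h hkn).trans ?_
      gcongr
      exact le_max_left _ _

/-- The coefficients of a product of moment series of a centred sequence are bounded by powers of
the `ℓ²` norm of the scales. -/
theorem exists_abs_coeff_prod_momentSeries_le {m : ℕ → ℝ} (h0 : m 0 = 1) (h1 : m 1 = 0) (n : ℕ) :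
    ∃ C ≥ 0, ∀ {ι : Type} (F : Finset ι) (c : ι → ℝ), ∀ k ≤ n,
      |coeff k (∏ u ∈ F, momentSeries m (c u))| ≤ C * √(∑ u ∈ F, c u ^ 2) ^ k := by
  obtain ⟨h, hh⟩ := exists_mul_eq_X_mul_derivative (constantCoeff_momentSeries h0 1)
  have hc0 : coeff 0 h = 0 := by
    have := congrArg (coeff 0) hh
    rw [coeff_X_mul_derivative, coeff_mul] at this
    simpa [constantCoeff_momentSeries h0] using this
  -- Centring is essential here: the first-order coefficient would multiply ∑ c u, which the ℓ² norm
  -- does not control uniformly in `F`.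
  have hc1 : coeff 1 h = 0 := by
    have := congrArg (coeff 1) hh
    rw [coeff_X_mul_derivative, coeff_mul] at this
    have hm : coeff 1 (momentSeries m 1) = 0 := by simp [momentSeries, h1]
    simpa [Finset.Nat.antidiagonal_succ, hm, constantCoeff_momentSeries h0] using this
  obtain ⟨C, hC, H⟩ := exists_abs_le_of_recursion (∑ j ∈ Finset.range (n + 1), |coeff j h|) n
  refine ⟨C, hC, fun {ι} F c => ?_⟩
  have hrec := X_mul_derivative_prod (fun u => rescale (c u))
    (fun u f => X_mul_derivative_rescale (c u) f) hh F
  simp_rw [← momentSeries_eq_rescale] at hrec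
  refine H _ (fun j => coeff j h * ∑ u ∈ F, c u ^ j) _ (Real.sqrt_nonneg _) ?_ (fun k => ?_)
    (by simp [hc0]) (fun j hj => ?_)
  · rw [coeff_zero_eq_constantCoeff_apply, map_prod]
    simp [constantCoeff_momentSeries h0]
  · have := congrArg (coeff k) hrec
    rw [coeff_X_mul_derivative, coeff_mul] at this
    rw [this]
    refine Finset.sum_congr rfl fun x _ => ?_
    rw [map_sum, Finset.mul_sum]
    simp only [coeff_rescale, mul_comm]
  · rw [abs_mul]
    by_cases hj2 : 2 ≤ j
    · refine mul_le_mul ?_ (abs_sum_pow_le F c hj2) (abs_nonneg _)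
        (Finset.sum_nonneg fun _ _ => abs_nonneg _)
      exact Finset.single_le_sum (f := fun j => |coeff j h|) (fun _ _ => abs_nonneg _)
        (Finset.mem_range.2 (by omega))
    · have : coeff j h = 0 := by
        obtain rfl | rfl : j = 0 ∨ j = 1 := by omega
        exacts [hc0, hc1]
      rw [this, abs_zero, zero_mul]
      have : 0 ≤ ∑ j ∈ Finset.range (n + 1), |coeff j h| :=
        Finset.sum_nonneg fun _ _ => abs_nonneg _
      positivity

end Univariate

/-! ### Generating series of Appell covariances and joint cumulants -/

section Bivariate

open PowerSeries

/-- Rescaling of both variables of a series in two variables. -/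
noncomputable def biRescale (a b : ℝ) : ℝ⟦X⟧⟦X⟧ →+* ℝ⟦X⟧⟦X⟧ :=
  (rescale (C a : ℝ⟦X⟧)).comp (map (rescale b))

theorem coeff_biRescale (a b : ℝ) (f : ℝ⟦X⟧⟦X⟧) (i j : ℕ) :
    coeff j (coeff i (biRescale a b f)) = a ^ i * b ^ j * coeff j (coeff i f) := by
  simp [biRescale, coeff_rescale, ← map_pow, coeff_C_mul, mul_assoc]

theorem biSeries_ext {f g : ℝ⟦X⟧⟦X⟧} (h : ∀ i j, coeff j (coeff i f) = coeff j (coeff i g)) :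
    f = g :=
  PowerSeries.ext fun i => PowerSeries.ext fun j => h i j

theorem X_mul_derivative_biRescale (a b : ℝ) (f : ℝ⟦X⟧⟦X⟧) :
    X * d⁄dX ℝ⟦X⟧ (biRescale a b f) = biRescale a b (X * d⁄dX ℝ⟦X⟧ f) := by
  have hn : ∀ (n : ℕ) (φ : ℝ⟦X⟧) (j : ℕ), coeff j ((n : ℝ⟦X⟧) * φ) = n * coeff j φ := by
    intro n φ j
    rw [← nsmul_eq_mul, map_nsmul, nsmul_eq_mul]
  refine biSeries_ext fun i j => ?_
  rw [coeff_biRescale, coeff_X_mul_derivative, coeff_X_mul_derivative, hn, hn, coeff_biRescale]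
  ring

/-- The series `∑ aⁱ bʲ m(i + j) zⁱ wʲ / (i! j!)`. -/
noncomputable def jointSeries (m : ℕ → ℝ) (a b : ℝ) : ℝ⟦X⟧⟦X⟧ :=
  PowerSeries.mk fun i => PowerSeries.mk fun j =>
    a ^ i * b ^ j * m (i + j) / (i.factorial * j.factorial)

/-- The joint moment series divided by the two marginal ones. -/
noncomputable def covSeries (m : ℕ → ℝ) (a b : ℝ) : ℝ⟦X⟧⟦X⟧ :=
  jointSeries m a b * map C (momentSeries m a)⁻¹ * C (momentSeries m b)⁻¹

variable {m : ℕ → ℝ}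

theorem rescale_inv {f : ℝ⟦X⟧} (hf : constantCoeff f = 1) (a : ℝ) :
    rescale a f⁻¹ = (rescale a f)⁻¹ := by
  have h : constantCoeff (rescale a f) = 1 := by
    rw [← coeff_zero_eq_constantCoeff_apply, coeff_rescale]; simp [hf]
  rw [PowerSeries.eq_inv_iff_mul_eq_one (by simp [h]), ← map_mul,
    PowerSeries.inv_mul_cancel _ (by simp [hf]), map_one]

/-- Every site thus contributes the image of one fixed series under a ring homomorphism commuting
with X d/dX, the form required by `X_mul_derivative_prod`. -/
theorem covSeries_eq_biRescale (h0 : m 0 = 1) (a b : ℝ) :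
    covSeries m a b = biRescale a b (covSeries m 1 1) := by
  have hc := constantCoeff_momentSeries h0 1
  rw [covSeries, covSeries, map_mul, map_mul, momentSeries_eq_rescale m a,
    momentSeries_eq_rescale m b, ← rescale_inv hc, ← rescale_inv hc]
  congr 1
  · congr 1
    · refine biSeries_ext fun i j => ?_
      rw [coeff_biRescale]
      simp [jointSeries, mul_div_assoc]
    · refine biSeries_ext fun i j => ?_
      rw [coeff_biRescale, coeff_map, coeff_map, coeff_C, coeff_C, coeff_rescale]
      split_ifs with h <;> simp [h]
  · refine biSeries_ext fun i j => ?_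
    rw [coeff_biRescale, coeff_C, coeff_C]
    split_ifs with h <;> simp [h, coeff_rescale]

theorem map_prod_inv {ι : Type*} (F : Finset ι) (f : ι → ℝ⟦X⟧) (hf : ∀ u, constantCoeff (f u) = 1) :
    (∏ u ∈ F, f u)⁻¹ = ∏ u ∈ F, (f u)⁻¹ := by
  symm
  rw [PowerSeries.eq_inv_iff_mul_eq_one, ← Finset.prod_mul_distrib]
  · exact Finset.prod_eq_one fun u _ => PowerSeries.inv_mul_cancel _ (by simp [hf])
  · simp [map_prod, hf]

/-- Inversion is multiplicative, so the product over sites is the joint series of two whole linear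
combinations divided by their marginals. This links the algebra per site to the Appell polynomials
of the sums. -/
theorem prod_covSeries {ι : Type*} (h0 : m 0 = 1) (F : Finset ι) (a b : ι → ℝ) :
    ∏ u ∈ F, covSeries m (a u) (b u) = (∏ u ∈ F, jointSeries m (a u) (b u)) *
      map C (∏ u ∈ F, momentSeries m (a u))⁻¹ * C (∏ u ∈ F, momentSeries m (b u))⁻¹ := by
  rw [map_prod_inv F _ fun u => constantCoeff_momentSeries h0 (a u),
    map_prod_inv F _ fun u => constantCoeff_momentSeries h0 (b u), map_prod, map_prod]
  simp only [covSeries, Finset.prod_mul_distrib]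

theorem coeff_zero_jointSeries (m : ℕ → ℝ) (a b : ℝ) :
    coeff 0 (jointSeries m a b) = momentSeries m b := by
  ext j; simp [jointSeries, momentSeries]

theorem coeff_coeff_zero_jointSeries (m : ℕ → ℝ) (a b : ℝ) :
    map (constantCoeff (R := ℝ)) (jointSeries m a b) = momentSeries m a := by
  ext i
  rw [coeff_map, ← coeff_zero_eq_constantCoeff_apply]
  simp [jointSeries, momentSeries]

/-- Setting the outer variable to zero reduces the joint series to a marginal, which its denominator
cancels. This is the formal version of E A_l = 0 for l ≥ 1. -/
theorem constantCoeff_covSeries (h0 : m 0 = 1) (a b : ℝ) :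
    constantCoeff (covSeries m a b) = 1 := by
  have ha := constantCoeff_momentSeries h0 a
  have hb := constantCoeff_momentSeries h0 b
  rw [covSeries, map_mul, map_mul, ← coeff_zero_eq_constantCoeff_apply (jointSeries m a b),
    coeff_zero_jointSeries, ← coeff_zero_eq_constantCoeff_apply (map C _), coeff_map]
  simp only [coeff_zero_eq_constantCoeff, constantCoeff_inv, ha, constantCoeff_C, inv_one,
    map_one, mul_one]
  exact PowerSeries.mul_inv_cancel _ (by simp [hb])

theorem map_constantCoeff_covSeries (h0 : m 0 = 1) (a b : ℝ) :
    map (constantCoeff (R := ℝ)) (covSeries m a b) = 1 := by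
  have ha := constantCoeff_momentSeries h0 a
  have hb := constantCoeff_momentSeries h0 b
  have h1 : map (constantCoeff (R := ℝ)) (map C (momentSeries m a)⁻¹) = (momentSeries m a)⁻¹ := by
    ext i; simp [coeff_map]
  rw [covSeries, map_mul, map_mul, coeff_coeff_zero_jointSeries, h1, map_C]
  simp [constantCoeff_inv, hb, PowerSeries.mul_inv_cancel, ha]

theorem coeff_one_inv_momentSeries (h0 : m 0 = 1) (h1 : m 1 = 0) (a : ℝ) :
    coeff 1 (momentSeries m a)⁻¹ = 0 := by
  have ha := constantCoeff_momentSeries h0 a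
  have hm : coeff 1 (momentSeries m a) = 0 := by simp [momentSeries, h1]
  have := congrArg (coeff 1) (PowerSeries.mul_inv_cancel (momentSeries m a) (by simp [ha]))
  rw [coeff_mul] at this
  simpa [Finset.Nat.antidiagonal_succ, hm, ha, coeff_one] using this

/-- By centring the denominators have no first-order term, so only the variance survives. This
normalises the leading cumulant to 1. -/
theorem coeff_one_one_covSeries (h0 : m 0 = 1) (h1 : m 1 = 0) (h2 : m 2 = 1) :
    coeff 1 (coeff 1 (covSeries m 1 1)) = 1 := by
  have hc := constantCoeff_momentSeries h0 1
  have hi := coeff_one_inv_momentSeries h0 h1 1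
  have hJ : coeff 1 (jointSeries m 1 1 * map C (momentSeries m 1)⁻¹)
      = coeff 1 (jointSeries m 1 1) := by
    rw [coeff_mul]
    simp only [Finset.Nat.antidiagonal_succ, Finset.Nat.antidiagonal_zero, Finset.map_singleton,
      Finset.sum_cons, Finset.sum_singleton, coeff_map, hi]
    simp [hc]
  have h11 : coeff 1 (coeff 1 (jointSeries m 1 1)) = 1 := by simp [jointSeries, h2]
  rw [covSeries, coeff_mul_C, hJ, coeff_mul]
  simp [Finset.Nat.antidiagonal_succ, hi, h11, hc]

/-- The logarithmic derivative of `covSeries m 1 1`: its coefficients play the role of joint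
cumulants. -/
theorem exists_cumulants (h0 : m 0 = 1) (h1 : m 1 = 0) (h2 : m 2 = 1) :
    ∃ κ : ℕ → ℕ → ℝ, (∀ j, κ 0 j = 0) ∧ (∀ i, κ i 0 = 0) ∧ κ 1 1 = 1 ∧
      ∀ {ι : Type} (F : Finset ι) (a b : ι → ℝ) (k l : ℕ),
        k * coeff l (coeff k (∏ u ∈ F, covSeries m (a u) (b u))) =
          ∑ x ∈ Finset.HasAntidiagonal.antidiagonal k, ∑ y ∈ Finset.HasAntidiagonal.antidiagonal l,
            (κ x.1 y.1 * ∑ u ∈ F, a u ^ x.1 * b u ^ y.1) *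
              coeff y.2 (coeff x.2 (∏ u ∈ F, covSeries m (a u) (b u))) := by
  have hg := constantCoeff_covSeries h0 1 1
  obtain ⟨h, hh⟩ := exists_mul_eq_X_mul_derivative hg
  have hk0 : coeff 0 h = 0 := by
    have := congrArg (coeff 0) hh
    rw [coeff_X_mul_derivative, coeff_mul] at this
    simpa [hg] using this
  refine ⟨fun i j => coeff j (coeff i h), fun j => by simp [hk0], fun i => ?_, ?_, ?_⟩
  -- With the inner variable set to zero the series is 1, whose logarithmic derivative vanishes.
  · have := congrArg (PowerSeries.map (constantCoeff (R := ℝ))) hh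
    rw [map_mul, map_constantCoeff_covSeries h0, mul_one] at this
    have := congrArg (coeff i) this
    have hone : constantCoeff (coeff i (covSeries m 1 1)) = coeff i (1 : ℝ⟦X⟧) := by
      rw [← coeff_map, map_constantCoeff_covSeries h0]
    rw [coeff_map, coeff_map, coeff_X_mul_derivative, map_mul, hone, coeff_one] at this
    change coeff 0 (coeff i h) = 0
    rw [coeff_zero_eq_constantCoeff_apply, this]
    split_ifs with hi <;> simp [hi]
  · have := congrArg (coeff 1) hh
    rw [coeff_X_mul_derivative, coeff_mul] at this
    have h3 : coeff 1 h = coeff 1 (covSeries m 1 1) := by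
      simpa [Finset.Nat.antidiagonal_succ, hk0, hg] using this
    simpa [h3] using coeff_one_one_covSeries h0 h1 h2
  · intro ι F a b k l
    have hrec := X_mul_derivative_prod (fun u => biRescale (a u) (b u))
      (fun u f => X_mul_derivative_biRescale (a u) (b u) f) hh F
    simp_rw [← covSeries_eq_biRescale h0] at hrec
    have := congrArg (fun f => coeff l (coeff k f)) hrec
    simp only [coeff_X_mul_derivative] at this
    rw [← nsmul_eq_mul, map_nsmul, nsmul_eq_mul, coeff_mul, map_sum] at this
    rw [this]
    refine Finset.sum_congr rfl fun x _ => ?_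
    rw [coeff_mul]
    refine Finset.sum_congr rfl fun y _ => ?_
    rw [map_sum, map_sum, Finset.mul_sum]
    congr 1
    refine Finset.sum_congr rfl fun u _ => ?_
    rw [coeff_biRescale, mul_comm]

end Bivariate

/-! ### The recursion for the diagonal coefficient -/

/-- Solutions of `k G(k,l) = ∑ H(i,j) G(k-i,l-j)` when `H` is controlled by two small parameters
`Z ≤ X`: the diagonal coefficient `G(k,k)` is `H(1,1)^k / k!` up to a smaller error. -/
theorem exists_diagonal_bound (B : ℝ) (hB : 1 ≤ B) (n : ℕ) :
    ∃ C : ℝ, 1 ≤ C ∧ ∀ (G H : ℕ → ℕ → ℝ) (X Z : ℝ), 0 < Z → Z ≤ X → X ≤ 1 →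
      (∀ k l, k * G k l = ∑ x ∈ Finset.HasAntidiagonal.antidiagonal k,
        ∑ y ∈ Finset.HasAntidiagonal.antidiagonal l, H x.1 y.1 * G x.2 y.2) →
      G 0 0 = 1 → (∀ l, 1 ≤ l → G 0 l = 0) → (∀ j, H 0 j = 0) → (∀ i, H i 0 = 0) →
      |H 1 1| ≤ B * X →
      (∀ i j, 1 ≤ i → i ≤ n → 1 ≤ j → j ≤ n → i ≠ j → |H i j| ≤ B * Z) →
      (∀ i, 2 ≤ i → i ≤ n → |H i i| ≤ B * Z ^ i) →
      |G n n - H 1 1 ^ n / n.factorial| ≤ C * (Z * X ^ (n - 1) + Z ^ 2) := by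
  -- Unfold the recursion along lattice paths from (0,0) to (n,n). Steps (1,1) alone give
  -- H(1,1)^n/n!. A path leaving the diagonal direction needs a second unequal step to come back,
  -- which costs Z²; a path of diagonal steps containing some (i,i) with i ≥ 2 costs Zⁱ X^(n-i) ≤ Z
  -- X^(n-1). The induction therefore carries along the bound O(Z) off the diagonal and the size of
  -- the diagonal coefficients.
  suffices h : ∀ m : ℕ, ∃ C : ℝ, 1 ≤ C ∧ ∀ (G H : ℕ → ℕ → ℝ) (X Z : ℝ), 0 < Z → Z ≤ X → X ≤ 1 →
      (∀ k l, k * G k l = ∑ x ∈ Finset.HasAntidiagonal.antidiagonal k,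
        ∑ y ∈ Finset.HasAntidiagonal.antidiagonal l, H x.1 y.1 * G x.2 y.2) →
      G 0 0 = 1 → (∀ l, 1 ≤ l → G 0 l = 0) → (∀ j, H 0 j = 0) → (∀ i, H i 0 = 0) →
      |H 1 1| ≤ B * X →
      (∀ i j, 1 ≤ i → i ≤ n → 1 ≤ j → j ≤ n → i ≠ j → |H i j| ≤ B * Z) →
      (∀ i, 2 ≤ i → i ≤ n → |H i i| ≤ B * Z ^ i) →
      ∀ k, k ≤ m → k ≤ n → (∀ l ≤ n, k ≠ l → |G k l| ≤ C * Z) ∧ |G k k| ≤ C * (X ^ k + Z ^ 2) ∧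
        |G k k - H 1 1 ^ k / k.factorial| ≤ C * (Z * X ^ (k - 1) + Z ^ 2) by
    obtain ⟨C, hC, h⟩ := h n
    exact ⟨C, hC, fun G H X Z h1 h2 h3 h4 h5 h6 h7 h8 h9 h10 h11 =>
      (h G H X Z h1 h2 h3 h4 h5 h6 h7 h8 h9 h10 h11 n le_rfl le_rfl).2.2⟩
  intro m
  induction m with
  | zero =>
    refine ⟨1, le_rfl, fun G H X Z hZ hZX hX hrec hG0 hGl _ _ _ _ _ k hk _ => ?_⟩
    obtain rfl : k = 0 := by omega
    refine ⟨fun l _ hl => ?_, ?_, ?_⟩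
    · rw [hGl l (by omega)]; simp [hZ.le]
    · simp [hG0, sq_nonneg]
    · simp [hG0]; positivity
  | succ m ih =>
    obtain ⟨C, hC, ih⟩ := ih
    -- The first part counts the index pairs, each contributing an error of at most 2BC; the second
    -- is the earlier diagonal error transported by H(1,1).
    set L : ℝ := (m + 2) * (n + 1) * (B * (2 * C)) + B * C with hL
    have hn0 : (0 : ℝ) ≤ n := Nat.cast_nonneg n
    have hm0 : (0 : ℝ) ≤ m := Nat.cast_nonneg m
    refine ⟨C + (L + B ^ (m + 1)), ?_, ?_⟩
    · have : 0 ≤ L + B ^ (m + 1) := by positivity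
      linarith
    intro G H X Z hZ hZX hX hrec hG0 hGl hH0 hH0' hH11 hHij hHii k hk hkn
    have hX0 : 0 < X := hZ.trans_le hZX
    have hZ1 : Z ≤ 1 := hZX.trans hX
    have IH := ih G H X Z hZ hZX hX hrec hG0 hGl hH0 hH0' hH11 hHij hHii
    have hbig : 0 ≤ L + B ^ (m + 1) := by positivity
    rcases Nat.lt_or_ge m k with hmk | hmk
    swap
    · obtain ⟨h1, h2, h3⟩ := IH k hmk hkn
      refine ⟨fun l hl hkl => (h1 l hl hkl).trans ?_, h2.trans ?_, h3.trans ?_⟩ <;>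
        exact mul_le_mul_of_nonneg_right (by linarith) (by positivity)
    obtain rfl : k = m + 1 := by omega
    have hone : ∀ j : ℕ, X ^ j ≤ 1 := fun j => pow_le_one₀ hX0.le hX
    have hpp : Z ^ 2 ≤ Z := by nlinarith
    have term_ne : ∀ x y : ℕ × ℕ, ∀ l, l ≤ n → x.1 + x.2 = m + 1 → y.1 + y.2 = l → m + 1 ≠ l →
        |H x.1 y.1 * G x.2 y.2| ≤ B * (2 * C) * Z := by
      intro x y l hl hx hy hkl
      rcases Nat.eq_zero_or_pos x.1 with h | hx1
      · rw [h, hH0]; simp; positivity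
      rcases Nat.eq_zero_or_pos y.1 with h | hy1
      · rw [h, hH0']; simp; positivity
      rw [abs_mul]
      by_cases hxy : x.1 = y.1
      · have hG := (IH x.2 (by omega) (by omega)).1 y.2 (by omega) (by omega)
        have hHB : |H x.1 y.1| ≤ B := by
          rw [← hxy]
          rcases Nat.lt_or_ge x.1 2 with h2 | h2
          · have : x.1 = 1 := by omega
            rw [this]; nlinarith
          · have := hHii x.1 h2 (by omega)
            have : Z ^ x.1 ≤ 1 := pow_le_one₀ hZ.le hZ1
            nlinarith
        calc _ ≤ B * (C * Z) := mul_le_mul hHB hG (abs_nonneg _) (by positivity)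
          _ ≤ _ := by nlinarith [show 0 ≤ B * (C * Z) by positivity]
      · have hHB := hHij x.1 y.1 hx1 (by omega) hy1 (by omega) hxy
        have hGC : |G x.2 y.2| ≤ 2 * C := by
          by_cases h2 : x.2 = y.2
          · rw [← h2]
            refine (IH x.2 (by omega) (by omega)).2.1.trans ?_
            have := hone x.2
            nlinarith
          · have := (IH x.2 (by omega) (by omega)).1 y.2 (by omega) h2
            nlinarith
        calc _ ≤ (B * Z) * (2 * C) := mul_le_mul hHB hGC (abs_nonneg _) (by positivity)
          _ = _ := by ring
    set E := Z * X ^ m + Z ^ 2 with hE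
    have hE0 : 0 < E := by positivity
    have term_eq : ∀ x y : ℕ × ℕ, x.1 + x.2 = m + 1 → y.1 + y.2 = m + 1 →
        |H x.1 y.1 * G x.2 y.2 - (if x = (1, m) ∧ y = (1, m) then H 1 1 * G m m else 0)|
          ≤ B * (2 * C) * E := by
      intro x y hx hy
      by_cases h11 : x = (1, m) ∧ y = (1, m)
      · rw [if_pos h11, h11.1, h11.2]; simp; positivity
      rw [if_neg h11, sub_zero]
      rcases Nat.eq_zero_or_pos x.1 with h | hx1
      · rw [h, hH0]; simp; positivity
      rcases Nat.eq_zero_or_pos y.1 with h | hy1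
      · rw [h, hH0']; simp; positivity
      rw [abs_mul]
      by_cases hxy : x.1 = y.1
      · have hxy2 : x.2 = y.2 := by omega
        rw [← hxy, ← hxy2]
        rcases Nat.lt_or_ge x.1 2 with h2 | h2
        · exfalso
          apply h11
          constructor <;> ext <;> simp <;> omega
        · have hHB := hHii x.1 h2 (by omega)
          have hG := (IH x.2 (by omega) (by omega)).2.1
          obtain ⟨i, hi⟩ := Nat.exists_eq_add_of_le h2
          have e1 : Z ^ x.1 ≤ Z * X ^ (x.1 - 1) := by
            have : x.1 = (x.1 - 1) + 1 := by omega
            conv_lhs => rw [this, pow_succ, mul_comm]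
            gcongr
          have e2 : Z ^ x.1 ≤ 1 := pow_le_one₀ hZ.le hZ1
          have e3 : Z ^ x.1 * (X ^ x.2 + Z ^ 2) ≤ E := by
            rw [mul_add, hE]
            refine add_le_add ?_ (mul_le_of_le_one_left (by positivity) e2)
            calc Z ^ x.1 * X ^ x.2 ≤ (Z * X ^ (x.1 - 1)) * X ^ x.2 := by gcongr
              _ = Z * X ^ m := by rw [mul_assoc, ← pow_add]; congr 2; omega
          calc _ ≤ (B * Z ^ x.1) * (C * (X ^ x.2 + Z ^ 2)) :=
                mul_le_mul hHB hG (abs_nonneg _) (by positivity)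
            _ = B * C * (Z ^ x.1 * (X ^ x.2 + Z ^ 2)) := by ring
            _ ≤ B * C * E := by gcongr
            _ ≤ _ := by nlinarith [show 0 ≤ B * C * E by positivity]
      -- An unequal first step leaves an unequal remainder, so both factors are O(Z).
      · have hHB := hHij x.1 y.1 hx1 (by omega) hy1 (by omega) hxy
        have hG := (IH x.2 (by omega) (by omega)).1 y.2 (by omega) (by omega)
        calc _ ≤ (B * Z) * (C * Z) := mul_le_mul hHB hG (abs_nonneg _) (by positivity)
          _ = B * C * Z ^ 2 := by ring
          _ ≤ B * C * E := by gcongr; rw [hE]; linarith [show 0 ≤ Z * X ^ m by positivity]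
          _ ≤ _ := by nlinarith [show 0 ≤ B * C * E by positivity]
    have hcard : ∀ l ≤ n, ∀ (f : ℕ × ℕ → ℕ × ℕ → ℝ) (b : ℝ), 0 ≤ b →
        (∀ x y : ℕ × ℕ, x.1 + x.2 = m + 1 → y.1 + y.2 = l → |f x y| ≤ b) →
        |∑ x ∈ Finset.HasAntidiagonal.antidiagonal (m + 1),
          ∑ y ∈ Finset.HasAntidiagonal.antidiagonal l, f x y| ≤ (m + 2) * (n + 1) * b := by
      intro l hl f b hb hf
      calc _ ≤ ∑ x ∈ Finset.HasAntidiagonal.antidiagonal (m + 1),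
            ∑ y ∈ Finset.HasAntidiagonal.antidiagonal l, b := by
            refine (Finset.abs_sum_le_sum_abs _ _).trans (Finset.sum_le_sum fun x hx => ?_)
            refine (Finset.abs_sum_le_sum_abs _ _).trans (Finset.sum_le_sum fun y hy => ?_)
            exact hf x y (Finset.HasAntidiagonal.mem_antidiagonal.1 hx)
              (Finset.HasAntidiagonal.mem_antidiagonal.1 hy)
        _ = (m + 2) * (l + 1) * b := by simp; ring
        _ ≤ _ := by gcongr
    have hdiv : ∀ r : ℝ, |r| ≤ |((m + 1 : ℕ) : ℝ) * r| := by
      intro r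
      rw [abs_mul]
      refine le_mul_of_one_le_left (abs_nonneg _) ?_
      rw [Nat.abs_cast]; push_cast; linarith
    have hLle : (m + 2) * (n + 1) * (B * (2 * C)) ≤ C + (L + B ^ (m + 1)) := by
      have : 0 ≤ B * C + B ^ (m + 1) := by positivity
      linarith
    have hmain : |G (m + 1) (m + 1) - H 1 1 ^ (m + 1) / (m + 1).factorial| ≤ L * E := by
      refine (hdiv _).trans ?_
      have hfac : ((m + 1 : ℕ) : ℝ) * (H 1 1 ^ (m + 1) / (m + 1).factorial)
          = H 1 1 * (H 1 1 ^ m / m.factorial) := by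
        rw [Nat.factorial_succ]; push_cast; field_simp; ring
      have hind : ∑ x ∈ Finset.HasAntidiagonal.antidiagonal (m + 1),
          ∑ y ∈ Finset.HasAntidiagonal.antidiagonal (m + 1),
            (if x = (1, m) ∧ y = (1, m) then H 1 1 * G m m else 0) = H 1 1 * G m m := by
        have hmem : ((1, m) : ℕ × ℕ) ∈ Finset.HasAntidiagonal.antidiagonal (m + 1) := by
          rw [Finset.HasAntidiagonal.mem_antidiagonal]; omega
        rw [Finset.sum_eq_single (1, m), Finset.sum_eq_single (1, m)]
        · simp
        · intro y _ hy; simp [hy]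
        · exact fun h => absurd hmem h
        · intro x _ hx; simp [hx]
        · exact fun h => absurd hmem h
      have hsplit : ((m + 1 : ℕ) : ℝ) * (G (m + 1) (m + 1) - H 1 1 ^ (m + 1) / (m + 1).factorial)
          = (∑ x ∈ Finset.HasAntidiagonal.antidiagonal (m + 1),
            ∑ y ∈ Finset.HasAntidiagonal.antidiagonal (m + 1), (H x.1 y.1 * G x.2 y.2 -
              (if x = (1, m) ∧ y = (1, m) then H 1 1 * G m m else 0)))
            + H 1 1 * (G m m - H 1 1 ^ m / m.factorial) := by
        simp only [Finset.sum_sub_distrib]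
        rw [hind, mul_sub, hrec, hfac]; ring
      rw [hsplit]
      refine (abs_add_le _ _).trans ?_
      have hA := hcard (m + 1) hkn _ (B * (2 * C) * E) (by positivity) term_eq
      have hBd : |H 1 1 * (G m m - H 1 1 ^ m / m.factorial)| ≤ B * C * E := by
        rw [abs_mul]
        have h3 := (IH m le_rfl (by omega)).2.2
        -- For m = 0 the truncated exponent m - 1 is 0, and the claim reads X ≤ 1.
        have hXX : X * X ^ (m - 1) ≤ X ^ m := by
          rcases Nat.eq_zero_or_pos m with rfl | hmpos
          · simpa using hX
          · rw [← pow_succ', Nat.sub_add_cancel hmpos]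
        calc _ ≤ (B * X) * (C * (Z * X ^ (m - 1) + Z ^ 2)) :=
              mul_le_mul hH11 h3 (abs_nonneg _) (by positivity)
          _ = B * C * (Z * (X * X ^ (m - 1)) + X * Z ^ 2) := by ring
          _ ≤ B * C * (Z * X ^ m + 1 * Z ^ 2) := by gcongr
          _ = _ := by rw [one_mul]
      calc _ ≤ _ := add_le_add hA hBd
        _ = _ := by rw [hL]; ring
    refine ⟨fun l hl hkl => ?_, ?_, ?_⟩
    · refine (hdiv _).trans ?_
      rw [hrec]
      refine (hcard l hl _ (B * (2 * C) * Z) (by positivity)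
        fun x y hx hy => term_ne x y l hl hx hy hkl).trans ?_
      rw [← mul_assoc]
      gcongr
    · have hpow : |H 1 1 ^ (m + 1) / (m + 1).factorial| ≤ B ^ (m + 1) * X ^ (m + 1) := by
        rw [abs_div, abs_pow, ← mul_pow, Nat.abs_cast]
        refine (div_le_self (by positivity) ?_).trans (pow_le_pow_left₀ (abs_nonneg _) hH11 _)
        exact_mod_cast Nat.factorial_pos (m + 1)
      have hEle : E ≤ X ^ (m + 1) + Z ^ 2 := by
        rw [hE, pow_succ' X m, add_le_add_iff_right]
        gcongr
      have hab := abs_add_le (G (m + 1) (m + 1) - H 1 1 ^ (m + 1) / (m + 1).factorial)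
        (H 1 1 ^ (m + 1) / (m + 1).factorial)
      rw [sub_add_cancel] at hab
      calc _ ≤ L * E + B ^ (m + 1) * X ^ (m + 1) := hab.trans (add_le_add hmain hpow)
        _ ≤ L * (X ^ (m + 1) + Z ^ 2) + B ^ (m + 1) * (X ^ (m + 1) + Z ^ 2) := by
            gcongr
            linarith [sq_nonneg Z]
        _ = (L + B ^ (m + 1)) * (X ^ (m + 1) + Z ^ 2) := by ring
        _ ≤ _ := mul_le_mul_of_nonneg_right (by linarith) (by positivity)
    · refine hmain.trans ?_
      rw [Nat.add_sub_cancel]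
      exact mul_le_mul_of_nonneg_right (by linarith [show 0 ≤ B ^ (m + 1) by positivity]) hE0.le

/-! ### Appell polynomials through the inverse moment series -/

section AppellPolynomial

open PowerSeries

/-- The convolution is unitriangular because m 0 = 1. Deconvolving only up to order k matters: the
Leibniz formula for the characteristic function is available only up to that order. -/
theorem eq_of_convolution_eq {m B T : ℕ → ℂ} (h0 : m 0 = 1) {k : ℕ}
    (h : ∀ n ≤ k, ∑ i ∈ Finset.range (n + 1), m i * B (n - i)
      = ∑ i ∈ Finset.range (n + 1), m i * T (n - i)) : ∀ n ≤ k, B n = T n := by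
  intro n
  induction n using Nat.strong_induction_on with
  | _ n ih =>
    intro hn
    have := h n hn
    rw [Finset.sum_range_succ', Finset.sum_range_succ' _ n] at this
    have hs : ∑ i ∈ Finset.range n, m (i + 1) * B (n - (i + 1))
        = ∑ i ∈ Finset.range n, m (i + 1) * T (n - (i + 1)) := by
      refine Finset.sum_congr rfl fun i hi => ?_
      rw [Finset.mem_range] at hi
      rw [ih (n - (i + 1)) (by omega) (by omega)]
    rw [hs] at this
    simpa [h0] using this

theorem iteratedDeriv_cexp_I_mul (x : ℝ) (n : ℕ) :
    iteratedDeriv n (fun u : ℝ => Complex.exp (Complex.I * u * x)) = fun u : ℝ =>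
      (Complex.I * x) ^ n * Complex.exp (Complex.I * u * x) := by
  induction n with
  | zero => simp
  | succ n ih =>
    rw [iteratedDeriv_succ, ih]
    ext u
    have h1 : HasDerivAt (fun u : ℝ => Complex.I * (u : ℂ) * x) (Complex.I * x) u := by
      simpa using ((Complex.ofRealCLM.hasDerivAt (x := u)).const_mul Complex.I).mul_const (x : ℂ)
    rw [(h1.cexp.const_mul _).deriv, pow_succ]
    ring

/-- The `k`-th Appell polynomial in terms of the inverse of the moment series. -/
theorem appell_eq_sum {ν : Measure ℝ} [IsProbabilityMeasure ν] {k : ℕ} (hν : MemLp id k ν)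
    (x : ℝ) : appell k ν x = k.factorial * ∑ y ∈ Finset.HasAntidiagonal.antidiagonal k,
      x ^ y.1 / y.1.factorial * coeff y.2 (momentSeries (fun n => ∫ t, t ^ n ∂ν) 1)⁻¹ := by
  set m : ℕ → ℝ := fun n => ∫ t, t ^ n ∂ν with hm
  have hm0 : m 0 = 1 := by simp [hm]
  set M := momentSeries m 1 with hM
  have hM0 : constantCoeff M = 1 := constantCoeff_momentSeries hm0 1
  set E : ℝ⟦X⟧ := PowerSeries.mk fun n => x ^ n / n.factorial with hE
  set T : ℕ → ℝ := fun n => coeff n (M⁻¹ * E) with hT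
  set f : ℝ → ℂ := fun u => Complex.exp (Complex.I * u * x) with hf
  set φ : ℝ → ℂ := charFun ν with hφ
  set g : ℝ → ℂ := fun u => f u / φ u with hg
  set B : ℕ → ℂ := fun n => (-Complex.I) ^ n * iteratedDeriv n g 0 / n.factorial with hB
  have hφ0 : φ 0 = 1 := by simp [hφ]
  have hle : ∀ n ≤ k, MemLp id n ν := fun n hn => hν.mono_exponent (by exact_mod_cast hn)
  have hφc : ContDiff ℝ k φ := contDiff_charFun hν
  have hfc : ContDiff ℝ k f := by
    have : ContDiff ℝ k (fun u : ℝ => Complex.I * (u : ℂ) * x) :=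
      (contDiff_const.mul Complex.ofRealCLM.contDiff).mul contDiff_const
    exact this.cexp
  have hgc : ContDiffAt ℝ k g 0 := by
    simp only [hg, div_eq_mul_inv]
    exact hfc.contDiffAt.mul (hφc.contDiffAt.inv (by simp [hφ0]))
  -- Leibniz' rule applied to this product, instead of differentiating a quotient, shows that the
  -- Taylor coefficients `B` solve the same convolution equation as the formal coefficients `T`.
  have hfg : f =ᶠ[𝓝 0] φ * g := by
    have : ∀ᶠ u in 𝓝 (0 : ℝ), φ u ≠ 0 :=
      hφc.continuous.continuousAt.eventually_ne (by simp [hφ0])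
    filter_upwards [this] with u hu
    simp [hg, mul_div_cancel₀ _ hu]
  have hI : Complex.I * -Complex.I = 1 := by simp
  have hBconv : ∀ n ≤ k, ∑ i ∈ Finset.range (n + 1), ((coeff i M : ℝ) : ℂ) * B (n - i)
      = ((x ^ n / n.factorial : ℝ) : ℂ) := by
    intro n hn
    have h1 : iteratedDeriv n f 0 = (Complex.I * x) ^ n := by
      rw [hf, iteratedDeriv_cexp_I_mul]; simp
    rw [hfg.iteratedDeriv_eq, iteratedDeriv_mul (hφc.contDiffAt.of_le (by exact_mod_cast hn))
      (hgc.of_le (by exact_mod_cast hn))] at h1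
    have h2 : ((x ^ n / n.factorial : ℝ) : ℂ)
        = (-Complex.I) ^ n * (Complex.I * x) ^ n / n.factorial := by
      rw [← mul_pow, ← mul_assoc, mul_comm (-Complex.I), hI]; push_cast; ring
    rw [h2, ← h1, Finset.mul_sum, Finset.sum_div]
    refine Finset.sum_congr rfl fun i hi => ?_
    rw [Finset.mem_range] at hi
    have hin : i ≤ n := by omega
    rw [hφ, iteratedDeriv_charFun_zero (hle i (by omega)), Nat.cast_choose ℂ hin]
    have e : (-Complex.I) ^ n = (-Complex.I) ^ i * (-Complex.I) ^ (n - i) := by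
      rw [← pow_add]; congr 1; omega
    have e2 : (-Complex.I) ^ i * Complex.I ^ i = 1 := by
      rw [← mul_pow, mul_comm, hI, one_pow]
    have hn0 : (n.factorial : ℂ) ≠ 0 := by exact_mod_cast n.factorial_ne_zero
    have hi0 : (i.factorial : ℂ) ≠ 0 := by exact_mod_cast i.factorial_ne_zero
    have hni0 : ((n - i).factorial : ℂ) ≠ 0 := by exact_mod_cast (n - i).factorial_ne_zero
    simp only [hB, hM, momentSeries, coeff_mk, one_pow, one_mul, hm]
    rw [e]
    push_cast
    have e3 : ∀ A c d : ℂ, (-Complex.I) ^ i * A * (n.factorial / (i.factorial * (n - i).factorial)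
        * (Complex.I ^ i * c) * d) / n.factorial = c / i.factorial * (A * d / (n - i).factorial) := by
      intro A c d
      calc _ = ((-Complex.I) ^ i * Complex.I ^ i) * A * ((n.factorial / (i.factorial *
            (n - i).factorial)) * c * d) / n.factorial := by ring
        _ = _ := by rw [e2]; field_simp
    rw [e3]
  have hTconv : ∀ n, ∑ i ∈ Finset.range (n + 1), ((coeff i M : ℝ) : ℂ) * ((T (n - i) : ℝ) : ℂ)
      = ((x ^ n / n.factorial : ℝ) : ℂ) := by
    intro n
    have h1 : M * (M⁻¹ * E) = E := by
      rw [← mul_assoc, PowerSeries.mul_inv_cancel _ (by simp [hM0]), one_mul]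
    have h2 := congrArg (coeff n) h1
    rw [coeff_mul, Finset.Nat.sum_antidiagonal_eq_sum_range_succ_mk] at h2
    have h3 : coeff n E = x ^ n / n.factorial := by simp [hE]
    rw [← h3, ← h2]
    push_cast
    rfl
  have hBT : B k = ((T k : ℝ) : ℂ) := eq_of_convolution_eq
    (m := fun i => ((coeff i M : ℝ) : ℂ)) (T := fun n => ((T n : ℝ) : ℂ))
    (by simp [hM0]) (fun n hn => (hBconv n hn).trans (hTconv n).symm) k le_rfl
  have hk0 : (k.factorial : ℂ) ≠ 0 := by exact_mod_cast k.factorial_ne_zero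
  have h4 : (-Complex.I) ^ k * iteratedDeriv k g 0 = ((k.factorial * T k : ℝ) : ℂ) := by
    rw [div_eq_iff hk0] at hBT
    rw [hBT]; push_cast; ring
  have h5 : appell k ν x = k.factorial * T k := by
    rw [appell]
    change ((-Complex.I) ^ k * iteratedDeriv k g 0).re = _
    rw [h4, Complex.ofReal_re]
  rw [h5, hT, mul_comm M⁻¹ E]
  simp only [coeff_mul, hE, coeff_mk]

end AppellPolynomial

/-! ### Joint moments under convergence in Lⁿ -/

section LpPowers

variable {Ω : Type*} [MeasurableSpace Ω] {μ : Measure Ω}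

/-- Hölder's inequality applied to FG - fg = (F-f)(G-g) + (F-f)g + f(G-g). -/
theorem tendsto_eLpNorm_mul_sub {ι : Type*} {l : Filter ι} {p q r : ENNReal}
    [ENNReal.HolderTriple p q r] (hr : 1 ≤ r) {F G : ι → Ω → ℝ} {f g : Ω → ℝ}
    (hF : ∀ n, MemLp (F n) p μ) (hG : ∀ n, MemLp (G n) q μ) (hf : MemLp f p μ) (hg : MemLp g q μ)
    (h1 : Tendsto (fun n => eLpNorm (F n - f) p μ) l (𝓝 0))
    (h2 : Tendsto (fun n => eLpNorm (G n - g) q μ) l (𝓝 0)) :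
    Tendsto (fun n => eLpNorm (F n * G n - f * g) r μ) l (𝓝 0) := by
  have hb : ∀ n, eLpNorm (F n * G n - f * g) r μ ≤
      eLpNorm (F n - f) p μ * eLpNorm (G n - g) q μ +
        eLpNorm (F n - f) p μ * eLpNorm g q μ + eLpNorm f p μ * eLpNorm (G n - g) q μ := by
    intro n
    have e : F n * G n - f * g = (F n - f) • (G n - g) + (F n - f) • g + f • (G n - g) := by
      simp only [smul_eq_mul]; ring
    have m1 := (hF n).1.sub hf.1
    have m2 := (hG n).1.sub hg.1
    rw [e]
    refine (eLpNorm_add_le ((m1.smul m2).add (m1.smul hg.1)) (hf.1.smul m2) hr).trans ?_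
    refine add_le_add ((eLpNorm_add_le (m1.smul m2) (m1.smul hg.1) hr).trans
      (add_le_add ?_ ?_)) ?_
    · exact eLpNorm_smul_le_mul_eLpNorm m2 m1
    · exact eLpNorm_smul_le_mul_eLpNorm hg.1 m1
    · exact eLpNorm_smul_le_mul_eLpNorm m2 hf.1
  refine tendsto_of_tendsto_of_tendsto_of_le_of_le tendsto_const_nhds ?_ (fun _ => zero_le) hb
  have t1 : Tendsto (fun n => eLpNorm (F n - f) p μ * eLpNorm (G n - g) q μ) l (𝓝 (0 * 0)) :=
    ENNReal.Tendsto.mul h1 (by simp) h2 (by simp)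
  have t2 : Tendsto (fun n => eLpNorm (F n - f) p μ * eLpNorm g q μ) l
      (𝓝 (0 * eLpNorm g q μ)) := ENNReal.Tendsto.mul_const h1 (Or.inr hg.2.ne)
  have t3 : Tendsto (fun n => eLpNorm f p μ * eLpNorm (G n - g) q μ) l
      (𝓝 (eLpNorm f p μ * 0)) := ENNReal.Tendsto.const_mul h2 (Or.inr hf.2.ne)
  simpa using (t1.add t2).add t3

/-- The exponent `n / i`, infinite for `i = 0`. -/
noncomputable def powExp (n i : ℕ) : ENNReal := ((i : ENNReal) / n)⁻¹

instance powExp_holderTriple (n i j : ℕ) :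
    ENNReal.HolderTriple (powExp n i) (powExp n j) (powExp n (i + j)) :=
  ⟨by simp [powExp, ENNReal.div_add_div_same]⟩

theorem powExp_one (n : ℕ) : powExp n 1 = n := by simp [powExp]

theorem powExp_zero (n : ℕ) : powExp n 0 = ⊤ := by simp [powExp]

theorem one_le_powExp {n i : ℕ} (h : i ≤ n) : 1 ≤ powExp n i := by
  rw [powExp, ENNReal.one_le_inv]
  exact ENNReal.div_le_of_le_mul (by rw [one_mul]; exact_mod_cast h)

variable [IsProbabilityMeasure μ]

theorem MemLp.pow_powExp {n : ℕ} {f : Ω → ℝ} (hf : MemLp f n μ) (i : ℕ) :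
    MemLp (f ^ i) (powExp n i) μ := by
  induction i with
  | zero => rw [powExp_zero, pow_zero]; exact memLp_const 1
  | succ i ih =>
    rw [pow_succ]
    refine MemLp.mul (p := powExp n i) (q := powExp n 1) ?_ ih
    rwa [powExp_one]

theorem MemLp.pow_mul_pow {n : ℕ} {f g : Ω → ℝ} (hf : MemLp f n μ) (hg : MemLp g n μ) (i j : ℕ) :
    MemLp (f ^ i * g ^ j) (powExp n (i + j)) μ :=
  MemLp.mul (p := powExp n i) (q := powExp n j) (MemLp.pow_powExp hg j) (MemLp.pow_powExp hf i)

theorem MemLp.integrable_pow_mul_pow {n : ℕ} {f g : Ω → ℝ} (hf : MemLp f n μ) (hg : MemLp g n μ)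
    {i j : ℕ} (h : i + j ≤ n) : Integrable (f ^ i * g ^ j) μ :=
  (MemLp.pow_mul_pow hf hg i j).integrable (one_le_powExp h)

theorem tendsto_eLpNorm_pow_sub {ι : Type*} {l : Filter ι} {n : ℕ} {F : ι → Ω → ℝ} {f : Ω → ℝ}
    (hF : ∀ a, MemLp (F a) n μ) (hf : MemLp f n μ)
    (h : Tendsto (fun a => eLpNorm (F a - f) n μ) l (𝓝 0)) {i : ℕ} (hi : i ≤ n) :
    Tendsto (fun a => eLpNorm (F a ^ i - f ^ i) (powExp n i) μ) l (𝓝 0) := by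
  induction i with
  | zero => simpa using tendsto_const_nhds
  | succ i ih =>
    simp_rw [pow_succ]
    refine tendsto_eLpNorm_mul_sub (p := powExp n i) (q := powExp n 1) (one_le_powExp hi)
      (fun a => MemLp.pow_powExp (hF a) i) ?_ (MemLp.pow_powExp hf i) ?_ (ih (by omega)) ?_
    all_goals rwa [powExp_one]

/-- Convergence in `Lⁿ` implies convergence of joint moments of total order at most `n`. -/
theorem tendsto_integral_pow_mul_pow {ι : Type*} {l : Filter ι} {n : ℕ} {F G : ι → Ω → ℝ}
    {f g : Ω → ℝ} (hF : ∀ a, MemLp (F a) n μ) (hf : MemLp f n μ)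
    (h1 : Tendsto (fun a => eLpNorm (F a - f) n μ) l (𝓝 0))
    (hG : ∀ a, MemLp (G a) n μ) (hg : MemLp g n μ)
    (h2 : Tendsto (fun a => eLpNorm (G a - g) n μ) l (𝓝 0)) {i j : ℕ} (hij : i + j ≤ n) :
    Tendsto (fun a => ∫ ω, F a ω ^ i * G a ω ^ j ∂μ) l (𝓝 (∫ ω, f ω ^ i * g ω ^ j ∂μ)) := by
  have h := tendsto_eLpNorm_mul_sub (p := powExp n i) (q := powExp n j) (r := powExp n (i + j))
    (one_le_powExp hij) (fun a => MemLp.pow_powExp (hF a) i) (fun a => MemLp.pow_powExp (hG a) j)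
    (MemLp.pow_powExp hf i) (MemLp.pow_powExp hg j) (tendsto_eLpNorm_pow_sub hF hf h1 (by omega))
    (tendsto_eLpNorm_pow_sub hG hg h2 (by omega))
  have hm := MemLp.pow_mul_pow hf hg i j
  have hm' := fun a => MemLp.pow_mul_pow (hF a) (hG a) i j
  refine tendsto_integral_of_L1' (f ^ i * g ^ j) hm.1
    (F := fun a => F a ^ i * G a ^ j)
    (Eventually.of_forall fun a => (hm' a).integrable (one_le_powExp hij)) ?_
  refine tendsto_of_tendsto_of_tendsto_of_le_of_le tendsto_const_nhds h (fun _ => zero_le)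
    fun a => ?_
  exact eLpNorm_le_eLpNorm_of_exponent_le (one_le_powExp hij) ((hm' a).1.sub hm.1)

end LpPowers

-- Each coefficient of an inverse is a polynomial in finitely many coefficients of the series, so
-- convergence propagates by recursion on the order.
open PowerSeries in
theorem tendsto_coeff_inv {ι : Type*} {l : Filter ι} {f : ι → ℝ⟦X⟧} {g : ℝ⟦X⟧}
    (hf : ∀ a, constantCoeff (f a) = 1) (hg : constantCoeff g = 1) {k : ℕ}
    (h : ∀ n ≤ k, Tendsto (fun a => coeff n (f a)) l (𝓝 (coeff n g))) :
    ∀ n ≤ k, Tendsto (fun a => coeff n (f a)⁻¹) l (𝓝 (coeff n g⁻¹)) := by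
  intro n
  induction n using Nat.strong_induction_on with
  | _ n ih =>
    intro hn
    by_cases h0 : n = 0
    · subst h0
      simpa [hf, hg] using tendsto_const_nhds
    have hinv : ∀ φ : ℝ⟦X⟧, constantCoeff φ = 1 → coeff n φ⁻¹ =
        -1 * ∑ x ∈ Finset.HasAntidiagonal.antidiagonal n,
          if x.2 < n then coeff x.1 φ * coeff x.2 φ⁻¹ else 0 := by
      intro φ hφ
      rw [coeff_inv, if_neg h0, hφ, inv_one]
    rw [hinv g hg]
    simp only [hinv _ (hf _)]
    refine Tendsto.const_mul _ (tendsto_finsetSum _ fun x hx => ?_)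
    rw [Finset.HasAntidiagonal.mem_antidiagonal] at hx
    split_ifs with hxn
    · exact (h _ (by omega)).mul (ih _ hxn (by omega))
    · exact tendsto_const_nhds

theorem add_pow_div_factorial (x y : ℝ) (n : ℕ) :
    (x + y) ^ n / n.factorial = ∑ p ∈ Finset.HasAntidiagonal.antidiagonal n,
      (x ^ p.1 / p.1.factorial) * (y ^ p.2 / p.2.factorial) := by
  rw [(Commute.all x y).add_pow', Finset.sum_div]
  refine Finset.sum_congr rfl fun p hp => ?_
  rw [Finset.HasAntidiagonal.mem_antidiagonal] at hp
  subst hp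
  rw [nsmul_eq_mul, Nat.cast_add_choose]
  have := (p.1 + p.2).factorial_ne_zero
  field_simp

/-! ### Linear combinations of an i.i.d. field -/

section Probability

set_option linter.unusedSectionVars false

variable {Ω : Type*} [MeasurableSpace Ω] {μ : Measure Ω} [IsProbabilityMeasure μ]
  {ε : ℤ × ℤ → Ω → ℝ}

/-- The finite linear combination `∑_{u ∈ F} c(u) ε(u)`. -/
noncomputable def linComb (ε : ℤ × ℤ → Ω → ℝ) (c : ℤ × ℤ → ℝ) (F : Finset (ℤ × ℤ)) (ω : Ω) : ℝ :=
  ∑ u ∈ F, c u * ε u ω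

theorem linComb_insert [DecidableEq (ℤ × ℤ)] (c : ℤ × ℤ → ℝ) {F : Finset (ℤ × ℤ)} {u : ℤ × ℤ}
    (hu : u ∉ F) :
    linComb ε c (insert u F) = fun ω => c u * ε u ω + linComb ε c F ω := by
  ext ω; rw [linComb, Finset.sum_insert hu, linComb]

theorem memLp_linComb {n : ℕ} (h : ∀ u, MemLp (ε u) n μ) (c : ℤ × ℤ → ℝ) (F : Finset (ℤ × ℤ)) :
    MemLp (linComb ε c F) n μ :=
  memLp_finsetSum F fun u _ => (h u).const_mul (c u)

theorem IsStandardIID.integral_pow_eq (hε : IsStandardIID ε μ) (u : ℤ × ℤ) (n : ℕ) :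
    ∫ ω, ε u ω ^ n ∂μ = ∫ ω, ε 0 ω ^ n ∂μ :=
  ((hε.ident u 0).comp (measurable_id.pow_const n)).integral_eq

theorem IsStandardIID.indepFun_linComb (hε : IsStandardIID ε μ) (a b : ℤ × ℤ → ℝ)
    {F : Finset (ℤ × ℤ)} {u : ℤ × ℤ} (hu : u ∉ F) :
    IndepFun (ε u) (fun ω => (linComb ε a F ω, linComb ε b F ω)) μ := by
  have h := hε.indep.indepFun_finset {u} F (by simpa using hu) hε.measurable
  have h1 : Measurable fun z : ({u} : Finset (ℤ × ℤ)) → ℝ => z ⟨u, by simp⟩ :=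
    measurable_pi_apply _
  have h2 : Measurable fun z : F → ℝ => (∑ v : F, a v * z v, ∑ v : F, b v * z v) := by
    fun_prop
  have h3 := h.comp h1 h2
  have e : (fun ω => (linComb ε a F ω, linComb ε b F ω)) =
      (fun z : F → ℝ => (∑ v : F, a v * z v, ∑ v : F, b v * z v)) ∘ fun ω (v : F) => ε v ω := by
    ext ω
    · exact (Finset.sum_coe_sort F fun v => a v * ε v ω).symm
    · exact (Finset.sum_coe_sort F fun v => b v * ε v ω).symm
  rw [e]
  exact h3

open PowerSeries in
/-- Joint moments of two linear combinations of an i.i.d. family. -/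
theorem IsStandardIID.integral_linComb_pow_mul_pow (hε : IsStandardIID ε μ) {n : ℕ}
    (hL : ∀ u, MemLp (ε u) n μ) (a b : ℤ × ℤ → ℝ) (F : Finset (ℤ × ℤ)) {i j : ℕ} (hij : i + j ≤ n) :
    ∫ ω, linComb ε a F ω ^ i / i.factorial * (linComb ε b F ω ^ j / j.factorial) ∂μ
      = coeff j (coeff i (∏ u ∈ F, jointSeries (fun l => ∫ ω, ε 0 ω ^ l ∂μ) (a u) (b u))) := by
  classical
  induction F using Finset.induction_on generalizing i j with
  | empty =>
    simp only [linComb, Finset.sum_empty, Finset.prod_empty, coeff_one]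
    rcases Nat.eq_zero_or_pos i with rfl | hi
    · rcases Nat.eq_zero_or_pos j with rfl | hj
      · simp
      · simp [coeff_one, hj.ne']
    · simp [hi.ne']
  | insert u F hu ih =>
    rw [Finset.prod_insert hu, coeff_mul, map_sum, linComb_insert a hu, linComb_insert b hu]
    simp_rw [coeff_mul, add_pow_div_factorial, Finset.sum_mul_sum]
    -- The new variable is independent of the pair of partial sums; after both binomial expansions
    -- each mixed moment splits into its own moment times one covered by the induction hypothesis.
    have hind := hε.indepFun_linComb a b hu
    have hint : ∀ x y : ℕ × ℕ, x.1 + x.2 = i → y.1 + y.2 = j →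
        Integrable (fun ω => (a u * ε u ω) ^ x.1 / x.1.factorial *
          (linComb ε a F ω ^ x.2 / x.2.factorial) * ((b u * ε u ω) ^ y.1 / y.1.factorial *
          (linComb ε b F ω ^ y.2 / y.2.factorial))) μ ∧
        ∫ ω, (a u * ε u ω) ^ x.1 / x.1.factorial *
          (linComb ε a F ω ^ x.2 / x.2.factorial) * ((b u * ε u ω) ^ y.1 / y.1.factorial *
          (linComb ε b F ω ^ y.2 / y.2.factorial)) ∂μ =
        coeff y.1 (coeff x.1 (jointSeries (fun l => ∫ ω, ε 0 ω ^ l ∂μ) (a u) (b u))) *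
        coeff y.2 (coeff x.2
          (∏ u ∈ F, jointSeries (fun l => ∫ ω, ε 0 ω ^ l ∂μ) (a u) (b u))) := by
      intro x y hx hy
      set K : ℝ := a u ^ x.1 * b u ^ y.1 / (x.1.factorial * y.1.factorial) with hK
      have hi1 : Integrable (fun ω => ε u ω ^ (x.1 + y.1)) μ := by
        have := MemLp.integrable_pow_mul_pow (hL u) (hL u) (i := x.1) (j := y.1) (by omega)
        refine this.congr (Eventually.of_forall fun ω => ?_)
        simp [pow_add]
      have hi2 : Integrable (fun ω => linComb ε a F ω ^ x.2 / x.2.factorial *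
          (linComb ε b F ω ^ y.2 / y.2.factorial)) μ := by
        have := (MemLp.integrable_pow_mul_pow (memLp_linComb hL a F) (memLp_linComb hL b F)
          (i := x.2) (j := y.2) (by omega)).div_const ((x.2.factorial : ℝ) * y.2.factorial)
        refine this.congr (Eventually.of_forall fun ω => ?_)
        simp only [Pi.mul_apply, Pi.pow_apply]
        rw [div_mul_div_comm]
      have hI : IndepFun (fun ω => ε u ω ^ (x.1 + y.1))
          (fun ω => linComb ε a F ω ^ x.2 / x.2.factorial *
            (linComb ε b F ω ^ y.2 / y.2.factorial)) μ := by
        have h1 : Measurable fun t : ℝ => t ^ (x.1 + y.1) := by fun_prop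
        have h2 : Measurable fun t : ℝ × ℝ => t.1 ^ x.2 / (x.2.factorial : ℝ) *
          (t.2 ^ y.2 / (y.2.factorial : ℝ)) := by fun_prop
        exact hind.comp h1 h2
      have e : (fun ω => (a u * ε u ω) ^ x.1 / x.1.factorial *
          (linComb ε a F ω ^ x.2 / x.2.factorial) * ((b u * ε u ω) ^ y.1 / y.1.factorial *
          (linComb ε b F ω ^ y.2 / y.2.factorial))) = fun ω => K * (ε u ω ^ (x.1 + y.1) *
          (linComb ε a F ω ^ x.2 / x.2.factorial * (linComb ε b F ω ^ y.2 / y.2.factorial))) := by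
        ext ω
        rw [hK, mul_pow, mul_pow, pow_add]
        field_simp
      rw [e]
      refine ⟨(hI.integrable_mul hi1 hi2).const_mul K, ?_⟩
      rw [integral_const_mul, hI.integral_fun_mul_eq_mul_integral hi1.1 hi2.1, ← mul_assoc,
        ih (by omega)]
      congr 1
      simp only [jointSeries, coeff_mk]
      rw [hε.integral_pow_eq, hK]
      ring
    rw [integral_finsetSum]
    · refine Finset.sum_congr rfl fun x hx => ?_
      rw [Finset.HasAntidiagonal.mem_antidiagonal] at hx
      rw [integral_finsetSum]
      · refine Finset.sum_congr rfl fun y hy => ?_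
        rw [Finset.HasAntidiagonal.mem_antidiagonal] at hy
        exact (hint x y hx hy).2
      · intro y hy
        rw [Finset.HasAntidiagonal.mem_antidiagonal] at hy
        exact (hint x y hx hy).1
    · intro x hx
      rw [Finset.HasAntidiagonal.mem_antidiagonal] at hx
      refine integrable_finsetSum _ fun y hy => ?_
      rw [Finset.HasAntidiagonal.mem_antidiagonal] at hy
      exact (hint x y hx hy).1

open PowerSeries in
theorem IsStandardIID.integral_linComb_pow (hε : IsStandardIID ε μ) {n : ℕ}
    (hL : ∀ u, MemLp (ε u) n μ) (a : ℤ × ℤ → ℝ) (F : Finset (ℤ × ℤ)) {i : ℕ} (hi : i ≤ n) :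
    ∫ ω, linComb ε a F ω ^ i / i.factorial ∂μ
      = coeff i (∏ u ∈ F, momentSeries (fun l => ∫ ω, ε 0 ω ^ l ∂μ) (a u)) := by
  have h := hε.integral_linComb_pow_mul_pow hL a a F (i := i) (j := 0) (by omega)
  simp only [pow_zero, Nat.factorial_zero, Nat.cast_one, div_one, mul_one] at h
  rw [h]
  rw [← Finset.prod_congr rfl fun u _ => coeff_coeff_zero_jointSeries _ (a u) (a u), ← map_prod,
    coeff_map, coeff_zero_eq_constantCoeff_apply]

theorem IsStandardIID.integral_one (hε : IsStandardIID ε μ) : ∫ ω, ε 0 ω ^ 1 ∂μ = 0 := by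
  simpa using hε.mean_zero 0

/-- Moment inequality of even order for linear combinations of an i.i.d. centred family. -/
theorem IsStandardIID.exists_eLpNorm_linComb_le (hε : IsStandardIID ε μ) {k : ℕ} (hk : 1 ≤ k)
    (hL : ∀ u, MemLp (ε u) (2 * k : ℕ) μ) :
    ∃ C : ℝ, 0 ≤ C ∧ ∀ (c : ℤ × ℤ → ℝ) (F : Finset (ℤ × ℤ)),
      eLpNorm (linComb ε c F) (2 * k : ℕ) μ ≤ ENNReal.ofReal (C * √(∑ u ∈ F, c u ^ 2)) := by
  obtain ⟨C, hC, H⟩ := exists_abs_coeff_prod_momentSeries_le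
    (m := fun l => ∫ ω, ε 0 ω ^ l ∂μ) (by simp) hε.integral_one (2 * k)
  have hk0 : (2 * k : ℕ) ≠ 0 := by omega
  have hk0' : ((2 * k : ℕ) : ℝ) ≠ 0 := by exact_mod_cast hk0
  set L := C * (2 * k).factorial
  refine ⟨L ^ ((2 * k : ℕ) : ℝ)⁻¹, by positivity, fun c F => ?_⟩
  rw [(memLp_linComb hL c F).eLpNorm_eq_integral_rpow_norm (by exact_mod_cast hk0)
    (ENNReal.natCast_ne_top _)]
  refine ENNReal.ofReal_le_ofReal ?_
  have h1 := H F c (2 * k) le_rfl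
  rw [← hε.integral_linComb_pow hL c F le_rfl, integral_div, abs_div, Nat.abs_cast,
    div_le_iff₀ (by positivity)] at h1
  -- The order is even, so the absolute moment is an ordinary moment and the coefficient bound
  -- applies.
  have h2 : ∫ ω, ‖linComb ε c F ω‖ ^ ((2 * k : ℕ) : ENNReal).toReal ∂μ
      ≤ L * √(∑ u ∈ F, c u ^ 2) ^ (2 * k) := by
    calc _ = ∫ ω, linComb ε c F ω ^ (2 * k) ∂μ := by
          congr 1; ext ω
          rw [ENNReal.toReal_natCast, Real.rpow_natCast, Real.norm_eq_abs, pow_mul, pow_mul, sq_abs]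
      _ ≤ _ := (le_abs_self _).trans h1
      _ = _ := by ring
  calc _ ≤ (L * √(∑ u ∈ F, c u ^ 2) ^ (2 * k)) ^ ((2 * k : ℕ) : ENNReal).toReal⁻¹ := by
        gcongr
    _ = _ := by
        rw [ENNReal.toReal_natCast, Real.mul_rpow (by positivity) (by positivity),
          Real.pow_rpow_inv_natCast (by positivity) hk0]

/-- An `L²`-convergent linear series in an i.i.d. family converges in `L^{2k}`. -/
theorem IsStandardIID.tendsto_linComb (hε : IsStandardIID ε μ) {k : ℕ} (hk : 1 ≤ k)
    (hL : ∀ u, MemLp (ε u) (2 * k : ℕ) μ) {c : ℤ × ℤ → ℝ} (hc : Summable fun u => c u ^ 2)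
    {Y : Ω → ℝ} (hY : MemLp Y 2 μ)
    (hlim : Tendsto (fun F => eLpNorm (fun ω => Y ω - linComb ε c F ω) 2 μ) atTop (𝓝 0)) :
    MemLp Y (2 * k : ℕ) μ ∧
      Tendsto (fun F => eLpNorm (linComb ε c F - Y) (2 * k : ℕ) μ) atTop (𝓝 0) := by
  classical
  obtain ⟨C, hC, H⟩ := hε.exists_eLpNorm_linComb_le hk hL
  have hm : ∀ F, AEStronglyMeasurable (linComb ε c F) μ := fun F => (memLp_linComb hL c F).1
  have hmeas : TendstoInMeasure μ (linComb ε c) atTop Y := by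
    refine tendstoInMeasure_of_tendsto_eLpNorm (p := 2) (by simp) hm hY.1 ?_
    refine hlim.congr fun F => ?_
    rw [eLpNorm_sub_comm]; rfl
  -- The L^{2k} bound for differences of partial sums passes to the limit by lower semicontinuity of
  -- the norm under convergence in measure, which L² convergence provides.
  have hbound : ∀ F, eLpNorm (linComb ε c F - Y) (2 * k : ℕ) μ
      ≤ ENNReal.ofReal (C * √(∑' u, c u ^ 2 - ∑ u ∈ F, c u ^ 2)) := by
    intro F
    rw [eLpNorm_sub_comm]
    refine eLpNorm_le_of_tendstoInMeasure (u := atTop)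
      (f := fun F' => linComb ε c F' - linComb ε c F) ?_ ?_ (fun F' => (hm F').sub (hm F))
    · filter_upwards [eventually_ge_atTop F] with F' hF'
      have e : linComb ε c F' - linComb ε c F = linComb ε c (F' \ F) := by
        ext ω
        simp only [Pi.sub_apply, linComb]
        rw [← Finset.sum_sdiff hF', add_sub_cancel_right]
      rw [e]
      refine (H c _).trans (ENNReal.ofReal_le_ofReal ?_)
      gcongr
      have h1 := Finset.sum_sdiff (f := fun u => c u ^ 2) hF'
      have h2 := hc.sum_le_tsum F' fun u _ => sq_nonneg (c u)
      linarith
    · intro η hη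
      refine (hmeas η hη).congr fun F' => ?_
      simp
  have hto : Tendsto (fun F => ENNReal.ofReal (C * √(∑' u, c u ^ 2 - ∑ u ∈ F, c u ^ 2)))
      atTop (𝓝 0) := by
    have h1 : Tendsto (fun F => ∑' u, c u ^ 2 - ∑ u ∈ F, c u ^ 2) atTop (𝓝 0) := by
      have := Tendsto.const_sub (∑' u, c u ^ 2) hc.hasSum
      rwa [sub_self] at this
    have h2 := (h1.sqrt.const_mul C)
    simpa using ENNReal.tendsto_ofReal h2
  refine ⟨?_, tendsto_of_tendsto_of_tendsto_of_le_of_le tendsto_const_nhds hto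
    (fun _ => zero_le) hbound⟩
  -- The bound at the empty set, where the partial sum is 0, shows that `Y` itself lies in L^{2k}.
  have h0 : MemLp (linComb ε c ∅ - Y) (2 * k : ℕ) μ :=
    ⟨(hm ∅).sub hY.1, (hbound ∅).trans_lt ENNReal.ofReal_lt_top⟩
  simpa using (memLp_linComb hL c ∅).sub h0

end Probability

/-! ### Mean and covariance of Appell polynomials -/

section Covariance

set_option linter.unusedSectionVars false

open PowerSeries

theorem coeff_coeff_mul_map_C_mul_C (J : ℝ⟦X⟧⟦X⟧) (U V : ℝ⟦X⟧) (k l : ℕ) :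
    coeff l (coeff k (J * PowerSeries.map C U * C V)) =
      ∑ x ∈ Finset.HasAntidiagonal.antidiagonal k, ∑ y ∈ Finset.HasAntidiagonal.antidiagonal l,
        coeff y.1 (coeff x.1 J) * coeff x.2 U * coeff y.2 V := by
  rw [coeff_mul_C, coeff_mul, coeff_mul, Finset.sum_comm]
  refine Finset.sum_congr rfl fun y _ => ?_
  rw [map_sum, Finset.sum_mul]
  refine Finset.sum_congr rfl fun x _ => ?_
  rw [coeff_map, coeff_mul_C]

variable {Ω : Type*} [MeasurableSpace Ω] {μ : Measure Ω} [IsProbabilityMeasure μ]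

theorem momentSeries_map {X : Ω → ℝ} (hX : AEMeasurable X μ) :
    momentSeries (fun n => ∫ t, t ^ n ∂(μ.map X)) 1 = momentSeries (fun n => ∫ ω, X ω ^ n ∂μ) 1 := by
  ext n
  simp only [momentSeries, coeff_mk]
  rw [integral_map hX (by fun_prop)]

theorem appell_map_eq_sum {k : ℕ} {X : Ω → ℝ} (hX : MemLp X (2 * k : ℕ) μ) (x : ℝ) :
    appell k (μ.map X) x = k.factorial * ∑ y ∈ Finset.HasAntidiagonal.antidiagonal k,
      x ^ y.1 / y.1.factorial * coeff y.2 (momentSeries (fun n => ∫ ω, X ω ^ n ∂μ) 1)⁻¹ := by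
  have hm : AEMeasurable X μ := hX.1.aemeasurable
  have : IsProbabilityMeasure (μ.map X) := Measure.isProbabilityMeasure_map hm
  rw [appell_eq_sum, momentSeries_map hm]
  rw [memLp_map_measure_iff (by fun_prop) hm]
  exact hX.mono_exponent (by exact_mod_cast (by omega : k ≤ 2 * k))

theorem two_le_powExp {k i : ℕ} (hk : 1 ≤ k) (h : i ≤ k) : 2 ≤ powExp (2 * k) i := by
  have hk0 : (k : ENNReal) ≠ 0 := by exact_mod_cast (by omega : k ≠ 0)
  have h1 : ((i : ENNReal) / (2 * k : ℕ)) ≤ 2⁻¹ := by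
    refine ENNReal.div_le_of_le_mul ?_
    push_cast
    rw [← mul_assoc, ENNReal.inv_mul_cancel (by simp) (by simp), one_mul]
    exact_mod_cast h
  rw [powExp]
  simpa using ENNReal.inv_le_inv.2 h1

theorem memLp_two_appell {k : ℕ} (hk : 1 ≤ k) {X : Ω → ℝ} (hX : MemLp X (2 * k : ℕ) μ) :
    MemLp (fun ω => appell k (μ.map X) (X ω)) 2 μ := by
  simp_rw [appell_map_eq_sum hX]
  set U := (momentSeries (fun n => ∫ ω, X ω ^ n ∂μ) 1)⁻¹
  suffices hs : MemLp (fun ω => ∑ y ∈ Finset.HasAntidiagonal.antidiagonal k,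
      X ω ^ y.1 / (y.1.factorial : ℝ) * coeff y.2 U) 2 μ from hs.const_mul _
  refine memLp_finsetSum _ fun y hy => ?_
  rw [Finset.HasAntidiagonal.mem_antidiagonal] at hy
  have h : MemLp (X ^ y.1) 2 μ :=
    MemLp.mono_exponent (MemLp.pow_powExp hX y.1) (two_le_powExp hk (show y.1 ≤ k by omega))
  refine (h.mul_const ((y.1.factorial : ℝ)⁻¹ * coeff y.2 U)).ae_eq (Eventually.of_forall fun ω => ?_)
  simp only [Pi.pow_apply]
  ring

/-- The mean is k! times the k-th coefficient of M · M⁻¹ = 1, which vanishes for k ≥ 1. -/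
theorem integral_appell {k : ℕ} (hk : 1 ≤ k) {X : Ω → ℝ} (hX : MemLp X (2 * k : ℕ) μ) :
    ∫ ω, appell k (μ.map X) (X ω) ∂μ = 0 := by
  simp_rw [appell_map_eq_sum hX]
  have hint : ∀ i ≤ k, Integrable (fun ω => X ω ^ i / (i.factorial : ℝ)) μ := fun i hi =>
    (((MemLp.pow_powExp hX i).mono_exponent (two_le_powExp hk hi)).integrable
      (by norm_num)).div_const _
  rw [integral_const_mul, integral_finsetSum]
  · set M := momentSeries (fun n => ∫ ω, X ω ^ n ∂μ) 1
    have hM : constantCoeff M = 1 := constantCoeff_momentSeries (by simp) 1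
    have h := congrArg (coeff k) (PowerSeries.mul_inv_cancel M (by simp [hM]))
    rw [coeff_mul, coeff_one, if_neg (by omega)] at h
    rw [mul_eq_zero]
    right
    rw [← h]
    refine Finset.sum_congr rfl fun y hy => ?_
    rw [integral_mul_const, integral_div]
    simp [M, momentSeries]
  · intro y hy
    rw [Finset.HasAntidiagonal.mem_antidiagonal] at hy
    exact (hint _ (by omega)).mul_const _

theorem integrable_pow_div_mul {k : ℕ} {X Y : Ω → ℝ} (hX : MemLp X (2 * k : ℕ) μ)
    (hY : MemLp Y (2 * k : ℕ) μ) {i j : ℕ} (hi : i ≤ k) (hj : j ≤ k) :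
    Integrable (fun ω => X ω ^ i / i.factorial * (Y ω ^ j / j.factorial)) μ := by
  refine ((MemLp.integrable_pow_mul_pow hX hY (i := i) (j := j) (by omega)).div_const
    ((i.factorial : ℝ) * j.factorial)).congr (Eventually.of_forall fun ω => ?_)
  simp only [Pi.mul_apply, Pi.pow_apply]
  rw [div_mul_div_comm]

/-- The double convolution is the shape produced by `coeff_coeff_mul_map_C_mul_C`, so the covariance
is a coefficient of joint series over marginals. -/
theorem integral_appell_mul_appell {k : ℕ} {X Y : Ω → ℝ} (hX : MemLp X (2 * k : ℕ) μ)
    (hY : MemLp Y (2 * k : ℕ) μ) :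
    ∫ ω, appell k (μ.map X) (X ω) * appell k (μ.map Y) (Y ω) ∂μ = (k.factorial : ℝ) ^ 2 *
      ∑ x ∈ Finset.HasAntidiagonal.antidiagonal k, ∑ y ∈ Finset.HasAntidiagonal.antidiagonal k,
        (∫ ω, X ω ^ x.1 / x.1.factorial * (Y ω ^ y.1 / y.1.factorial) ∂μ) *
          coeff x.2 (momentSeries (fun n => ∫ ω, X ω ^ n ∂μ) 1)⁻¹ *
          coeff y.2 (momentSeries (fun n => ∫ ω, Y ω ^ n ∂μ) 1)⁻¹ := by
  simp_rw [appell_map_eq_sum hX, appell_map_eq_sum hY]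
  set U := (momentSeries (fun n => ∫ ω, X ω ^ n ∂μ) 1)⁻¹
  set V := (momentSeries (fun n => ∫ ω, Y ω ^ n ∂μ) 1)⁻¹
  have e : ∀ ω, (k.factorial * ∑ x ∈ Finset.HasAntidiagonal.antidiagonal k,
        X ω ^ x.1 / x.1.factorial * coeff x.2 U) * (k.factorial *
        ∑ y ∈ Finset.HasAntidiagonal.antidiagonal k, Y ω ^ y.1 / y.1.factorial * coeff y.2 V)
      = (k.factorial : ℝ) ^ 2 * ∑ x ∈ Finset.HasAntidiagonal.antidiagonal k,
        ∑ y ∈ Finset.HasAntidiagonal.antidiagonal k,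
        (X ω ^ x.1 / x.1.factorial * (Y ω ^ y.1 / y.1.factorial)) * coeff x.2 U * coeff y.2 V := by
    intro ω
    rw [mul_mul_mul_comm, Finset.sum_mul_sum, sq]
    congr 1
    refine Finset.sum_congr rfl fun x _ => Finset.sum_congr rfl fun y _ => ?_
    ring
  simp_rw [e]
  have hint : ∀ x ∈ Finset.HasAntidiagonal.antidiagonal k,
      ∀ y ∈ Finset.HasAntidiagonal.antidiagonal k,
      Integrable (fun ω => (X ω ^ x.1 / x.1.factorial * (Y ω ^ y.1 / y.1.factorial)) * coeff x.2 U *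
        coeff y.2 V) μ := by
    intro x hx y hy
    rw [Finset.HasAntidiagonal.mem_antidiagonal] at hx hy
    exact ((integrable_pow_div_mul hX hY (by omega) (by omega)).mul_const _).mul_const _
  rw [integral_const_mul, integral_finsetSum _ fun x hx => integrable_finsetSum _ (hint x hx)]
  congr 1
  refine Finset.sum_congr rfl fun x hx => ?_
  rw [integral_finsetSum _ (hint x hx)]
  refine Finset.sum_congr rfl fun y _ => ?_
  rw [integral_mul_const, integral_mul_const]

variable {ε : ℤ × ℤ → Ω → ℝ}

/-- The covariance of Appell polynomials of two linear fields is the limit of coefficients of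
finite products of `covSeries`. -/
theorem IsStandardIID.tendsto_coeff_prod_covSeries (hε : IsStandardIID ε μ) {k : ℕ}
    (hL : ∀ u, MemLp (ε u) (2 * k : ℕ) μ) {a b : ℤ × ℤ → ℝ} {X Y : Ω → ℝ}
    (hX : MemLp X (2 * k : ℕ) μ) (hY : MemLp Y (2 * k : ℕ) μ)
    (hXlim : Tendsto (fun F => eLpNorm (linComb ε a F - X) (2 * k : ℕ) μ) atTop (𝓝 0))
    (hYlim : Tendsto (fun F => eLpNorm (linComb ε b F - Y) (2 * k : ℕ) μ) atTop (𝓝 0)) :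
    Tendsto (fun F => (k.factorial : ℝ) ^ 2 * coeff k (coeff k
        (∏ u ∈ F, covSeries (fun l => ∫ ω, ε 0 ω ^ l ∂μ) (a u) (b u)))) atTop
      (𝓝 (∫ ω, appell k (μ.map X) (X ω) * appell k (μ.map Y) (Y ω) ∂μ)) := by
  set m : ℕ → ℝ := fun l => ∫ ω, ε 0 ω ^ l ∂μ with hm
  have hm0 : m 0 = 1 := by simp [hm]
  rw [integral_appell_mul_appell hX hY]
  refine Tendsto.const_mul _ ?_
  simp_rw [prod_covSeries hm0, coeff_coeff_mul_map_C_mul_C]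
  -- The inverse marginal coefficients converge because the moments of the truncations do.
  have hone : ∀ {c : ℤ × ℤ → ℝ} {W : Ω → ℝ}, MemLp W (2 * k : ℕ) μ →
      Tendsto (fun F => eLpNorm (linComb ε c F - W) (2 * k : ℕ) μ) atTop (𝓝 0) → ∀ n ≤ k,
      Tendsto (fun F => coeff n (∏ u ∈ F, momentSeries m (c u))⁻¹) atTop
        (𝓝 (coeff n (momentSeries (fun n => ∫ ω, W ω ^ n ∂μ) 1)⁻¹)) := by
    intro c W hW hlim
    refine tendsto_coeff_inv (fun F => ?_) (constantCoeff_momentSeries (by simp) 1) fun n hn => ?_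
    · rw [map_prod]; exact Finset.prod_eq_one fun u _ => constantCoeff_momentSeries hm0 _
    · simp_rw [hm, ← hε.integral_linComb_pow hL c _ (show n ≤ 2 * k by omega), integral_div]
      have h := tendsto_integral_pow_mul_pow (i := n) (j := 0) (memLp_linComb hL c) hW hlim
        (memLp_linComb hL c) hW hlim (by omega)
      simpa [momentSeries] using h.div_const (n.factorial : ℝ)
  refine tendsto_finsetSum _ fun x hx => tendsto_finsetSum _ fun y hy => ?_
  rw [Finset.HasAntidiagonal.mem_antidiagonal] at hx hy
  refine Tendsto.mul (Tendsto.mul ?_ (hone hX hXlim _ (by omega))) (hone hY hYlim _ (by omega))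
  simp_rw [hm, ← hε.integral_linComb_pow_mul_pow hL a b _ (show x.1 + y.1 ≤ 2 * k by omega),
    div_mul_div_comm, integral_div]
  exact (tendsto_integral_pow_mul_pow (memLp_linComb hL a) hX hXlim
    (memLp_linComb hL b) hY hYlim (by omega)).div_const _

end Covariance

/-! ### Uniform estimate for truncated covariances -/

section UniformBound

open PowerSeries

variable {δ q : ℝ}

/-- The substitution v = -u brings the moving-average pairs into the form v, v + x used by the
correlation bounds. -/
theorem sum_aniWt_reflect (f : ℤ × ℤ → ℤ × ℤ → ℝ) (x : ℤ × ℤ) (F : Finset (ℤ × ℤ)) :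
    ∑ u ∈ F, f (-u) (x - u) = ∑ v ∈ F.map (Equiv.neg (ℤ × ℤ)).toEmbedding, f v (v + x) := by
  rw [Finset.sum_map]
  refine Finset.sum_congr rfl fun u _ => ?_
  simp [sub_eq_neg_add]

/-- Uniform estimate of the coefficients of finite products of `covSeries` for coefficients
dominated by the anisotropic weight. -/
theorem exists_coeff_prod_covSeries_bound (hδ : 0 < δ) (hq : 0 < q) (h1 : q < 1 + 1 / δ)
    (h2 : 1 + 1 / δ < 2 * q) {m : ℕ → ℝ} (hm0 : m 0 = 1) (hm1 : m 1 = 0) (hm2 : m 2 = 1)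
    {k : ℕ} (hk : 1 ≤ k) {a : ℤ × ℤ → ℝ} {A : ℝ} (ha : ∀ v, |a v| ≤ A * aniWt δ q v) :
    ∃ C ≥ 1, ∀ x, ∀ F : Finset (ℤ × ℤ),
      |∑ u ∈ F, a (-u) * a (x - u)| ≤ C * aniNorm δ x ^ (-(2 * q - (1 + 1 / δ))) ∧
      |coeff k (coeff k (∏ u ∈ F, covSeries m (a (-u)) (a (x - u)))) -
          (∑ u ∈ F, a (-u) * a (x - u)) ^ k / k.factorial| ≤
        C * (aniNorm δ x ^ (-q) * (aniNorm δ x ^ (-(2 * q - (1 + 1 / δ)))) ^ (k - 1) +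
          (aniNorm δ x ^ (-q)) ^ 2) := by
  set D := 1 + 1 / δ with hD
  obtain ⟨C₁, hC₁, -, H11⟩ := exists_aniWt_correlation_le hδ hq h1 h2
  obtain ⟨C₂, hC₂, Hij, Hii⟩ := exists_aniWt_higher_correlation_le hδ hq h1 h2
  obtain ⟨κ, hκ0, hκ0', hκ11, hrec⟩ := exists_cumulants hm0 hm1 hm2
  set A' := max A 1 with hA'
  have hA1 : 1 ≤ A' := le_max_right _ _
  have ha' : ∀ v, |a v| ≤ A' * aniWt δ q v := fun v =>
    (ha v).trans (mul_le_mul_of_nonneg_right (le_max_left _ _) (aniWt_pos δ q v).le)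
  set K : ℝ := 1 + ∑ i ∈ Finset.range (k + 1), ∑ j ∈ Finset.range (k + 1), |κ i j| with hK
  have hKκ : ∀ i j, i ≤ k → j ≤ k → |κ i j| ≤ K := by
    intro i j hi hj
    have s1 : |κ i j| ≤ ∑ j ∈ Finset.range (k + 1), |κ i j| :=
      Finset.single_le_sum (f := fun j => |κ i j|) (fun _ _ => abs_nonneg _)
        (Finset.mem_range.2 (by omega))
    have s2 : ∑ j ∈ Finset.range (k + 1), |κ i j|
        ≤ ∑ i ∈ Finset.range (k + 1), ∑ j ∈ Finset.range (k + 1), |κ i j| :=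
      Finset.single_le_sum (f := fun i => ∑ j ∈ Finset.range (k + 1), |κ i j|)
        (fun _ _ => Finset.sum_nonneg fun _ _ => abs_nonneg _) (Finset.mem_range.2 (by omega))
    linarith
  have hK1 : 1 ≤ K := le_add_of_nonneg_right
    (Finset.sum_nonneg fun _ _ => Finset.sum_nonneg fun _ _ => abs_nonneg _)
  -- `K` bounds the cumulants with indices at most k, A'^(2k) the domination constant raised to i +
  -- j, and C₁ C₂^k all the correlation constants at once.
  set B : ℝ := K * (A' ^ (2 * k) * (C₁ * C₂ ^ k)) with hB
  have hApow : 1 ≤ A' ^ (2 * k) := one_le_pow₀ hA1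
  have hC₂pow : 1 ≤ C₂ ^ k := one_le_pow₀ hC₂
  have hCC : 1 ≤ C₁ * C₂ ^ k := one_le_mul_of_one_le_of_one_le hC₁ hC₂pow
  have hB1 : 1 ≤ B := one_le_mul_of_one_le_of_one_le hK1 (one_le_mul_of_one_le_of_one_le hApow hCC)
  obtain ⟨C, hC, Hdiag⟩ := exists_diagonal_bound B hB1 k
  refine ⟨max C B, hC.trans (le_max_left _ _), fun x F => ?_⟩
  set X := aniNorm δ x ^ (-(2 * q - D)) with hX
  set Z := aniNorm δ x ^ (-q) with hZ
  have hN := one_le_aniNorm δ x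
  have hZ0 : 0 < Z := Real.rpow_pos_of_pos (aniNorm_pos δ x) _
  -- This is q < D in the form 2q - D < q.
  have hZX : Z ≤ X := Real.rpow_le_rpow_of_exponent_le hN (by linarith)
  have hX0 : 0 < X := hZ0.trans_le hZX
  have hX1 : X ≤ 1 := Real.rpow_le_one_of_one_le_of_nonpos hN (by linarith)
  have hS : ∀ i j, i ≤ k → j ≤ k → ∀ b : ℝ,
      (∀ G : Finset (ℤ × ℤ), ∑ v ∈ G, aniWt δ q v ^ i * aniWt δ q (v + x) ^ j ≤ b) →
      |∑ u ∈ F, a (-u) ^ i * a (x - u) ^ j| ≤ A' ^ (2 * k) * b := by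
    intro i j hi hj b hb
    have hb0 : 0 ≤ b := by simpa using hb ∅
    rw [sum_aniWt_reflect (fun v w => a v ^ i * a w ^ j)]
    set G := F.map (Equiv.neg (ℤ × ℤ)).toEmbedding
    calc _ ≤ ∑ v ∈ G, |a v ^ i * a (v + x) ^ j| := Finset.abs_sum_le_sum_abs _ _
      _ ≤ ∑ v ∈ G, A' ^ (i + j) * (aniWt δ q v ^ i * aniWt δ q (v + x) ^ j) := by
          refine Finset.sum_le_sum fun v _ => ?_
          have p1 := aniWt_pos δ q v
          rw [abs_mul, abs_pow, abs_pow]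
          calc _ ≤ (A' * aniWt δ q v) ^ i * (A' * aniWt δ q (v + x)) ^ j := by
                gcongr
                exacts [ha' v, ha' (v + x)]
            _ = _ := by rw [mul_pow, mul_pow, pow_add]; ring
      _ ≤ A' ^ (i + j) * b := by rw [← Finset.mul_sum]; gcongr; exact hb G
      _ ≤ _ := by gcongr; omega
  set H : ℕ → ℕ → ℝ := fun i j => κ i j * ∑ u ∈ F, a (-u) ^ i * a (x - u) ^ j with hH
  have hHb : ∀ i j, i ≤ k → j ≤ k → ∀ b z : ℝ, 0 ≤ z → b ≤ C₁ * C₂ ^ k →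
      (∀ G : Finset (ℤ × ℤ), ∑ v ∈ G, aniWt δ q v ^ i * aniWt δ q (v + x) ^ j ≤ b * z) →
      |H i j| ≤ B * z := by
    intro i j hi hj b z hz hb hG
    rw [hH, abs_mul, hB]
    calc _ ≤ K * (A' ^ (2 * k) * (b * z)) :=
          mul_le_mul (hKκ i j hi hj) (hS i j hi hj _ hG) (abs_nonneg _) (by linarith)
      _ ≤ K * (A' ^ (2 * k) * ((C₁ * C₂ ^ k) * z)) := by gcongr
      _ = _ := by ring
  have hH11 : |H 1 1| ≤ B * X := by
    refine hHb 1 1 hk hk C₁ X hX0.le (le_mul_of_one_le_right (by linarith) hC₂pow) fun G => ?_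
    simp only [pow_one]
    exact H11 x G
  have hH11' : H 1 1 = ∑ u ∈ F, a (-u) * a (x - u) := by simp [hH, hκ11]
  constructor
  · rw [← hH11']
    exact hH11.trans (mul_le_mul_of_nonneg_right (le_max_right _ _) hX0.le)
  rw [← hH11']
  refine (Hdiag (fun i j => coeff j (coeff i (∏ u ∈ F, covSeries m (a (-u)) (a (x - u))))) H X Z
    hZ0 hZX hX1 (fun i j => hrec F (fun u => a (-u)) (fun u => a (x - u)) i j) ?_ ?_
    (fun j => by simp [hH, hκ0]) (fun i => by simp [hH, hκ0']) hH11 ?_ ?_).trans ?_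
  · simp [map_prod, constantCoeff_covSeries hm0]
  · intro l hl
    simp only [coeff_zero_eq_constantCoeff, map_prod, constantCoeff_covSeries hm0,
      Finset.prod_const_one, coeff_one]
    rw [if_neg (by omega)]
  · intro i j hi hik hj hjk hij
    refine hHb i j hik hjk C₂ Z hZ0.le ?_ fun G => Hij i j hi hj hij x G
    have : C₂ ≤ C₂ ^ k := le_self_pow₀ hC₂ (by omega)
    nlinarith
  · intro i hi hik
    refine hHb i i hik hik (C₂ ^ i) (Z ^ i) (by positivity) ?_ fun G => ?_
    · have : C₂ ^ i ≤ C₂ ^ k := pow_le_pow_right₀ hC₂ hik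
      nlinarith
    · rw [← mul_pow]; exact Hii i hi x G
  · exact mul_le_mul_of_nonneg_right (le_max_left _ _) (by positivity)

end UniformBound

/-! ### Comparison of ρ with the anisotropic size -/

section Rho

variable {q₁ q₂ : ℝ}

theorem rho_rpow_half (t : ℝ) : (|t| ^ (2 : ℝ)) ^ (1 / 2 : ℝ) = |t| := by
  rw [← Real.rpow_mul (abs_nonneg _)]; norm_num

theorem abs_le_rho (t s : ℝ) : |t| ≤ rho q₁ q₂ t s := by
  conv_lhs => rw [← rho_rpow_half t]
  exact Real.rpow_le_rpow (by positivity) (le_add_of_nonneg_right (by positivity)) (by norm_num)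

theorem abs_rpow_le_rho (t s : ℝ) : |s| ^ (q₂ / q₁) ≤ rho q₁ q₂ t s := by
  have : |s| ^ (q₂ / q₁) = (|s| ^ (2 * q₂ / q₁)) ^ (1 / 2 : ℝ) := by
    rw [← Real.rpow_mul (abs_nonneg _)]; congr 1; ring
  rw [this]
  exact Real.rpow_le_rpow (by positivity) (le_add_of_nonneg_left (by positivity)) (by norm_num)

theorem rho_nonneg (t s : ℝ) : 0 ≤ rho q₁ q₂ t s := (abs_nonneg t).trans (abs_le_rho t s)

theorem one_le_abs_intCast {n : ℤ} (h : n ≠ 0) : (1 : ℝ) ≤ |(n : ℝ)| := by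
  exact_mod_cast Int.one_le_abs h

theorem aniNorm_le_rho (h : 0 < q₂ / q₁) {v : ℤ × ℤ} (hv : v ≠ 0) :
    aniNorm (q₂ / q₁) v ≤ rho q₁ q₂ v.1 v.2 := by
  refine max_le ?_ (max_le (abs_le_rho _ _) (abs_rpow_le_rho _ _))
  by_cases h1 : v.1 = 0
  · have h2 : v.2 ≠ 0 := fun h2 => hv (Prod.ext h1 h2)
    exact (Real.one_le_rpow (one_le_abs_intCast h2) h.le).trans (abs_rpow_le_rho _ _)
  · exact (one_le_abs_intCast h1).trans (abs_le_rho _ _)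

theorem div_rho_mem_Icc (t s : ℝ) : t / rho q₁ q₂ t s ∈ Set.Icc (-1 : ℝ) 1 := by
  rw [Set.mem_Icc, ← abs_le, abs_div, abs_of_nonneg (rho_nonneg t s)]
  exact div_le_one_of_le₀ (abs_le_rho t s) (rho_nonneg t s)

theorem rho_rpow_le_aniWt (h : 0 < q₂ / q₁) (hq : 0 < q₁) {v : ℤ × ℤ} :
    rho q₁ q₂ v.1 v.2 ^ (-q₁) ≤ aniWt (q₂ / q₁) q₁ v := by
  by_cases hv : v = 0
  · subst hv
    have : rho q₁ q₂ ((0 : ℤ × ℤ).1 : ℝ) ((0 : ℤ × ℤ).2 : ℝ) = 0 := by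
      have h2 : 2 * q₂ / q₁ ≠ 0 := by rw [mul_div_assoc]; positivity
      simp [rho, Real.zero_rpow h2]
    -- At the origin the negative power of ρ = 0 takes the default value 0.
    rw [this, Real.zero_rpow (by linarith)]
    exact (aniWt_pos _ _ _).le
  · exact Real.rpow_le_rpow_of_nonpos (aniNorm_pos _ v) (aniNorm_le_rho h hv) (by linarith)

/-- `ρ(t,s) = t √(1 + y²)` where `y = |s|^(q₂/q₁) / t`. -/
theorem rho_eq_mul {t : ℝ} (ht : t ≠ 0) (s : ℝ) :
    rho q₁ q₂ t s = |t| * √(1 + (|s| ^ (q₂ / q₁) / |t|) ^ 2) := by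
  have e : |t| ^ (2 : ℝ) + |s| ^ (2 * q₂ / q₁) = |t| ^ 2 * (1 + (|s| ^ (q₂ / q₁) / |t|) ^ 2) := by
    have h2 : |s| ^ (2 * q₂ / q₁) = (|s| ^ (q₂ / q₁)) ^ 2 := by
      rw [← Real.rpow_natCast, ← Real.rpow_mul (abs_nonneg _)]; congr 1; push_cast; ring
    rw [h2, Real.rpow_two]
    have : |t| ≠ 0 := abs_ne_zero.2 ht
    field_simp
  rw [rho, e, ← Real.sqrt_eq_rpow, Real.sqrt_mul (by positivity), Real.sqrt_sq (abs_nonneg _)]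

end Rho

/-! ### Leading term, remainder and angular sector -/

section Decomposition

variable {q₁ q₂ : ℝ} {L₀ : ℝ → ℝ} {a : ℤ × ℤ → ℝ}

/-- The leading term `ρ(t,s)^(-q₁) L₀(t/ρ(t,s))` of the moving-average coefficients. -/
noncomputable def leadCoeff (q₁ q₂ : ℝ) (L₀ : ℝ → ℝ) (v : ℤ × ℤ) : ℝ :=
  rho q₁ q₂ v.1 v.2 ^ (-q₁) * L₀ ((v.1 : ℝ) / rho q₁ q₂ v.1 v.2)

theorem IsMACoeff.div_pos (ha : IsMACoeff q₁ q₂ L₀ a) : 0 < q₂ / q₁ :=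
  _root_.div_pos ha.pos₂ ha.pos₁

theorem IsMACoeff.leadCoeff_nonneg (ha : IsMACoeff q₁ q₂ L₀ a) (v : ℤ × ℤ) :
    0 ≤ leadCoeff q₁ q₂ L₀ v :=
  mul_nonneg (Real.rpow_nonneg (rho_nonneg _ _) _) (ha.angular.nonneg _ (div_rho_mem_Icc _ _))

theorem IsMACoeff.exists_leadCoeff_le (ha : IsMACoeff q₁ q₂ L₀ a) :
    ∃ C ≥ 0, ∀ v, leadCoeff q₁ q₂ L₀ v ≤ C * aniWt (q₂ / q₁) q₁ v := by
  obtain ⟨C, hC⟩ := ha.angular.bounded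
  refine ⟨max C 0, le_max_right _ _, fun v => ?_⟩
  rw [mul_comm]
  exact mul_le_mul (rho_rpow_le_aniWt ha.div_pos ha.pos₁)
    ((hC _ (div_rho_mem_Icc _ _)).trans (le_max_left _ _))
    (ha.angular.nonneg _ (div_rho_mem_Icc _ _)) (aniWt_pos _ _ _).le

/-- Far away the o(1) is below η; on the remaining finite set any positive function dominates the
remainder up to a constant. The square of the weight is chosen because its correlation with the
weight is of lower order. -/
theorem IsMACoeff.exists_remainder_le (ha : IsMACoeff q₁ q₂ L₀ a) {η : ℝ} (hη : 0 < η) :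
    ∃ C ≥ 0, ∀ v, |a v - leadCoeff q₁ q₂ L₀ v| ≤
      η * aniWt (q₂ / q₁) q₁ v + C * aniWt (q₂ / q₁) q₁ v ^ 2 := by
  obtain ⟨e, he, hae⟩ := ha.asymp
  have h1 : ∀ᶠ v in comap (fun x : ℤ × ℤ => |x.1| + |x.2|) atTop, |e v| < η := by
    have := he.abs
    rw [abs_zero] at this
    exact this.eventually_lt_const hη
  rw [eventually_comap] at h1
  obtain ⟨M, hM⟩ := eventually_atTop.1 h1
  set T : Finset (ℤ × ℤ) := Finset.Icc (-|M| - 1, -|M| - 1) (|M| + 1, |M| + 1) with hT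
  have hTmem : ∀ v : ℤ × ℤ, v ∉ T → M ≤ |v.1| + |v.2| ∧ v ≠ 0 := by
    intro v hv
    rw [hT, Finset.mem_Icc, Prod.le_def, Prod.le_def] at hv
    refine ⟨?_, ?_⟩
    · by_contra hlt
      apply hv
      simp only
      have := le_abs_self M
      have h1 := abs_le.1 (le_refl |v.1|)
      have h2 := abs_le.1 (le_refl |v.2|)
      have h3 := abs_nonneg v.1
      have h4 := abs_nonneg v.2
      refine ⟨⟨?_, ?_⟩, ⟨?_, ?_⟩⟩ <;> omega
    · rintro rfl
      apply hv
      have := abs_nonneg M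
      simp only [Prod.fst_zero, Prod.snd_zero]
      refine ⟨⟨?_, ?_⟩, ⟨?_, ?_⟩⟩ <;> omega
  set r : ℤ × ℤ → ℝ := fun v => |a v - leadCoeff q₁ q₂ L₀ v| with hr
  set C := ∑ v ∈ T, r v / aniWt (q₂ / q₁) q₁ v ^ 2 with hC
  have hterm : ∀ v, 0 ≤ r v / aniWt (q₂ / q₁) q₁ v ^ 2 := fun v =>
    div_nonneg (abs_nonneg _) (sq_nonneg _)
  have hC0 : 0 ≤ C := Finset.sum_nonneg fun v _ => hterm v
  refine ⟨C, hC0, fun v => ?_⟩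
  have hw := aniWt_pos (q₂ / q₁) q₁ v
  by_cases hv : v ∈ T
  · have h2 : r v / aniWt (q₂ / q₁) q₁ v ^ 2 ≤ C :=
      Finset.single_le_sum (f := fun v => r v / aniWt (q₂ / q₁) q₁ v ^ 2) (fun v _ => hterm v) hv
    rw [div_le_iff₀ (by positivity)] at h2
    have : 0 ≤ η * aniWt (q₂ / q₁) q₁ v := by positivity
    linarith
  · obtain ⟨hMv, hv0⟩ := hTmem v hv
    have h3 := hM _ hMv v rfl
    have h4 : a v - leadCoeff q₁ q₂ L₀ v = rho q₁ q₂ v.1 v.2 ^ (-q₁) * e v := by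
      rw [hae v hv0, leadCoeff]; ring
    have h5 : 0 ≤ rho q₁ q₂ v.1 v.2 ^ (-q₁) := Real.rpow_nonneg (rho_nonneg _ _) _
    have h6 : |a v - leadCoeff q₁ q₂ L₀ v| ≤ aniWt (q₂ / q₁) q₁ v * η := by
      rw [h4, abs_mul, abs_of_nonneg h5]
      exact mul_le_mul (rho_rpow_le_aniWt ha.div_pos ha.pos₁) h3.le (abs_nonneg _) hw.le
    have : 0 ≤ C * aniWt (q₂ / q₁) q₁ v ^ 2 := by positivity
    linarith

theorem IsMACoeff.exists_abs_le (ha : IsMACoeff q₁ q₂ L₀ a) :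
    ∃ C ≥ 1, ∀ v, |a v| ≤ C * aniWt (q₂ / q₁) q₁ v := by
  obtain ⟨C₁, hC₁, h1⟩ := ha.exists_leadCoeff_le
  obtain ⟨C₂, hC₂, h2⟩ := ha.exists_remainder_le one_pos
  refine ⟨C₁ + 1 + C₂, by linarith, fun v => ?_⟩
  have hw := aniWt_pos (q₂ / q₁) q₁ v
  have hw1 := aniWt_le_one (δ := q₂ / q₁) ha.pos₁.le v
  have h3 := abs_add_le (leadCoeff q₁ q₂ L₀ v) (a v - leadCoeff q₁ q₂ L₀ v)
  rw [add_sub_cancel, abs_of_nonneg (ha.leadCoeff_nonneg v)] at h3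
  have h4 : C₂ * aniWt (q₂ / q₁) q₁ v ^ 2 ≤ C₂ * aniWt (q₂ / q₁) q₁ v := by
    gcongr
    nlinarith
  linarith [h1 v, h2 v]

/-- If `L₀` is not a.e. zero, it is bounded below on a curvilinear sector. -/
theorem IsAngularFunction.exists_sector (hL : IsAngularFunction L₀)
    (h0 : ¬ (∀ᵐ z ∂(volume.restrict (Set.Icc (-1 : ℝ) 1)), L₀ z = 0)) (q₁ q₂ : ℝ) :
    ∃ σ : ℤ, (σ = 1 ∨ σ = -1) ∧ ∃ c₁ c₂ η : ℝ, 0 < c₁ ∧ c₁ < c₂ ∧ 0 < η ∧ ∀ t s : ℝ, 0 < t →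
      c₁ * t ≤ |s| ^ (q₂ / q₁) → |s| ^ (q₂ / q₁) ≤ c₂ * t →
        η ≤ L₀ (σ * t / rho q₁ q₂ (σ * t) s) := by
  obtain ⟨F, hF, hcont⟩ := hL.piecewise_continuous
  -- Excluding finitely many points is free almost everywhere. The conditions z ≠ 0 and |z| < 1 keep
  -- the sector away from both coordinate axes.
  have hz : ∃ z ∈ Set.Ioo (-1 : ℝ) 1, z ∉ F ∧ z ≠ 0 ∧ 0 < L₀ z := by
    by_contra hcon
    push Not at hcon
    apply h0
    have hfin : (F ∪ {0, 1, -1} : Set ℝ).Finite := hF.union (by simp)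
    have hae : ∀ᵐ z ∂(volume.restrict (Set.Icc (-1 : ℝ) 1)), z ∉ (F ∪ {0, 1, -1} : Set ℝ) :=
      measure_eq_zero_iff_ae_notMem.1 (hfin.measure_zero _)
    filter_upwards [hae, ae_restrict_mem measurableSet_Icc] with z hz1 hz2
    simp only [Set.mem_union, Set.mem_insert_iff, Set.mem_singleton_iff, not_or] at hz1
    obtain ⟨hzF, hz0, hz1', hzm⟩ := hz1
    have := hcon z ⟨lt_of_le_of_ne hz2.1 (Ne.symm hzm), lt_of_le_of_ne hz2.2 hz1'⟩ hzF hz0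
    exact le_antisymm this (hL.nonneg z hz2)
  obtain ⟨z, hz, hzF, hz0, hLz⟩ := hz
  have hzc : ContinuousAt L₀ z := by
    have hopen : IsOpen (Set.Ioo (-1 : ℝ) 1 \ F) := isOpen_Ioo.sdiff hF.isClosed
    refine (hcont.mono ?_).continuousAt (hopen.mem_nhds ⟨hz, hzF⟩)
    exact Set.sdiff_subset_sdiff_left Set.Ioo_subset_Icc_self
  obtain ⟨σ, hσ, hσz⟩ : ∃ σ : ℤ, (σ = 1 ∨ σ = -1) ∧ (σ : ℝ) * |z| = z := by
    rcases lt_or_gt_of_ne hz0 with h | h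
    · exact ⟨-1, Or.inr rfl, by rw [abs_of_neg h]; push_cast; ring⟩
    · exact ⟨1, Or.inl rfl, by rw [abs_of_pos h]; push_cast; ring⟩
  have hzabs : 0 < |z| := abs_pos.2 hz0
  have hz1 : |z| < 1 := abs_lt.2 hz
  -- On the curve |s|^(q₂/q₁) = y|t| with t of the sign of z, the angular variable t/ρ equals z; the
  -- sector is a neighbourhood of that curve.
  set y := √(1 / |z| ^ 2 - 1) with hy
  have hpos : 0 < 1 / |z| ^ 2 - 1 := by
    rw [sub_pos, lt_div_iff₀ (by positivity)]
    nlinarith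
  have hy0 : 0 < y := Real.sqrt_pos.2 hpos
  set g : ℝ → ℝ := fun y => σ / √(1 + y ^ 2) with hg
  have hgy : g y = z := by
    have : √(1 + y ^ 2) = 1 / |z| := by
      rw [hy, Real.sq_sqrt hpos.le, add_sub_cancel, ← one_div_pow, Real.sqrt_sq (by positivity)]
    rw [hg]
    simp only
    rw [this, div_div_eq_mul_div, div_one, hσz]
  have hgc : ContinuousAt g y := by
    refine ContinuousAt.div continuousAt_const (by fun_prop) ?_
    positivity
  have hc : ContinuousAt (fun y => L₀ (g y)) y :=
    ContinuousAt.comp (g := L₀) (by rw [hgy]; exact hzc) hgc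
  have hev : ∀ᶠ w in 𝓝 y, L₀ z / 2 < L₀ (g w) := by
    refine hc.eventually_const_lt ?_
    simp only [hgy]
    linarith
  obtain ⟨r, hr, hball⟩ := Metric.eventually_nhds_iff.1 hev
  set d := min (r / 2) (y / 2) with hd
  have hd0 : 0 < d := by positivity
  have hdr : d < r := (min_le_left _ _).trans_lt (by linarith)
  have hdy : d < y := (min_le_right _ _).trans_lt (by linarith)
  refine ⟨σ, hσ, y - d, y + d, L₀ z / 2, by linarith, by linarith, by linarith, ?_⟩
  intro t s ht hs1 hs2
  have hσabs : |(σ : ℝ)| = 1 := by rcases hσ with rfl | rfl <;> simp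
  have hσ0 : (σ : ℝ) ≠ 0 := by intro h; simp [h] at hσabs
  rw [rho_eq_mul (mul_ne_zero hσ0 ht.ne'), abs_mul, hσabs, one_mul, abs_of_pos ht]
  have e : (σ : ℝ) * t / (t * √(1 + (|s| ^ (q₂ / q₁) / t) ^ 2)) = g (|s| ^ (q₂ / q₁) / t) := by
    rw [hg]; field_simp
  rw [e]
  refine (hball ?_).le
  rw [Real.dist_eq, abs_lt]
  have h1 : y - d ≤ |s| ^ (q₂ / q₁) / t := by rwa [le_div_iff₀ ht]
  have h2 : |s| ^ (q₂ / q₁) / t ≤ y + d := by rwa [div_le_iff₀ ht]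
  constructor <;> linarith

end Decomposition

/-! ### Lower bound for the correlation of the coefficients -/

theorem le_card_int_Icc (α β : ℝ) :
    β - α - 1 ≤ ((Finset.Icc ⌈α⌉ ⌊β⌋).card : ℝ) := by
  have h1 : (⌊β⌋ + 1 - ⌈α⌉ : ℤ) ≤ ((Finset.Icc ⌈α⌉ ⌊β⌋).card : ℤ) := by
    rw [Int.card_Icc]; exact Int.self_le_toNat _
  have h2 : ((⌊β⌋ + 1 - ⌈α⌉ : ℤ) : ℝ) ≤ ((Finset.Icc ⌈α⌉ ⌊β⌋).card : ℝ) := by exact_mod_cast h1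
  have h3 := Int.lt_floor_add_one β
  have h4 := Int.ceil_lt_add_one α
  push_cast at h2
  linarith

/-- A curvilinear sector contains, at every large scale `n`, a set of about `n^(1+1/δ)` lattice
points which stays in the sector under all translations of size at most `n`. -/
theorem exists_stable_box {δ c₁ c₂ : ℝ} (hδ : 0 < δ) (hc₁ : 0 < c₁) (hc : c₁ < c₂) :
    ∃ C > 0, ∃ R₀ : ℝ, 1 ≤ R₀ ∧ ∀ n : ℝ, R₀ ≤ n → ∃ G : Finset (ℤ × ℤ),
      n ^ (1 + 1 / δ) / 4 ≤ (G.card : ℝ) ∧ ∀ v ∈ G, ∀ x₁ x₂ : ℝ, |x₁| ≤ n → |x₂| ≤ n ^ (1 / δ) →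
        0 < v.1 + x₁ ∧ v.1 + x₁ ≤ C * n ∧ c₁ * (v.1 + x₁) ≤ |v.2 + x₂| ^ δ ∧
          |v.2 + x₂| ^ δ ≤ c₂ * (v.1 + x₁) := by
  set γ := 1 / δ with hγ
  have hγ0 : 0 < γ := by positivity
  -- The box has t in [Bn, Bn+n], so shifted points have first coordinate between (B-1)n and (B+2)n.
  -- The second coordinate needs room 3n^γ: a margin n^γ on each side for the shift and n^γ for the
  -- box. An intermediate slope c shows that a large B provides it.
  obtain ⟨B, hB2, hBgap⟩ : ∃ B : ℝ, 2 ≤ B ∧ (c₁ * (B + 2)) ^ γ + 3 ≤ (c₂ * (B - 1)) ^ γ := by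
    set c := (c₁ + c₂) / 2 with hcdef
    have hcc₁ : c₁ < c := by rw [hcdef]; linarith
    have hcc₂ : c < c₂ := by rw [hcdef]; linarith
    have hpow : c₁ ^ γ < c ^ γ := Real.rpow_lt_rpow hc₁.le hcc₁ hγ0
    have h1 : ∀ᶠ B : ℝ in atTop, 3 / (c ^ γ - c₁ ^ γ) ≤ B ^ γ :=
      (tendsto_rpow_atTop hγ0).eventually_ge_atTop _
    obtain ⟨B, hb1, hb2, hb3⟩ := (h1.and ((eventually_ge_atTop 2).and
      (eventually_ge_atTop ((2 * c + c₂) / (c₂ - c))))).exists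
    refine ⟨B, hb2, ?_⟩
    rw [div_le_iff₀ (by linarith)] at hb1 hb3
    have h4 : (c * (B + 2)) ^ γ ≤ (c₂ * (B - 1)) ^ γ :=
      Real.rpow_le_rpow (mul_nonneg (by linarith) (by linarith)) (by nlinarith) hγ0.le
    have h5 : B ^ γ ≤ (B + 2) ^ γ := Real.rpow_le_rpow (by linarith) (by linarith) hγ0.le
    rw [Real.mul_rpow (by linarith) (by linarith)] at h4 ⊢
    nlinarith
  refine ⟨B + 2, by linarith, max 2 (2 ^ δ), (by norm_num : (1 : ℝ) ≤ 2).trans (le_max_left _ _),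
    fun n hn => ?_⟩
  have hn2 : 2 ≤ n := (le_max_left _ _).trans hn
  have hn0 : 0 < n := by linarith
  have hnγ : 2 ≤ n ^ γ := by
    have := Real.rpow_le_rpow (by positivity) ((le_max_right _ _).trans hn) hγ0.le
    rwa [← Real.rpow_mul (by norm_num), hγ, mul_one_div_cancel hδ.ne', Real.rpow_one] at this
  have hinv : ∀ y : ℝ, 0 ≤ y → (y ^ γ) ^ δ = y := fun y hy => by
    rw [← Real.rpow_mul hy, hγ, one_div_mul_cancel hδ.ne', Real.rpow_one]
  set lo := (c₁ * (B + 2)) ^ γ * n ^ γ with hlo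
  set hi := (c₂ * (B - 1)) ^ γ * n ^ γ with hhi
  have hlo0 : 0 < lo := by positivity
  have hlo' : lo = (c₁ * (B + 2) * n) ^ γ := by rw [hlo, ← Real.mul_rpow (by positivity) hn0.le]
  have hB1 : 0 < B - 1 := by linarith
  have hc₂ : 0 < c₂ := by linarith
  have hhi' : hi = (c₂ * (B - 1) * n) ^ γ := by rw [hhi, ← Real.mul_rpow (by positivity) hn0.le]
  refine ⟨Finset.Icc ⌈B * n⌉ ⌊B * n + n⌋ ×ˢ Finset.Icc ⌈lo + n ^ γ⌉ ⌊hi - n ^ γ⌋, ?_, ?_⟩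
  · have h1 := le_card_int_Icc (B * n) (B * n + n)
    have h2 := le_card_int_Icc (lo + n ^ γ) (hi - n ^ γ)
    have h3 : 3 * n ^ γ ≤ hi - lo := by rw [hhi, hlo]; nlinarith
    rw [Finset.card_product, Nat.cast_mul, Real.rpow_add hn0, Real.rpow_one]
    calc n * n ^ γ / 4 = (n / 2) * (n ^ γ / 2) := by ring
      _ ≤ _ := mul_le_mul (by linarith) (by linarith) (by positivity) (Nat.cast_nonneg _)
  · intro v hv x₁ x₂ hx₁ hx₂
    rw [Finset.mem_product, Finset.mem_Icc, Finset.mem_Icc, Int.ceil_le, Int.ceil_le,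
      Int.le_floor, Int.le_floor] at hv
    obtain ⟨⟨ht1, ht2⟩, hs1, hs2⟩ := hv
    rw [abs_le] at hx₁ hx₂
    have hs0 : 0 < v.2 + x₂ := by linarith
    have ht0 : (B - 1) * n ≤ v.1 + x₁ := by linarith
    have ht3 : v.1 + x₁ ≤ (B + 2) * n := by linarith
    rw [abs_of_pos hs0]
    refine ⟨by nlinarith, ht3, ?_, ?_⟩
    · calc c₁ * (v.1 + x₁) ≤ c₁ * (B + 2) * n := by rw [mul_assoc]; gcongr
        _ = lo ^ δ := by rw [hlo', hinv _ (by positivity)]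
        _ ≤ _ := Real.rpow_le_rpow hlo0.le (by linarith) hδ.le
    · calc (v.2 + x₂) ^ δ ≤ hi ^ δ := Real.rpow_le_rpow hs0.le (by linarith) hδ.le
        _ = c₂ * (B - 1) * n := by rw [hhi', hinv _ (by positivity)]
        _ ≤ _ := by rw [mul_assoc]; gcongr

section Lower

variable {q₁ q₂ : ℝ} {L₀ : ℝ → ℝ} {a : ℤ × ℤ → ℝ}

/-- At scale n = N(x) the stable box contains about n^D points v with both v and v + x in the
sector, where the leading coefficients are at least of order n^(-q₁). -/
theorem exists_leadCoeff_correlation_ge (ha : IsMACoeff q₁ q₂ L₀ a)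
    (h0 : ¬ (∀ᵐ z ∂(volume.restrict (Set.Icc (-1 : ℝ) 1)), L₀ z = 0)) :
    ∃ c > 0, ∃ R₀ : ℝ, ∀ x, R₀ ≤ aniNorm (q₂ / q₁) x → ∃ G : Finset (ℤ × ℤ),
      c * aniNorm (q₂ / q₁) x ^ (-(2 * q₁ - (1 + 1 / (q₂ / q₁)))) ≤
        ∑ v ∈ G, leadCoeff q₁ q₂ L₀ v * leadCoeff q₁ q₂ L₀ (v + x) := by
  obtain ⟨σ, hσ, c₁, c₂, η, hc₁, hc, hη, hsec⟩ := ha.angular.exists_sector h0 q₁ q₂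
  have hδ := ha.div_pos
  have hq := ha.pos₁
  obtain ⟨C, hC, R₀, hR₀, hbox⟩ := exists_stable_box hδ hc₁ hc
  set δ := q₂ / q₁ with hδdef
  have hσσ : σ * σ = 1 := by rcases hσ with rfl | rfl <;> rfl
  have hσabs : |(σ : ℝ)| = 1 := by rcases hσ with rfl | rfl <;> simp
  have hσ0 : (σ : ℝ) ≠ 0 := by intro h; simp [h] at hσabs
  set A := C * √(1 + c₂ ^ 2) with hA
  have hA0 : 0 < A := by positivity
  have hlead : ∀ t s : ℝ, ∀ n : ℝ, 0 < n → 0 < t → t ≤ C * n → c₁ * t ≤ |s| ^ δ →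
      |s| ^ δ ≤ c₂ * t → η * (A * n) ^ (-q₁) ≤
        rho q₁ q₂ (σ * t) s ^ (-q₁) * L₀ (σ * t / rho q₁ q₂ (σ * t) s) := by
    intro t s n hn ht htn h1 h2
    have hr : rho q₁ q₂ (σ * t) s = t * √(1 + (|s| ^ δ / t) ^ 2) := by
      rw [rho_eq_mul (mul_ne_zero hσ0 ht.ne'), abs_mul, hσabs, one_mul, abs_of_pos ht]
    have hr0 : 0 < rho q₁ q₂ (σ * t) s := by rw [hr]; positivity
    have hle : rho q₁ q₂ (σ * t) s ≤ A * n := by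
      have h3 : |s| ^ δ / t ≤ c₂ := by rwa [div_le_iff₀ ht]
      rw [hr, hA]
      calc _ ≤ (C * n) * √(1 + c₂ ^ 2) := by gcongr
        _ = _ := by ring
    rw [mul_comm]
    exact mul_le_mul (Real.rpow_le_rpow_of_nonpos hr0 hle (by linarith)) (hsec t s ht h1 h2) hη.le
      (Real.rpow_nonneg hr0.le _)
  refine ⟨(η * A ^ (-q₁)) ^ 2 / 4, by positivity, R₀, fun x hx => ?_⟩
  set n := aniNorm δ x with hn
  have hn1 : 1 ≤ n := one_le_aniNorm δ x
  have hn0 : 0 < n := aniNorm_pos δ x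
  obtain ⟨hx1, hx2⟩ := (aniNorm_le_iff hδ hn1 x).1 le_rfl
  obtain ⟨G, hcard, hG⟩ := hbox n hx
  -- The box is built in t > 0; when the sector lies on the other side, it is reflected.
  have hinj : Function.Injective fun v : ℤ × ℤ => (σ * v.1, v.2) := by
    intro u v huv
    simp only [Prod.mk.injEq] at huv
    have : u.1 = v.1 := by
      have := congrArg (fun z => σ * z) huv.1
      simpa [← mul_assoc, hσσ] using this
    exact Prod.ext this huv.2
  refine ⟨G.map ⟨_, hinj⟩, ?_⟩
  rw [Finset.sum_map]
  have hterm : ∀ v ∈ G, (η * (A * n) ^ (-q₁)) ^ 2 ≤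
      leadCoeff q₁ q₂ L₀ (σ * v.1, v.2) * leadCoeff q₁ q₂ L₀ ((σ * v.1, v.2) + x) := by
    intro v hv
    have b0 : 0 ≤ η * (A * n) ^ (-q₁) := by positivity
    obtain ⟨u1, u2, u3, u4⟩ := hG v hv 0 0 (by simpa using hn0.le)
      (by simpa using Real.rpow_nonneg hn0.le _)
    rw [add_zero] at u1 u2 u3 u4
    rw [add_zero] at u3 u4
    have hx1' : |(σ : ℝ) * x.1| ≤ n := by rw [abs_mul, hσabs, one_mul]; exact hx1
    obtain ⟨w1, w2, w3, w4⟩ := hG v hv (σ * x.1) x.2 hx1' hx2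
    have l1 := hlead v.1 v.2 n hn0 u1 u2 u3 u4
    have l2 := hlead _ _ n hn0 w1 w2 w3 w4
    have e2 : (σ : ℝ) * (v.1 + σ * x.1) = σ * v.1 + x.1 := by
      have : (σ : ℝ) * σ = 1 := by exact_mod_cast hσσ
      rw [mul_add, ← mul_assoc, this, one_mul]
    rw [e2] at l2
    rw [sq]
    refine mul_le_mul ?_ ?_ b0 (b0.trans ?_)
    · simpa [leadCoeff] using l1
    · simpa [leadCoeff] using l2
    · simpa [leadCoeff] using l1
  calc (η * A ^ (-q₁)) ^ 2 / 4 * n ^ (-(2 * q₁ - (1 + 1 / δ)))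
      = (n ^ (1 + 1 / δ) / 4) * (η * (A * n) ^ (-q₁)) ^ 2 := by
        rw [Real.mul_rpow hA0.le hn0.le]
        have : n ^ (-(2 * q₁ - (1 + 1 / δ))) = n ^ (1 + 1 / δ) * (n ^ (-q₁)) ^ 2 := by
          rw [← Real.rpow_natCast, ← Real.rpow_mul hn0.le, ← Real.rpow_add hn0]
          congr 1; push_cast; ring
        rw [this]; ring
    _ ≤ G.card * (η * (A * n) ^ (-q₁)) ^ 2 := by gcongr
    _ = ∑ v ∈ G, (η * (A * n) ^ (-q₁)) ^ 2 := by simp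
    _ ≤ _ := Finset.sum_le_sum hterm

/-- `D < 2q₁` and `q₁ < D` where `D = 1 + q₁/q₂`. -/
theorem IsMACoeff.exponents (ha : IsMACoeff q₁ q₂ L₀ a) :
    q₁ < 1 + 1 / (q₂ / q₁) ∧ 1 + 1 / (q₂ / q₁) < 2 * q₁ := by
  have h1 := ha.pos₁
  have h2 := ha.pos₂
  have e : 1 + 1 / (q₂ / q₁) = q₁ * expQ q₁ q₂ := by rw [expQ]; field_simp
  rw [e]
  constructor
  · nlinarith [ha.one_lt_Q]
  · nlinarith [ha.Q_lt_two]

/-- Replacing the coefficients by their leading terms costs η times the weight correlation, which is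
small relative to the main term, plus correlations of total exponent 3, which are O(N^(-q₁)) and
hence negligible far out. Nonnegativity of the leading terms lets the sum over the box survive in
every larger finite set. -/
theorem IsMACoeff.exists_correlation_ge (ha : IsMACoeff q₁ q₂ L₀ a)
    (h0 : ¬ (∀ᵐ z ∂(volume.restrict (Set.Icc (-1 : ℝ) 1)), L₀ z = 0)) :
    ∃ c > 0, ∃ R₀ : ℝ, ∀ x, R₀ ≤ aniNorm (q₂ / q₁) x → ∀ᶠ F : Finset (ℤ × ℤ) in atTop,
      c * aniNorm (q₂ / q₁) x ^ (-(2 * q₁ - (1 + 1 / (q₂ / q₁)))) ≤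
        ∑ u ∈ F, a (-u) * a (x - u) := by
  classical
  obtain ⟨hD1, hD2⟩ := ha.exponents
  have hδ := ha.div_pos
  have hq := ha.pos₁
  obtain ⟨c, hc, R₀, hlead⟩ := exists_leadCoeff_correlation_ge ha h0
  obtain ⟨A, hA, hAa⟩ := ha.exists_abs_le
  obtain ⟨A', hA', hAl⟩ := ha.exists_leadCoeff_le
  set δ := q₂ / q₁ with hδdef
  set D := 1 + 1 / δ with hD
  obtain ⟨C₁, hC₁, -, H11⟩ := exists_aniWt_correlation_le hδ hq hD1 hD2
  obtain ⟨C₂, hC₂, H21, -⟩ := exists_aniWt_higher_correlation_le hδ hq hD1 hD2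
  set M := A + A' with hM
  have hM0 : 0 < M := by linarith
  -- Chosen so that 2MηC₁ = c/4; the exponent-3 terms use another c/4, leaving half of c.
  set η := c / (8 * M * C₁) with hη
  have hη0 : 0 < η := by positivity
  obtain ⟨E, hE, hrem⟩ := ha.exists_remainder_le hη0
  have hR1 : ∀ᶠ n : ℝ in atTop, n ^ (-(D - q₁)) ≤ c / (8 * M * (E + 1) * C₂) :=
    ((tendsto_rpow_neg_atTop (by linarith : 0 < D - q₁)).eventually_lt_const
      (by positivity)).mono fun _ h => le_of_lt h
  obtain ⟨R₁, hR₁⟩ := eventually_atTop.1 hR1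
  refine ⟨c / 2, by positivity, max R₀ R₁, fun x hx => ?_⟩
  obtain ⟨G, hG⟩ := hlead x ((le_max_left _ _).trans hx)
  filter_upwards [eventually_ge_atTop (G.map (Equiv.neg (ℤ × ℤ)).toEmbedding)] with F hF
  rw [sum_aniWt_reflect (fun v w => a v * a w)]
  set F' := F.map (Equiv.neg (ℤ × ℤ)).toEmbedding with hF'
  have hGF : G ⊆ F' := by
    intro v hv
    have h1 : -v ∈ F := hF (Finset.mem_map.2 ⟨v, hv, rfl⟩)
    exact Finset.mem_map.2 ⟨-v, h1, by simp⟩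
  set n := aniNorm δ x with hn
  have hn0 : 0 < n := aniNorm_pos δ x
  set X := n ^ (-(2 * q₁ - D)) with hX
  have hX0 : 0 < X := Real.rpow_pos_of_pos hn0 _
  set Z := aniWt δ q₁ x with hZ
  have hZX : Z ≤ c / (8 * M * (E + 1) * C₂) * X := by
    have : Z = n ^ (-(D - q₁)) * X := by
      rw [hZ, hX, aniWt, ← Real.rpow_add hn0]; congr 1; ring
    rw [this]
    exact mul_le_mul_of_nonneg_right (hR₁ n ((le_max_right _ _).trans hx)) hX0.le
  have hpt : ∀ v, leadCoeff q₁ q₂ L₀ v * leadCoeff q₁ q₂ L₀ (v + x) -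
      (2 * M * η * (aniWt δ q₁ v * aniWt δ q₁ (v + x)) +
        M * E * (aniWt δ q₁ v ^ 2 * aniWt δ q₁ (v + x) ^ 1 +
          aniWt δ q₁ v ^ 1 * aniWt δ q₁ (v + x) ^ 2)) ≤ a v * a (v + x) := by
    intro v
    have hb : ∀ s t s₀ t₀ w z : ℝ, 0 < w → 0 < z → 0 ≤ s₀ → s₀ ≤ A' * w → |t| ≤ A * z →
        |s - s₀| ≤ η * w + E * w ^ 2 → |t - t₀| ≤ η * z + E * z ^ 2 →
        s₀ * t₀ - (2 * M * η * (w * z) + M * E * (w ^ 2 * z ^ 1 + w ^ 1 * z ^ 2)) ≤ s * t := by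
      intro s t s₀ t₀ w z hw hz hs0 hs ht h1 h2
      have k1 : |s₀ * (t - t₀)| ≤ (M * w) * (η * z + E * z ^ 2) := by
        rw [abs_mul, abs_of_nonneg hs0]
        exact mul_le_mul (hs.trans (by gcongr; linarith)) h2 (abs_nonneg _) (by positivity)
      have k2 : |(s - s₀) * t| ≤ (η * w + E * w ^ 2) * (M * z) := by
        rw [abs_mul]
        exact mul_le_mul h1 (ht.trans (by gcongr; linarith)) (abs_nonneg _) (by positivity)
      have k1' := (abs_le.1 k1).1
      have k2' := (abs_le.1 k2).1
      have e : s * t = s₀ * t₀ + s₀ * (t - t₀) + (s - s₀) * t := by ring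
      rw [e]
      nlinarith
    exact hb _ _ _ _ _ _ (aniWt_pos δ q₁ v) (aniWt_pos δ q₁ (v + x)) (ha.leadCoeff_nonneg v)
      (hAl v) (hAa (v + x)) (hrem v) (hrem (v + x))
  have hsum : ∑ v ∈ G, leadCoeff q₁ q₂ L₀ v * leadCoeff q₁ q₂ L₀ (v + x) ≤
      ∑ v ∈ F', leadCoeff q₁ q₂ L₀ v * leadCoeff q₁ q₂ L₀ (v + x) :=
    Finset.sum_le_sum_of_subset_of_nonneg hGF fun v _ _ =>
      mul_nonneg (ha.leadCoeff_nonneg v) (ha.leadCoeff_nonneg (v + x))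
  have hfin := Finset.sum_le_sum fun v (_ : v ∈ F') => hpt v
  rw [Finset.sum_sub_distrib, Finset.sum_add_distrib, ← Finset.mul_sum, ← Finset.mul_sum,
    Finset.sum_add_distrib] at hfin
  have s1 := H11 x F'
  have s2 := H21 2 1 (by norm_num) le_rfl (by norm_num) x F'
  have s3 := H21 1 2 le_rfl (by norm_num) (by norm_num) x F'
  have t1 : 2 * M * η * ∑ v ∈ F', aniWt δ q₁ v * aniWt δ q₁ (v + x) ≤ c / 4 * X := by
    calc _ ≤ 2 * M * η * (C₁ * X) := by gcongr
      _ = _ := by rw [hη]; field_simp; norm_num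
  have t2 : M * E * (∑ v ∈ F', aniWt δ q₁ v ^ 2 * aniWt δ q₁ (v + x) ^ 1 +
      ∑ v ∈ F', aniWt δ q₁ v ^ 1 * aniWt δ q₁ (v + x) ^ 2) ≤ c / 4 * X := by
    calc _ ≤ M * (E + 1) * (C₂ * Z + C₂ * Z) := by
          have hZ0 : 0 < Z := aniWt_pos δ q₁ x
          refine mul_le_mul (by gcongr; linarith) (add_le_add s2 s3) ?_ (by positivity)
          exact add_nonneg
            (Finset.sum_nonneg fun v _ => by
              have := aniWt_pos δ q₁ v; have := aniWt_pos δ q₁ (v + x); positivity)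
            (Finset.sum_nonneg fun v _ => by
              have := aniWt_pos δ q₁ v; have := aniWt_pos δ q₁ (v + x); positivity)
      _ = 2 * M * (E + 1) * C₂ * Z := by ring
      _ ≤ 2 * M * (E + 1) * C₂ * (c / (8 * M * (E + 1) * C₂) * X) := by gcongr
      _ = _ := by field_simp; norm_num
  linarith
end Lower

/-! ### Summability of powers of the anisotropic size -/

section SizeSums

variable {δ : ℝ}

theorem finite_setOf_aniNorm_le (hδ : 0 < δ) (R : ℝ) : {v : ℤ × ℤ | aniNorm δ v ≤ R}.Finite := by
  by_contra hinf
  have h1 : ∀ v ∈ {v : ℤ × ℤ | aniNorm δ v ≤ R}, aniNorm δ v ≤ max 1 R := fun v hv =>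
    le_trans hv (le_max_right _ _)
  obtain ⟨n, hn⟩ := exists_nat_gt (9 * max 1 R ^ (1 + 1 / δ))
  obtain ⟨F, hF, hcard⟩ := Set.Infinite.exists_subset_card_eq hinf n
  have := card_aniNorm_le hδ (le_max_left 1 R) F fun v hv => h1 v (hF hv)
  rw [hcard] at this
  linarith

theorem summable_aniNorm_rpow (hδ : 0 < δ) {e : ℝ} (he : 1 + 1 / δ < e) :
    Summable fun v : ℤ × ℤ => aniNorm δ v ^ (-e) := by
  have hD : 0 < 1 + 1 / δ := by positivity
  obtain ⟨C, hC, H⟩ := exists_sum_tail_le (one_le_aniNorm δ)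
    (fun R hR F hF => card_aniNorm_le hδ hR F hF) (by norm_num) (hD.trans he) he
  refine summable_of_sum_le (c := C) (fun v => Real.rpow_nonneg (aniNorm_pos δ v).le _) fun F => ?_
  simpa using H 1 one_pos F fun v _ => one_le_aniNorm δ v

/-- At least n · n^(1/δ) points of the positive quadrant have size at most n, so partial sums exceed
n^(D-e) for every n ≥ 1. -/
theorem not_summable_aniNorm_rpow (hδ : 0 < δ) {e : ℝ} (he0 : 0 < e) (he : e < 1 + 1 / δ) :
    ¬ Summable fun v : ℤ × ℤ => aniNorm δ v ^ (-e) := by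
  intro hs
  have hle : ∀ n : ℝ, 1 ≤ n → n ^ (1 + 1 / δ - e) ≤ ∑' v : ℤ × ℤ, aniNorm δ v ^ (-e) := by
    intro n hn
    have hn0 : 0 < n := by linarith
    have hfl : ∀ y : ℝ, 0 ≤ y → y ≤ ((Finset.Icc (0 : ℤ) ⌊y⌋).card : ℝ) := by
      intro y hy
      have h1 : (⌊y⌋ + 1 : ℤ) ≤ ((Finset.Icc (0 : ℤ) ⌊y⌋).card : ℤ) := by
        rw [Int.card_Icc, sub_zero]; exact Int.self_le_toNat _
      have h2 : ((⌊y⌋ + 1 : ℤ) : ℝ) ≤ ((Finset.Icc (0 : ℤ) ⌊y⌋).card : ℝ) := by exact_mod_cast h1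
      have := Int.lt_floor_add_one y
      push_cast at h2
      linarith
    set G := Finset.Icc (0 : ℤ) ⌊n⌋ ×ˢ Finset.Icc (0 : ℤ) ⌊n ^ (1 / δ)⌋
    calc n ^ (1 + 1 / δ - e) = (n * n ^ (1 / δ)) * n ^ (-e) := by
          rw [sub_eq_add_neg, Real.rpow_add hn0, Real.rpow_add hn0, Real.rpow_one]
      _ ≤ G.card * n ^ (-e) := by
          rw [Finset.card_product, Nat.cast_mul]
          gcongr
          exacts [hfl n hn0.le, hfl _ (by positivity)]
      _ = ∑ v ∈ G, n ^ (-e) := by simp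
      _ ≤ ∑ v ∈ G, aniNorm δ v ^ (-e) := by
          refine Finset.sum_le_sum fun v hv => ?_
          rw [Finset.mem_product, Finset.mem_Icc, Finset.mem_Icc, Int.le_floor, Int.le_floor] at hv
          refine Real.rpow_le_rpow_of_nonpos (aniNorm_pos δ v) ?_ (by linarith)
          rw [aniNorm_le_iff hδ hn, abs_of_nonneg (by exact_mod_cast hv.1.1),
            abs_of_nonneg (by exact_mod_cast hv.2.1)]
          exact ⟨hv.1.2, hv.2.2⟩
      _ ≤ _ := hs.sum_le_tsum G fun v _ => Real.rpow_nonneg (aniNorm_pos δ v).le _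
  obtain ⟨n, h1, h2⟩ := ((eventually_ge_atTop 1).and ((tendsto_rpow_atTop
    (by linarith : 0 < 1 + 1 / δ - e)).eventually_gt_atTop
      (∑' v : ℤ × ℤ, aniNorm δ v ^ (-e)))).exists
  exact absurd (hle n h1) (not_le.2 h2)

theorem summable_abs_int_rpow_iff {b : ℝ} (hb : 0 < b) :
    (Summable fun n : ℤ => max 1 |(n : ℝ)| ^ (-b)) ↔ 1 < b := by
  have hmax : ∀ n : ℤ, n ≠ 0 → max 1 |(n : ℝ)| = |(n : ℝ)| := fun n hn =>
    max_eq_right (one_le_abs_intCast hn)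
  constructor
  · intro h
    have h1 : Summable fun n : ℕ => (n : ℝ) ^ (-b) := by
      refine Summable.of_norm_bounded (h.comp_injective Nat.cast_injective) fun n => ?_
      rw [Real.norm_of_nonneg (by positivity)]
      simp only [Function.comp_apply]
      rcases Nat.eq_zero_or_pos n with rfl | hn
      · rw [Nat.cast_zero, Real.zero_rpow (by linarith)]; positivity
      · rw [hmax _ (by exact_mod_cast hn.ne')]
        simp
    rw [Real.summable_nat_rpow] at h1
    linarith
  · intro h
    refine Summable.of_norm_bounded_eventually (Real.summable_abs_int_rpow h) ?_
    filter_upwards [(Set.finite_singleton (0 : ℤ)).compl_mem_cofinite] with n hn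
    rw [Real.norm_of_nonneg (by positivity), hmax n (by simpa using hn)]

theorem aniNorm_snd (hδ : 0 < δ) (s : ℤ) : aniNorm δ (0, s) = max 1 |(s : ℝ)| ^ δ := by
  have : (0 : ℝ) ≤ |(s : ℝ)| ^ δ := by positivity
  rw [(Real.monotoneOn_rpow_Ici_of_exponent_nonneg hδ.le).map_max (by simp) (by simp)]
  simp [aniNorm, this]

theorem aniNorm_fst (hδ : 0 < δ) (t : ℤ) : aniNorm δ (t, 0) = max 1 |(t : ℝ)| := by
  simp [aniNorm, Real.zero_rpow hδ.ne']

/-- Summability along an injective family of sites of a function comparable to `aniNorm ^ (-e)`. -/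
theorem summable_abs_comp_iff (hδ : 0 < δ) {e : ℝ} {r : ℤ × ℤ → ℝ} {C c R : ℝ} (hc : 0 < c)
    (hup : ∀ x, |r x| ≤ C * aniNorm δ x ^ (-e))
    (hlow : ∀ x, R ≤ aniNorm δ x → c * aniNorm δ x ^ (-e) ≤ r x) {ι : Type*} {φ : ι → ℤ × ℤ}
    (hφ : Function.Injective φ) :
    (Summable fun i => |r (φ i)|) ↔ Summable fun i => aniNorm δ (φ i) ^ (-e) := by
  constructor
  · intro h
    refine Summable.of_norm_bounded_eventually (h.mul_left c⁻¹) ?_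
    -- The lower bound can fail only at finitely many sites, hence at finitely many indices by
    -- injectivity.
    have hfin := (finite_setOf_aniNorm_le hδ R).preimage hφ.injOn
    filter_upwards [hfin.compl_mem_cofinite] with i hi
    have hi' : R ≤ aniNorm δ (φ i) := by
      simp only [Set.mem_compl_iff, Set.mem_preimage, Set.mem_ofPred_eq, not_le] at hi
      exact hi.le
    rw [Real.norm_of_nonneg (Real.rpow_nonneg (aniNorm_pos δ _).le _), le_inv_mul_iff₀ hc]
    exact (hlow _ hi').trans (le_abs_self _)
  · intro h
    refine Summable.of_nonneg_of_le (fun i => abs_nonneg _) (fun i => hup (φ i)) (h.mul_left C)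

end SizeSums

/-! ### Covariance bounds and the theorem -/

section Main

set_option linter.unusedSectionVars false

variable {Ω : Type*} [MeasurableSpace Ω] {μ : Measure Ω} [IsProbabilityMeasure μ]
  {q₁ q₂ : ℝ} {L₀ : ℝ → ℝ} {a : ℤ × ℤ → ℝ} {ε Y : ℤ × ℤ → Ω → ℝ} {k : ℕ}

theorem IsMACoeff.summable_sq (ha : IsMACoeff q₁ q₂ L₀ a) : Summable fun v => a v ^ 2 := by
  obtain ⟨hD1, hD2⟩ := ha.exponents
  obtain ⟨A, hA, hAa⟩ := ha.exists_abs_le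
  obtain ⟨C, hC, H, -⟩ := exists_aniWt_correlation_le ha.div_pos ha.pos₁ hD1 hD2
  refine summable_of_sum_le (c := A ^ 2 * C) (fun v => sq_nonneg _) fun F => ?_
  calc _ ≤ ∑ v ∈ F, A ^ 2 * aniWt (q₂ / q₁) q₁ v ^ 2 := by
        refine Finset.sum_le_sum fun v _ => ?_
        rw [← sq_abs, ← mul_pow]
        exact pow_le_pow_left₀ (abs_nonneg _) (hAa v) 2
    _ ≤ _ := by rw [← Finset.mul_sum]; gcongr; exact H F

theorem IsStandardIID.memLp_of_moment (hε : IsStandardIID ε μ) (hk : 1 ≤ k)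
    (hmom : ∀ x, Integrable (fun ω => |ε x ω| ^ (2 * k)) μ) (u : ℤ × ℤ) :
    MemLp (ε u) (2 * k : ℕ) μ := by
  have h0 : ((2 * k : ℕ) : ENNReal) ≠ 0 := by exact_mod_cast (by omega : 2 * k ≠ 0)
  rw [← integrable_norm_rpow_iff (hε.measurable u).aestronglyMeasurable h0
    (ENNReal.natCast_ne_top _), ENNReal.toReal_natCast]
  simpa only [Real.rpow_natCast, Real.norm_eq_abs] using hmom u

theorem IsMovingAverage.tendsto_linComb (hε : IsStandardIID ε μ) (ha : IsMACoeff q₁ q₂ L₀ a)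
    (hY : IsMovingAverage a ε Y μ) (hk : 1 ≤ k)
    (hmom : ∀ x, Integrable (fun ω => |ε x ω| ^ (2 * k)) μ) (x : ℤ × ℤ) :
    MemLp (Y x) (2 * k : ℕ) μ ∧ Tendsto (fun F => eLpNorm (linComb ε (fun u => a (x - u)) F - Y x)
      (2 * k : ℕ) μ) atTop (𝓝 0) :=
  hε.tendsto_linComb hk (hε.memLp_of_moment hk hmom)
    (ha.summable_sq.comp_injective (Equiv.subLeft x).injective) (hY.memLp x) (hY.tendsto x)

/-- The covariance of the subordinated field as a limit of coefficients. -/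
theorem IsMovingAverage.tendsto_covFun (hε : IsStandardIID ε μ) (ha : IsMACoeff q₁ q₂ L₀ a)
    (hY : IsMovingAverage a ε Y μ) (hk : 1 ≤ k)
    (hmom : ∀ x, Integrable (fun ω => |ε x ω| ^ (2 * k)) μ) (x : ℤ × ℤ) :
    Tendsto (fun F => (k.factorial : ℝ) ^ 2 * PowerSeries.coeff k (PowerSeries.coeff k
        (∏ u ∈ F, covSeries (fun l => ∫ ω, ε 0 ω ^ l ∂μ) (a (-u)) (a (x - u))))) atTop
      (𝓝 (covFun (appellField k Y μ) μ x)) := by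
  obtain ⟨h0, h0'⟩ := hY.tendsto_linComb hε ha hk hmom (0, 0)
  obtain ⟨h1, h1'⟩ := hY.tendsto_linComb hε ha hk hmom x
  have h := hε.tendsto_coeff_prod_covSeries (hε.memLp_of_moment hk hmom) h0 h1 h0' h1'
  have e : ∀ u : ℤ × ℤ, ((0, 0) : ℤ × ℤ) - u = -u := fun u => zero_sub u
  simp only [e] at h
  exact h

/-- Two-sided bounds for the covariance function of the subordinated field. -/
theorem IsMovingAverage.covFun_bounds (hε : IsStandardIID ε μ) (ha : IsMACoeff q₁ q₂ L₀ a)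
    (hY : IsMovingAverage a ε Y μ) (hk : 1 ≤ k)
    (hmom : ∀ x, Integrable (fun ω => |ε x ω| ^ (2 * k)) μ) :
    (∃ C, ∀ x, |covFun (appellField k Y μ) μ x| ≤
      C * (aniNorm (q₂ / q₁) x ^ (-(k * expP₁ q₁ q₂)) + aniNorm (q₂ / q₁) x ^ (-(2 * q₁)))) ∧
    (¬ (∀ᵐ z ∂(volume.restrict (Set.Icc (-1 : ℝ) 1)), L₀ z = 0) → k * expP₁ q₁ q₂ < 2 * q₁ →
      ∃ c > 0, ∃ R, ∀ x, R ≤ aniNorm (q₂ / q₁) x →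
        c * aniNorm (q₂ / q₁) x ^ (-(k * expP₁ q₁ q₂)) ≤ covFun (appellField k Y μ) μ x) := by
  obtain ⟨hD1, hD2⟩ := ha.exponents
  have hq := ha.pos₁
  have hp : expP₁ q₁ q₂ = 2 * q₁ - (1 + 1 / (q₂ / q₁)) := by
    have := ha.pos₂
    rw [expP₁, expQ]; field_simp
  obtain ⟨A, hA, hAa⟩ := ha.exists_abs_le
  obtain ⟨C, hC, H⟩ := exists_coeff_prod_covSeries_bound ha.div_pos hq hD1 hD2
    (m := fun l => ∫ ω, ε 0 ω ^ l ∂μ) (by simp) hε.integral_one (hε.var_one 0) hk hAa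
  rw [← hp] at H
  set δ := q₂ / q₁ with hδdef
  set p := expP₁ q₁ q₂ with hpdef
  -- Equivalent to q₁ < D. It makes the error Z X^(k-1) negligible against X^k.
  have hpq : p < q₁ := by linarith
  have hp0 : 0 < p := by linarith
  have hXk : ∀ x, aniNorm δ x ^ (-(k * p)) = (aniNorm δ x ^ (-p)) ^ k := fun x => by
    rw [← Real.rpow_natCast, ← Real.rpow_mul (aniNorm_pos δ x).le]; congr 1; ring
  have hZ2 : ∀ x, aniNorm δ x ^ (-(2 * q₁)) = (aniNorm δ x ^ (-q₁)) ^ 2 := fun x => by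
    rw [← Real.rpow_natCast, ← Real.rpow_mul (aniNorm_pos δ x).le]; congr 1; push_cast; ring
  have hpos : ∀ x (e : ℝ), 0 < aniNorm δ x ^ e := fun x e => Real.rpow_pos_of_pos (aniNorm_pos δ x) _
  have hfac : (1 : ℝ) ≤ k.factorial := by exact_mod_cast Nat.factorial_pos k
  have hXX : ∀ x, (aniNorm δ x ^ (-p)) ^ k = aniNorm δ x ^ (-p) * (aniNorm δ x ^ (-p)) ^ (k - 1) :=
    fun x => by rw [← pow_succ', Nat.sub_add_cancel hk]
  have hlim := hY.tendsto_covFun hε ha hk hmom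
  constructor
  · refine ⟨(k.factorial : ℝ) ^ 2 * (C ^ k + C), fun x => ?_⟩
    refine le_of_tendsto (hlim x).abs (Eventually.of_forall fun F => ?_)
    obtain ⟨h1, h2⟩ := H x F
    rw [hXk, hZ2]
    set X := aniNorm δ x ^ (-p) with hX
    set Z := aniNorm δ x ^ (-q₁) with hZ
    set S := ∑ u ∈ F, a (-u) * a (x - u)
    have hX0 : 0 < X := hpos x _
    have hZ0 : 0 < Z := hpos x _
    have hZX : Z ≤ X := Real.rpow_le_rpow_of_exponent_le (one_le_aniNorm δ x) (by linarith)
    have hS : |S ^ k / k.factorial| ≤ C ^ k * X ^ k := by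
      rw [abs_div, abs_pow, Nat.abs_cast, ← mul_pow]
      exact (div_le_self (by positivity) hfac).trans (pow_le_pow_left₀ (abs_nonneg _) h1 k)
    rw [abs_mul, abs_of_nonneg (by positivity : (0 : ℝ) ≤ (k.factorial : ℝ) ^ 2), mul_assoc]
    gcongr
    set g := PowerSeries.coeff k (PowerSeries.coeff k
        (∏ u ∈ F, covSeries (fun l => ∫ ω, ε 0 ω ^ l ∂μ) (a (-u)) (a (x - u))))
    have h3 := abs_add_le (g - S ^ k / k.factorial) (S ^ k / k.factorial)
    rw [sub_add_cancel] at h3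
    have h4 : Z * X ^ (k - 1) ≤ X ^ k := by rw [hXX]; gcongr
    have hCk : 0 ≤ C ^ k * Z ^ 2 := by positivity
    nlinarith
  · intro h0 hlt
    obtain ⟨c, hc, R₀, hlow⟩ := ha.exists_correlation_ge h0
    rw [← hδdef, ← hp] at hlow
    set b := c ^ k / k.factorial with hb
    have hb0 : 0 < b := by positivity
    -- The summands are the sizes of the two errors relative to the main term n^(-kp).
    have hlarge : ∀ᶠ n : ℝ in atTop, n ^ (-(q₁ - p)) + n ^ (-(2 * q₁ - k * p)) < b / (2 * C) := by
      have := (tendsto_rpow_neg_atTop (by linarith : 0 < q₁ - p)).add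
        (tendsto_rpow_neg_atTop (by linarith : 0 < 2 * q₁ - k * p))
      rw [add_zero] at this
      exact this.eventually_lt_const (by positivity)
    obtain ⟨R₁, hR₁⟩ := eventually_atTop.1 hlarge
    refine ⟨(k.factorial : ℝ) ^ 2 * (b / 2), by positivity, max R₀ R₁, fun x hx => ?_⟩
    refine ge_of_tendsto (hlim x) ?_
    filter_upwards [hlow x ((le_max_left _ _).trans hx)] with F hF
    obtain ⟨-, h2⟩ := H x F
    have hn := hR₁ _ ((le_max_right _ _).trans hx)
    rw [lt_div_iff₀ (by positivity)] at hn
    have hn0 := aniNorm_pos δ x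
    have e1 : aniNorm δ x ^ (-q₁) = aniNorm δ x ^ (-(q₁ - p)) * aniNorm δ x ^ (-p) := by
      rw [← Real.rpow_add hn0]; congr 1; ring
    have e2 : (aniNorm δ x ^ (-q₁)) ^ 2
        = aniNorm δ x ^ (-(2 * q₁ - k * p)) * (aniNorm δ x ^ (-p)) ^ k := by
      rw [← hZ2, ← hXk, ← Real.rpow_add hn0]; congr 1; ring
    rw [e2, e1, mul_assoc, ← hXX, ← add_mul] at h2
    rw [hXk]
    set X := aniNorm δ x ^ (-p) with hX
    have hX0 : 0 < X := hpos x _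
    set S := ∑ u ∈ F, a (-u) * a (x - u)
    have hS : b * X ^ k ≤ S ^ k / k.factorial := by
      rw [hb, div_mul_eq_mul_div, ← mul_pow]
      have := pow_le_pow_left₀ (by positivity) hF k
      gcongr
    have h3 := (abs_le.1 h2).1
    have h4 : C * ((aniNorm δ x ^ (-(q₁ - p)) + aniNorm δ x ^ (-(2 * q₁ - k * p))) * X ^ k)
        ≤ b / 2 * X ^ k := by
      rw [← mul_assoc]
      exact mul_le_mul_of_nonneg_right (by linarith) (by positivity)
    rw [mul_assoc]
    gcongr
    linarith

end Main

theorem mainTheorem11 {Ω : Type*} [MeasurableSpace Ω] (μ : Measure Ω) [IsProbabilityMeasure μ]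
    (q₁ q₂ : ℝ) (L₀ : ℝ → ℝ) (a : ℤ × ℤ → ℝ) (ε Y : ℤ × ℤ → Ω → ℝ) (k : ℕ)
    (hε : IsStandardIID ε μ) (ha : IsMACoeff q₁ q₂ L₀ a) (hY : IsMovingAverage a ε Y μ)
    (hk : 1 ≤ k) (hmom : ∀ x, Integrable (fun ω => |ε x ω| ^ (2 * k)) μ) :
    (∀ x, MemLp (appellField k Y μ x) 2 μ ∧ ∫ ω, appellField k Y μ x ω ∂μ = 0) ∧
    ((k : ℝ) < expP q₁ q₂ → ¬ (∀ᵐ z ∂(volume.restrict (Set.Icc (-1 : ℝ) 1)), L₀ z = 0) →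
      ¬ Summable (fun x : ℤ × ℤ => |covFun (appellField k Y μ) μ x|) ∧
      (¬ Summable (fun s : ℤ => |covFun (appellField k Y μ) μ (0, s)|) ↔
        k * expP₂ q₁ q₂ ≤ 1) ∧
      (¬ Summable (fun t : ℤ => |covFun (appellField k Y μ) μ (t, 0)|) ↔
        k * expP₁ q₁ q₂ ≤ 1)) ∧
    (expP q₁ q₂ < (k : ℝ) →
      Summable (fun x : ℤ × ℤ => |covFun (appellField k Y μ) μ x|)) := by
  obtain ⟨hD1, hD2⟩ := ha.exponents
  have hq := ha.pos₁
  have hq₂ := ha.pos₂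
  have hδ := ha.div_pos
  have hQ : 0 < 2 - expQ q₁ q₂ := sub_pos.2 ha.Q_lt_two
  have hp0 : 0 < expP₁ q₁ q₂ := mul_pos hq hQ
  have hk0 : (0 : ℝ) < k := by exact_mod_cast hk
  have hp₂ : expP₂ q₁ q₂ = q₂ / q₁ * expP₁ q₁ q₂ := by rw [expP₁, expP₂]; field_simp
  -- In the form P = D/p₁, comparing k with P means comparing the decay exponent kp₁ with the
  -- homogeneous dimension D.
  have hP : expP q₁ q₂ = (1 + 1 / (q₂ / q₁)) / expP₁ q₁ q₂ := by
    rw [expP, hp₂]; field_simp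
  obtain ⟨⟨C, hup⟩, hlow⟩ := hY.covFun_bounds hε ha hk hmom
  have hC : 0 ≤ C := by
    have h := (abs_nonneg _).trans (hup 0)
    have hpos : 0 < aniNorm (q₂ / q₁) 0 ^ (-(k * expP₁ q₁ q₂)) +
        aniNorm (q₂ / q₁) 0 ^ (-(2 * q₁)) :=
      add_pos (Real.rpow_pos_of_pos (aniNorm_pos _ _) _) (Real.rpow_pos_of_pos (aniNorm_pos _ _) _)
    exact nonneg_of_mul_nonneg_left h hpos
  refine ⟨fun x => ?_, fun hkP h0 => ?_, fun hkP => ?_⟩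
  · have hx := (hY.tendsto_linComb hε ha hk hmom x).1
    exact ⟨memLp_two_appell hk hx, integral_appell hk hx⟩
  · rw [hP, lt_div_iff₀ hp0] at hkP
    -- Here kp₁ < D < 2q₁, so the N^(-2q₁) error is dominated and the covariance has exact order
    -- N^(-kp₁).
    obtain ⟨c, hc, R, hlow⟩ := hlow h0 (hkP.trans hD2)
    have hup' : ∀ x, |covFun (appellField k Y μ) μ x| ≤
        (C * 2) * aniNorm (q₂ / q₁) x ^ (-(k * expP₁ q₁ q₂)) := by
      intro x
      refine (hup x).trans ?_
      rw [mul_assoc]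
      gcongr
      have : aniNorm (q₂ / q₁) x ^ (-(2 * q₁)) ≤ aniNorm (q₂ / q₁) x ^ (-(k * expP₁ q₁ q₂)) :=
        Real.rpow_le_rpow_of_exponent_le (one_le_aniNorm _ x) (by linarith)
      linarith
    refine ⟨?_, ?_, ?_⟩
    · rw [summable_abs_comp_iff hδ hc hup' hlow (φ := fun x => x) Function.injective_id]
      exact not_summable_aniNorm_rpow hδ (by positivity) hkP
    · rw [summable_abs_comp_iff hδ hc hup' hlow (φ := fun s => (0, s)) (Prod.mk_right_injective 0)]
      have e : ∀ s : ℤ, aniNorm (q₂ / q₁) (0, s) ^ (-(k * expP₁ q₁ q₂))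
          = max 1 |(s : ℝ)| ^ (-(k * expP₂ q₁ q₂)) := by
        intro s
        rw [aniNorm_snd hδ, ← Real.rpow_mul (by positivity), hp₂]
        congr 1; ring
      simp_rw [e]
      rw [summable_abs_int_rpow_iff (by rw [hp₂]; positivity), not_lt]
    · rw [summable_abs_comp_iff hδ hc hup' hlow (φ := fun t => (t, 0)) (Prod.mk_left_injective 0)]
      simp_rw [aniNorm_fst hδ]
      rw [summable_abs_int_rpow_iff (by positivity), not_lt]
  · rw [hP, div_lt_iff₀ hp0] at hkP
    -- Both exponents exceed D: kp₁ because k > P, and 2q₁ because Q < 2.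
    exact Summable.of_nonneg_of_le (fun x => abs_nonneg _) hup
      (((summable_aniNorm_rpow hδ hkP).add (summable_aniNorm_rpow hδ hD2)).mul_left C)
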